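/- **Conventions.** Let $\mathbb S^5\subset\mathbb C^3$ be the unit sphere with its standard metric, let $\langle\cdot,\cdot\rangle$ be the real inner product of $\mathbb C^3$, let $\mathbf R_z=-iz$ be the Reeb field, $\alpha=\langle\cdot,\mathbf R\rangle$ the contact form and $J v=i\,(v-\alpha(v)\mathbf R)$ for $v\in T\mathbb S^5$ (so that $\bar\nabla_X\mathbf R=-JX$). Let $\Sigma$ be a smooth surface (Hausdorff, second countable, without boundary) and $f:\Sigma\to\mathbb S^5$ a smooth Legendrian immersion, i.e. $\alpha(df(X))=0$ for all tangent vectors $X$. Let $B$ be its second fundamental form in $\mathbb S^5$, $H=\operatorname{tr}B$ its mean curvature vector, $\nabla$ and $\operatorname{Div}$ the gradient and the divergence of the induced metric, and $\Delta^{\perp}$ the Laplacian of the normal bundle in $\mathbb S^5$. The Willmore operator is $$\vec W(f)=\tfrac12\Big(\Delta^\perp H+\sum_{i,j}\langle B(e_i,e_j),H\rangle B(e_i,e_j)-\tfrac12|H|^2H\Big),$$ where $\{e_1,e_2\}$ is a local orthonormal tangent frame. A smooth immersion $f:\Sigma\to\mathbb S^5$ is called Willmore if it is a critical point of $W(f)=\int_\Sigma\big(\tfrac14|H|^2+1\big)\,d\mu_f$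 with respect to all smooth compactly supported variations in $\mathbb S^5$. **Proposition.** For every smooth Legendrian immersion $f:\Sigma\to\mathbb S^5$, $$\vec W(f)=\tfrac12\Big\{-J\nabla\operatorname{Div}(JH)+B(JH,JH)-\tfrac12|H|^2H-2\operatorname{Div}(JH)\,\mathbf R\Big\}.$$ In particular, the Euler–Lagrange equation of Willmore Legendrian surfaces in $\mathbb S^5$ is the equation below: $f$ is Willmore if and only if, everywhere on $\Sigma$, $$-J\nabla\operatorname{Div}(JH)+B(JH,JH)-\tfrac12|H|^2H-2\operatorname{Div}(JH)\,\mathbf R=0.$$ -/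

import Mathlib

open scoped Manifold ContDiff

noncomputable section

namespace LegendrianWillmore

/-- The parameter plane `ℝ²`, the model space of surfaces. -/
abbrev Plane : Type := EuclideanSpace ℝ (Fin 2)

/-- `ℂ³`, with the real inner product `⟪z, w⟫ = Re ∑ z̄ₖ wₖ`, which is `inner ℝ z w`. The unit
sphere `{‖z‖ = 1}` of this space is `S⁵`. -/
abbrev C3 : Type := EuclideanSpace ℂ (Fin 3)

/-! ### The contact structure of `S⁵` -/

/-- The Reeb field `R = -i z` of `S⁵`. The sign is the one for which `∇̄_X R = -J X` and, on the
cone `ℂ³ ∖ 0`, `J (r ∂r) = -R`, with `J` the multiplication by `i`. -/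
def reeb (z : C3) : C3 := -(Complex.I • z)

/-- The contact form `α_z(v) = ⟪v, R⟫`, so that `α(R) = 1`; its kernel in `T_z S⁵` is the contact
hyperplane `ξ_z = {v ∈ T_z S⁵ | ⟪v, i z⟫ = 0}`. -/
def contactForm (z v : C3) : ℝ := inner ℝ v (reeb z)

/-- The endomorphism `J` of `T S⁵`: the projection `v ↦ v - α(v) R` to the contact hyperplane,
followed by multiplication by `i`. -/
def contactJ (z v : C3) : C3 := Complex.I • (v - contactForm z v • reeb z)

/-- `f : M → ℂ³` is a smooth Legendrian immersion of the surface `M` into `S⁵`. -/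
structure IsLegendrianImmersion {M : Type*} [TopologicalSpace M] [ChartedSpace Plane M]
    (f : M → C3) : Prop where
  smooth : ContMDiff (𝓡 2) 𝓘(ℝ, C3) ∞ f
  mem_sphere : ∀ p, ‖f p‖ = 1
  immersion : ∀ p, Function.Injective (mfderiv (𝓡 2) 𝓘(ℝ, C3) f p)
  legendrian : ∀ (p : M) (v : TangentSpace (𝓡 2) p),
    contactForm (f p) (mfderiv (𝓡 2) 𝓘(ℝ, C3) f p v) = 0

/-! ### Geometry of an immersed surface in `S⁵` in local coordinates

Here `u : ℝ² → ℂ³` is (the extension by arbitrary values of) a local parametrization of the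
surface: an immersion into `S⁵` of a neighbourhood of the point `x` at which the objects are
evaluated. Vector fields along the surface are `ℂ³`-valued functions of the coordinates. -/

/-- The coordinate derivative `∂ᵢ V` at `x`. -/
def pd {F : Type*} [NormedAddCommGroup F] [NormedSpace ℝ F] (i : Fin 2) (V : Plane → F)
    (x : Plane) : F :=
  fderiv ℝ V x (EuclideanSpace.single i 1)

/-- The induced metric `gᵢⱼ = ⟪∂ᵢu, ∂ⱼu⟫`. -/
def metric (u : Plane → C3) (x : Plane) : Matrix (Fin 2) (Fin 2) ℝ :=
  Matrix.of fun i j => inner ℝ (pd i u x) (pd j u x)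

/-- The inverse metric `gⁱʲ`. -/
def invMetric (u : Plane → C3) (x : Plane) : Matrix (Fin 2) (Fin 2) ℝ := (metric u x)⁻¹

/-- The Christoffel symbol `Γᵏᵢⱼ` of the induced metric. -/
def christoffel (u : Plane → C3) (i j k : Fin 2) (x : Plane) : ℝ :=
  (1 / 2) * ∑ l, invMetric u x k l *
    (pd i (fun y => metric u y j l) x + pd j (fun y => metric u y i l) x
      - pd l (fun y => metric u y i j) x)

/-- The component `Vⁱ = gⁱʲ ⟪v, ∂ⱼu⟫` of a tangent vector `v = Vⁱ ∂ᵢu` (for an arbitrary `v`, of its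
tangential part). -/
def tangentCoord (u : Plane → C3) (x : Plane) (v : C3) (i : Fin 2) : ℝ :=
  ∑ j, invMetric u x i j * inner ℝ v (pd j u x)

/-- The orthogonal projection of `ℂ³` to the normal space of the surface in `S⁵` at `u x`, i.e. to
the orthogonal complement of the span of `∂₀u, ∂₁u, u` (note `u ⟂ ∂ᵢu` and `‖u‖ = 1`). -/
def normalProj (u : Plane → C3) (x : Plane) (v : C3) : C3 :=
  v - ∑ i, tangentCoord u x v i • pd i u x - (inner ℝ v (u x) : ℝ) • u x

/-- The coefficient `Bᵢⱼ = (∂ᵢ∂ⱼu)^⊥` of the second fundamental form of the surface in `S⁵`. -/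
def secondFundCoeff (u : Plane → C3) (i j : Fin 2) (x : Plane) : C3 :=
  normalProj u x (pd i (pd j u) x)

/-- The second fundamental form `B(v, w)` at `u x`, for tangent vectors `v, w` of the surface. -/
def secondFund (u : Plane → C3) (x : Plane) (v w : C3) : C3 :=
  ∑ i, ∑ j, (tangentCoord u x v i * tangentCoord u x w j) • secondFundCoeff u i j x

/-- The mean curvature vector `H = tr B = gⁱʲ Bᵢⱼ` (without a factor `1/2`). -/
def meanCurv (u : Plane → C3) (x : Plane) : C3 :=
  ∑ i, ∑ j, invMetric u x i j • secondFundCoeff u i j x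

/-- The normal connection `∇^⊥_{∂ᵢ} V` of a normal field `V`. -/
def normalConn (u : Plane → C3) (i : Fin 2) (V : Plane → C3) (x : Plane) : C3 :=
  normalProj u x (pd i V x)

/-- The Laplacian `Δ^⊥ V = gⁱʲ (∇^⊥ᵢ ∇^⊥ⱼ V - Γᵏᵢⱼ ∇^⊥ₖ V)` of the normal bundle in `S⁵`. -/
def normalLaplacian (u : Plane → C3) (V : Plane → C3) (x : Plane) : C3 :=
  ∑ i, ∑ j, invMetric u x i j •
    (normalConn u i (normalConn u j V) x - ∑ k, christoffel u i j k x • normalConn u k V x)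

/-- The normal field `∑ ⟪B(eᵢ,eⱼ), V⟫ B(eᵢ,eⱼ)` (orthonormal frame), that is
`gⁱᵏ gʲˡ ⟪Bᵢⱼ, V⟫ Bₖₗ`. -/
def simonsOperator (u : Plane → C3) (x : Plane) (V : C3) : C3 :=
  ∑ i, ∑ j, ∑ k, ∑ l, (invMetric u x i k * invMetric u x j l *
    inner ℝ (secondFundCoeff u i j x) V) • secondFundCoeff u k l x

/-- The Willmore operator of a surface in `S⁵`,
`W⃗ = ½ (Δ^⊥ H + ∑ ⟪B(eᵢ,eⱼ), H⟫ B(eᵢ,eⱼ) - ½ |H|² H)`, with the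
orthonormal-frame sum written as `simonsOperator`. -/
def willmoreOperator (u : Plane → C3) (x : Plane) : C3 :=
  (1 / 2 : ℝ) • (normalLaplacian u (meanCurv u) x + simonsOperator u x (meanCurv u x)
    - ((1 / 2 : ℝ) * ‖meanCurv u x‖ ^ 2) • meanCurv u x)

/-! ### Willmore immersions -/

/-- The measure on `M` carried by the domain of the chart `e` that is given in this chart by the area
element `√(det g) dx` of the immersion `f`. -/
def chartAreaMeasure {M : Type*} [TopologicalSpace M] [MeasurableSpace M]
    (f : M → C3) (e : OpenPartialHomeomorph M Plane) : MeasureTheory.Measure M :=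
  MeasureTheory.Measure.map e.symm
    ((MeasureTheory.volume.restrict e.target).withDensity
      fun x => ENNReal.ofReal √(metric (f ∘ e.symm) x).det)

/-- The area measure `μ_f` of an immersion `f`. The measures of the charts agree on overlaps (change
of variables), so their supremum is the measure that restricts to each of them on its chart. -/
def areaMeasure {M : Type*} [TopologicalSpace M] [ChartedSpace Plane M] [MeasurableSpace M]
    (f : M → C3) : MeasureTheory.Measure M :=
  ⨆ e ∈ IsManifold.maximalAtlas (𝓡 2) ∞ M, chartAreaMeasure f e

/-- The integrand `¼ |H|² + κ` at `p`, with `κ = 1` the sectional curvature of `S⁵`; `H` does not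
depend on the chart in which it is computed. -/
def willmoreDensity {M : Type*} [TopologicalSpace M] [ChartedSpace Plane M]
    (f : M → C3) (p : M) : ℝ :=
  1 / 4 * ‖meanCurv (f ∘ (chartAt Plane p).symm) (chartAt Plane p p)‖ ^ 2 + 1

/-- The Willmore energy `∫_K (¼ |H|² + 1) dμ_f` of the part of the surface over `K`. -/
def willmoreEnergy {M : Type*} [TopologicalSpace M] [ChartedSpace Plane M] [MeasurableSpace M]
    (f : M → C3) (K : Set M) : ℝ :=
  ∫ p in K, willmoreDensity f p ∂(areaMeasure f)

/-- `F` is a smooth variation of `f` in `S⁵`, supported in the compact set `K`. -/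
structure IsVariation {M : Type*} [TopologicalSpace M] [ChartedSpace Plane M]
    (f : M → C3) (K : Set M) (F : ℝ → M → C3) : Prop where
  smooth : ContMDiff (𝓘(ℝ, ℝ).prod (𝓡 2)) 𝓘(ℝ, C3) ∞ (fun q : ℝ × M => F q.1 q.2)
  mem_sphere : ∀ t p, ‖F t p‖ = 1
  start : F 0 = f
  isCompact : IsCompact K
  support : ∀ t, ∀ p ∉ K, F t p = f p

/-- `f` is a Willmore immersion: a critical point of the Willmore functional with respect to all
smooth compactly supported variations in `S⁵` (Legendrian or not). The variation leaves the surface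
fixed outside `K`, so that only the energy over `K` varies. -/
def IsWillmore {M : Type*} [TopologicalSpace M] [ChartedSpace Plane M] [MeasurableSpace M]
    (f : M → C3) : Prop :=
  ∀ (K : Set M) (F : ℝ → M → C3), IsVariation f K F →
    HasDerivAt (fun t => willmoreEnergy (F t) K) 0 0

/-! ### The Willmore operator in terms of `JH` -/

/-- The gradient `∇h = gⁱʲ ∂ᵢh ∂ⱼu` of a function on the surface, as a vector in `ℂ³`. -/
def surfGrad (u : Plane → C3) (h : Plane → ℝ) (x : Plane) : C3 :=
  ∑ i, ∑ j, (invMetric u x i j * pd i h x) • pd j u x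

/-- The divergence `Div V = tr ∇V = gⁱʲ ⟪∂ᵢV, ∂ⱼu⟫` of a tangent field `V` of the surface. -/
def surfDiv (u : Plane → C3) (V : Plane → C3) (x : Plane) : ℝ :=
  ∑ i, ∑ j, invMetric u x i j * inner ℝ (pd i V x) (pd j u x)

/-- The tangent field `J H`. -/
def JH (u : Plane → C3) (x : Plane) : C3 := contactJ (u x) (meanCurv u x)

/-- `-J ∇Div(JH) + B(JH, JH) - ½ |H|² H - 2 Div(JH) R`. -/
def legendrianWillmoreField (u : Plane → C3) (x : Plane) : C3 :=
  -contactJ (u x) (surfGrad u (surfDiv u (JH u)) x) + secondFund u x (JH u x) (JH u x)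
    - ((1 / 2 : ℝ) * ‖meanCurv u x‖ ^ 2) • meanCurv u x
    - (2 * surfDiv u (JH u) x) • reeb (u x)

end LegendrianWillmore

end

open scoped Manifold ContDiff
noncomputable section

namespace LegendrianWillmore

/-! ### Calculus of coordinate derivatives, and multiplication by `i`. -/

section Calculus

variable {F : Type*} [NormedAddCommGroup F] [NormedSpace ℝ F] {Ω : Set Plane} {x : Plane}

/-! In a chart the surface is an immersion `u` into the sphere; let θᵏ be the tangent frame dual to
∂ₖu.

The formula for the Willmore operator. The Legendrian condition makes u, ∂₀u, ∂₁u a complex basis of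
ℂ³ with real Hermitian Gram matrix, so the normal space in S⁵ is spanned by the iθᵏ and iu. In this
frame B is a totally symmetric cubic form without Reeb component, and H is the Maslov form Hₖ, which
is closed. Because ∇̄_X R = -JX, the normal derivative of H in direction j acquires the component
-Hⱼ along iu; the second derivative contributes once more, so Δ^⊥H has component -2 div along iu
(`inner_normalLaplacian_I_self`). Along i∂ₖu a Bochner argument (closedness, then commutation of
derivatives) turns Δ^⊥H into the gradient of the divergence plus two quadratic terms
(`inner_normalLaplacian_I_pd`). One is B(JH,JH); the other is minus the term ∑⟪B,H⟫B of the Willmore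
operator and cancels it (`willmoreOperator_eq`).

The Euler–Lagrange equation. The mean curvature vector in ℂ³ is h = H - 2u, so ¼|H|² + 1 = ¼|h|²:
the energy is the Willmore energy of ℂ³. Moreover √g h = ∑ ∂ₗ(√g θˡ), so the integrand is ¼|∑ ∂ₗ(√g
θˡ)|²/√g, and its time derivative needs only that of √g θˡ (`hasDerivAt_energyDensity`). The
translations of ℂ³ preserve this energy, which is why the Willmore operator is the divergence of a
current (`sum_pd_willmoreCurrent`); with that current the first variation becomes √g⟪W,V⟫ plus a
divergence (`energyVar_eq`), and the divergence integrates to zero when V has compact support in a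
chart.

A general variation field is cut up by a partition of unity
(`isWillmore_of_willmoreOperator_eq_zero`). Conversely, the variation with velocity χW, for a bump
function χ, has first derivative ∫ χ|W|², which is positive if W does not vanish at the centre of χ
(`IsWillmore.willmoreOperator_eq_zero`). -/

theorem _root_.ContDiffOn.differentiableAt_of_isOpen {E : Type*} [NormedAddCommGroup E]
    [NormedSpace ℝ E] {s : Set E} {V : E → F} {x : E} (hV : ContDiffOn ℝ ∞ V s)
    (hs : IsOpen s) (hx : x ∈ s) : DifferentiableAt ℝ V x :=
  (hV.contDiffAt (hs.mem_nhds hx)).differentiableAt (by simp)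

theorem contDiffOn_pd {V : Plane → F} (hV : ContDiffOn ℝ ∞ V Ω) (hΩ : IsOpen Ω) (i : Fin 2) :
    ContDiffOn ℝ ∞ (pd i V) Ω :=
  (hV.fderiv_of_isOpen hΩ (m := ∞) (by simp)).clm_apply contDiffOn_const

theorem pd_congr {V W : Plane → F} (h : V =ᶠ[nhds x] W) (i : Fin 2) : pd i V x = pd i W x := by
  simp only [pd, h.fderiv_eq]

theorem pd_congr_on {V W : Plane → F} (hΩ : IsOpen Ω) (h : Set.EqOn V W Ω) (hx : x ∈ Ω)
    (i : Fin 2) : pd i V x = pd i W x :=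
  pd_congr (h.eventuallyEq_of_mem (hΩ.mem_nhds hx)) i

theorem pd_eventuallyEq {V W : Plane → F} (h : V =ᶠ[nhds x] W) (i : Fin 2) :
    pd i V =ᶠ[nhds x] pd i W :=
  h.eventuallyEq_nhds.mono fun _ hy => pd_congr hy i

@[simp] theorem pd_const (i : Fin 2) (c : F) : pd i (fun _ => c) x = 0 := by
  simp [pd]

theorem pd_add {V W : Plane → F} (hV : DifferentiableAt ℝ V x) (hW : DifferentiableAt ℝ W x)
    (i : Fin 2) : pd i (fun y => V y + W y) x = pd i V x + pd i W x := by
  simp only [pd]; rw [fderiv_fun_add hV hW]; rfl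

theorem pd_sub {V W : Plane → F} (hV : DifferentiableAt ℝ V x) (hW : DifferentiableAt ℝ W x)
    (i : Fin 2) : pd i (fun y => V y - W y) x = pd i V x - pd i W x := by
  simp only [pd]; rw [fderiv_fun_sub hV hW]; rfl

theorem pd_neg {V : Plane → F} (i : Fin 2) : pd i (fun y => -V y) x = -pd i V x := by
  simp only [pd]; rw [fderiv_fun_neg]; rfl

theorem pd_sum {ι : Type*} {s : Finset ι} {V : ι → Plane → F}
    (hV : ∀ k ∈ s, DifferentiableAt ℝ (V k) x) (i : Fin 2) :
    pd i (fun y => ∑ k ∈ s, V k y) x = ∑ k ∈ s, pd i (V k) x := by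
  simp only [pd]; rw [fderiv_fun_sum hV]; simp

theorem pd_smul {f : Plane → ℝ} {V : Plane → F} (hf : DifferentiableAt ℝ f x)
    (hV : DifferentiableAt ℝ V x) (i : Fin 2) :
    pd i (fun y => f y • V y) x = pd i f x • V x + f x • pd i V x := by
  simp only [pd]; rw [fderiv_fun_smul hf hV]; simp [add_comm]

theorem pd_const_smul (c : ℝ) {V : Plane → F} (hV : DifferentiableAt ℝ V x) (i : Fin 2) :
    pd i (fun y => c • V y) x = c • pd i V x := by
  simp only [pd]; rw [fderiv_fun_const_smul hV]; rfl

theorem pd_mul {f h : Plane → ℝ} (hf : DifferentiableAt ℝ f x) (hh : DifferentiableAt ℝ h x)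
    (i : Fin 2) : pd i (fun y => f y * h y) x = pd i f x * h x + f x * pd i h x := by
  simpa using pd_smul hf hh i

theorem pd_const_mul (c : ℝ) {f : Plane → ℝ} (hf : DifferentiableAt ℝ f x) (i : Fin 2) :
    pd i (fun y => c * f y) x = c * pd i f x := by
  simpa using pd_const_smul c hf i

theorem pd_inner {V W : Plane → C3} (hV : DifferentiableAt ℝ V x) (hW : DifferentiableAt ℝ W x)
    (i : Fin 2) : pd i (fun y => (inner ℝ (V y) (W y) : ℝ)) x
      = inner ℝ (pd i V x) (W x) + inner ℝ (V x) (pd i W x) := by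
  simp only [pd]; rw [fderiv_inner_apply ℝ hV hW, add_comm]

theorem pd_comm {V : Plane → F} (hV : ContDiffOn ℝ ∞ V Ω) (hΩ : IsOpen Ω) (hx : x ∈ Ω)
    (i j : Fin 2) : pd i (pd j V) x = pd j (pd i V) x := by
  have hc : ContDiffAt ℝ ∞ V x := hV.contDiffAt (hΩ.mem_nhds hx)
  have hs : IsSymmSndFDerivAt ℝ V x := hc.isSymmSndFDerivAt (by
    simpa using ENat.LEInfty.out)
  have hd : DifferentiableAt ℝ (fderiv ℝ V) x :=
    (hV.fderiv_of_isOpen hΩ (m := ∞) (by simp)).differentiableAt_of_isOpen hΩ hx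
  have key : ∀ a b : Plane, fderiv ℝ (fun y => fderiv ℝ V y a) x b
      = fderiv ℝ (fderiv ℝ V) x b a := fun a b => by
    rw [fderiv_clm_apply hd (differentiableAt_const a)]; simp
  change fderiv ℝ (fun y => fderiv ℝ V y _) x _ = fderiv ℝ (fun y => fderiv ℝ V y _) x _
  rw [key, key]; exact hs _ _

theorem I_smul_smul (a : ℝ) (v : C3) : Complex.I • (a • v) = a • (Complex.I • v) := by
  ext k; simp; ring

@[simp] theorem I_smul_I_smul (v : C3) : Complex.I • (Complex.I • v) = -v := by
  rw [smul_smul, Complex.I_mul_I, neg_one_smul]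

theorem inner_I_smul_I_smul (v w : C3) :
    (inner ℝ (Complex.I • v) (Complex.I • w) : ℝ) = inner ℝ v w := by
  simp only [PiLp.inner_apply, Complex.inner]
  refine Finset.sum_congr rfl fun k _ => ?_
  simp

theorem inner_I_smul_left (v w : C3) :
    (inner ℝ (Complex.I • v) w : ℝ) = -inner ℝ v (Complex.I • w) := by
  rw [← inner_I_smul_I_smul v (Complex.I • w), I_smul_I_smul, inner_neg_right, neg_neg]

theorem inner_I_smul_comm (v w : C3) :
    (inner ℝ v (Complex.I • w) : ℝ) = -inner ℝ w (Complex.I • v) := by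
  rw [real_inner_comm, inner_I_smul_left]

@[simp] theorem inner_I_smul_self (v : C3) : (inner ℝ v (Complex.I • v) : ℝ) = 0 := by
  linarith [inner_I_smul_comm v v]

/-- Multiplication by `i` as a real linear map. -/
def mulI : C3 →L[ℝ] C3 := (Complex.I • ContinuousLinearMap.id ℂ C3).restrictScalars ℝ

theorem contDiffOn_I_smul {V : Plane → C3} (hV : ContDiffOn ℝ ∞ V Ω) :
    ContDiffOn ℝ ∞ (fun y => Complex.I • V y) Ω :=
  mulI.contDiff.comp_contDiffOn hV

theorem pd_I_smul {V : Plane → C3} (hV : DifferentiableAt ℝ V x) (i : Fin 2) :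
    pd i (fun y => Complex.I • V y) x = Complex.I • pd i V x := by
  change fderiv ℝ (fun y => mulI (V y)) x _ = mulI _
  have h : HasFDerivAt (fun y => mulI (V y)) (mulI ∘L fderiv ℝ V x) x :=
    mulI.hasFDerivAt.comp x hV.hasFDerivAt
  rw [h.fderiv]; rfl

end Calculus
end LegendrianWillmore
-- Structure equations of an immersed surface in the sphere.
namespace LegendrianWillmore

/-- `u` is a smooth immersion of the open set `Ω` into the unit sphere. -/
structure IsSphereImmersionOn (u : Plane → C3) (Ω : Set Plane) : Prop where
  isOpen : IsOpen Ω
  smooth : ContDiffOn ℝ ∞ u Ω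
  norm_eq : ∀ x ∈ Ω, ‖u x‖ = 1
  det_pos : ∀ x ∈ Ω, 0 < (metric u x).det

/-- The dual frame `θˡ = gˡᵏ ∂ₖu`. -/
def dualFrame (u : Plane → C3) (l : Fin 2) (x : Plane) : C3 :=
  ∑ k, invMetric u x l k • pd k u x

/-- The area element `√(det g)`. -/
def areaElement (u : Plane → C3) (x : Plane) : ℝ := √(metric u x).det

/-- `v` is normal to the surface in `S⁵` at `u x`. -/
def IsNormalAt (u : Plane → C3) (x : Plane) (v : C3) : Prop :=
  (∀ k, (inner ℝ v (pd k u x) : ℝ) = 0) ∧ (inner ℝ v (u x) : ℝ) = 0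

section Algebra

variable (u : Plane → C3) (x : Plane)

theorem metric_apply (i j : Fin 2) : metric u x i j = inner ℝ (pd i u x) (pd j u x) := rfl

theorem metric_comm (i j : Fin 2) : metric u x i j = metric u x j i := by
  rw [metric_apply, metric_apply, real_inner_comm]

theorem det_metric : (metric u x).det
    = metric u x 0 0 * metric u x 1 1 - metric u x 0 1 * metric u x 0 1 := by
  rw [Matrix.det_fin_two, metric_comm u x 1 0]

theorem invMetric_eq : invMetric u x = (metric u x).det⁻¹ •
    !![metric u x 1 1, -metric u x 0 1; -metric u x 0 1, metric u x 0 0] := by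
  rw [invMetric, Matrix.inv_def, Ring.inverse_eq_inv', Matrix.adjugate_fin_two,
    metric_comm u x 1 0]

theorem invMetric_comm (i j : Fin 2) : invMetric u x i j = invMetric u x j i := by
  rw [invMetric_eq]; fin_cases i <;> fin_cases j <;> simp

variable {u x}

theorem invMetric_mul_metric (hd : (metric u x).det ≠ 0) (i j : Fin 2) :
    ∑ k, invMetric u x i k * metric u x k j = if i = j then 1 else 0 := by
  have h := congrFun (congrFun (Matrix.nonsing_inv_mul (metric u x) hd.isUnit) i) j
  rwa [Matrix.mul_apply, Matrix.one_apply] at h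

theorem tangentCoord_eq (v : C3) (i : Fin 2) :
    tangentCoord u x v i = inner ℝ v (dualFrame u i x) := by
  simp only [tangentCoord, dualFrame, inner_sum, inner_smul_right]

theorem inner_dualFrame_pd (hd : (metric u x).det ≠ 0) (l k : Fin 2) :
    (inner ℝ (dualFrame u l x) (pd k u x) : ℝ) = if l = k then 1 else 0 := by
  rw [← invMetric_mul_metric hd, dualFrame, sum_inner]
  simp only [inner_smul_left, metric_apply]; rfl

theorem inner_dualFrame_dualFrame (hd : (metric u x).det ≠ 0) (l k : Fin 2) :
    (inner ℝ (dualFrame u l x) (dualFrame u k x) : ℝ) = invMetric u x l k := by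
  rw [dualFrame, sum_inner]
  have e := fun i => (real_inner_comm (dualFrame u k x) (pd i u x)).trans
    (inner_dualFrame_pd hd k i)
  simp only [real_inner_smul_left, e]
  simp

theorem sum_inner_smul_dualFrame (v : C3) : ∑ k, (inner ℝ v (pd k u x) : ℝ) • dualFrame u k x
    = ∑ k, tangentCoord u x v k • pd k u x := by
  simp only [dualFrame, tangentCoord, Fin.sum_univ_two, invMetric_comm u x 1 0]
  module

/-- In the dual frame the tangential coefficients are the plain products ⟪v, ∂ₖu⟫, so the inverse
metric disappears from the projection. -/
theorem normalProj_eq (v : C3) : normalProj u x v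
    = v - ∑ k, (inner ℝ v (pd k u x) : ℝ) • dualFrame u k x - (inner ℝ v (u x) : ℝ) • u x := by
  rw [normalProj, sum_inner_smul_dualFrame]

theorem normalProj_add (v w : C3) :
    normalProj u x (v + w) = normalProj u x v + normalProj u x w := by
  simp only [normalProj_eq, inner_add_left, Fin.sum_univ_two]; module

theorem normalProj_smul (c : ℝ) (v : C3) :
    normalProj u x (c • v) = c • normalProj u x v := by
  simp only [normalProj_eq, real_inner_smul_left, Fin.sum_univ_two]; module

theorem normalProj_sum {ι : Type*} (s : Finset ι) (v : ι → C3) :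
    normalProj u x (∑ k ∈ s, v k) = ∑ k ∈ s, normalProj u x (v k) := by
  classical
  induction s using Finset.induction_on with
  | empty => simp [normalProj_eq]
  | insert a s ha ih => rw [Finset.sum_insert ha, Finset.sum_insert ha, normalProj_add, ih]

theorem IsNormalAt.normalProj_eq_self {v : C3} (hv : IsNormalAt u x v) :
    normalProj u x v = v := by
  simp [normalProj_eq, hv.1, hv.2]

theorem IsNormalAt.add {v w : C3} (hv : IsNormalAt u x v) (hw : IsNormalAt u x w) :
    IsNormalAt u x (v + w) :=
  ⟨fun k => by rw [inner_add_left, hv.1, hw.1, add_zero],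
    by rw [inner_add_left, hv.2, hw.2, add_zero]⟩

theorem IsNormalAt.smul (c : ℝ) {v : C3} (hv : IsNormalAt u x v) : IsNormalAt u x (c • v) :=
  ⟨fun k => by rw [real_inner_smul_left, hv.1, mul_zero],
    by rw [real_inner_smul_left, hv.2, mul_zero]⟩

theorem IsNormalAt.sum {ι : Type*} {s : Finset ι} {v : ι → C3}
    (hv : ∀ k ∈ s, IsNormalAt u x (v k)) : IsNormalAt u x (∑ k ∈ s, v k) :=
  ⟨fun k => by rw [sum_inner]; exact Finset.sum_eq_zero fun i hi => (hv i hi).1 k,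
    by rw [sum_inner]; exact Finset.sum_eq_zero fun i hi => (hv i hi).2⟩

theorem IsNormalAt.inner_dualFrame {v : C3} (hv : IsNormalAt u x v) (k : Fin 2) :
    (inner ℝ v (dualFrame u k x) : ℝ) = 0 := by
  simp [dualFrame, inner_add_right, real_inner_smul_right, hv.1]

theorem IsNormalAt.inner_normalProj_left {v n : C3} (hn : IsNormalAt u x n) :
    (inner ℝ (normalProj u x v) n : ℝ) = inner ℝ v n := by
  have h1 := fun k => hn.inner_dualFrame k
  have h2 := hn.2
  simp only [real_inner_comm _ n] at h1 h2
  simp [normalProj_eq, inner_sub_left, inner_add_left, real_inner_smul_left, h1, h2]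

end Algebra

namespace IsSphereImmersionOn

variable {u : Plane → C3} {Ω : Set Plane} (h : IsSphereImmersionOn u Ω) {x : Plane} (hx : x ∈ Ω)
include h

section Smooth

theorem diff {F : Type*} [NormedAddCommGroup F] [NormedSpace ℝ F] {V : Plane → F}
    (hV : ContDiffOn ℝ ∞ V Ω) {x : Plane} (hx : x ∈ Ω) : DifferentiableAt ℝ V x :=
  hV.differentiableAt_of_isOpen h.isOpen hx

theorem smooth_pd (i : Fin 2) : ContDiffOn ℝ ∞ (pd i u) Ω := contDiffOn_pd h.smooth h.isOpen i

theorem smooth_pd_pd (i j : Fin 2) : ContDiffOn ℝ ∞ (pd i (pd j u)) Ω :=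
  contDiffOn_pd (h.smooth_pd j) h.isOpen i

theorem smooth_metric (i j : Fin 2) : ContDiffOn ℝ ∞ (fun y => metric u y i j) Ω :=
  (h.smooth_pd i).inner ℝ (h.smooth_pd j)

theorem smooth_det : ContDiffOn ℝ ∞ (fun y => (metric u y).det) Ω := by
  simp only [det_metric]
  exact ((h.smooth_metric 0 0).mul (h.smooth_metric 1 1)).sub
    ((h.smooth_metric 0 1).mul (h.smooth_metric 0 1))

theorem smooth_invMetric (i j : Fin 2) : ContDiffOn ℝ ∞ (fun y => invMetric u y i j) Ω := by
  have hd := h.smooth_det.inv fun y hy => (h.det_pos y hy).ne'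
  simp only [invMetric_eq]
  fin_cases i <;> fin_cases j
  · exact hd.mul (h.smooth_metric 1 1)
  · exact hd.mul (h.smooth_metric 0 1).neg
  · exact hd.mul (h.smooth_metric 0 1).neg
  · exact hd.mul (h.smooth_metric 0 0)

theorem smooth_dualFrame (l : Fin 2) : ContDiffOn ℝ ∞ (dualFrame u l) Ω :=
  ContDiffOn.sum fun k _ => (h.smooth_invMetric l k).smul (h.smooth_pd k)

theorem smooth_areaElement : ContDiffOn ℝ ∞ (areaElement u) Ω :=
  h.smooth_det.sqrt fun y hy => (h.det_pos y hy).ne'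

theorem smooth_christoffel (i j k : Fin 2) : ContDiffOn ℝ ∞ (christoffel u i j k) Ω :=
  contDiffOn_const.mul <| ContDiffOn.sum fun l _ => (h.smooth_invMetric k l).mul <|
    ((contDiffOn_pd (h.smooth_metric j l) h.isOpen i).add
      (contDiffOn_pd (h.smooth_metric i l) h.isOpen j)).sub
      (contDiffOn_pd (h.smooth_metric i j) h.isOpen l)

theorem smooth_normalProj {V : Plane → C3} (hV : ContDiffOn ℝ ∞ V Ω) :
    ContDiffOn ℝ ∞ (fun y => normalProj u y (V y)) Ω := by
  simp only [normalProj_eq]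
  exact (hV.sub <| ContDiffOn.sum fun k _ =>
    (hV.inner ℝ (h.smooth_pd k)).smul (h.smooth_dualFrame k)).sub
      ((hV.inner ℝ h.smooth).smul h.smooth)

theorem smooth_secondFundCoeff (i j : Fin 2) : ContDiffOn ℝ ∞ (secondFundCoeff u i j) Ω :=
  h.smooth_normalProj (h.smooth_pd_pd i j)

theorem smooth_meanCurv : ContDiffOn ℝ ∞ (meanCurv u) Ω :=
  ContDiffOn.sum fun i _ => ContDiffOn.sum fun j _ =>
    (h.smooth_invMetric i j).smul (h.smooth_secondFundCoeff i j)

theorem smooth_normalConn {V : Plane → C3} (hV : ContDiffOn ℝ ∞ V Ω) (i : Fin 2) :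
    ContDiffOn ℝ ∞ (normalConn u i V) Ω :=
  h.smooth_normalProj (contDiffOn_pd hV h.isOpen i)

end Smooth

include hx

theorem det_ne : (metric u x).det ≠ 0 := (h.det_pos x hx).ne'

theorem areaElement_pos : 0 < areaElement u x := Real.sqrt_pos.2 (h.det_pos x hx)

theorem inner_self : (inner ℝ (u x) (u x) : ℝ) = 1 := by
  rw [real_inner_self_eq_norm_sq, h.norm_eq x hx, one_pow]

theorem inner_pd_self (i : Fin 2) : (inner ℝ (pd i u x) (u x) : ℝ) = 0 := by
  have e := pd_congr_on (W := fun _ => (1 : ℝ)) h.isOpen (fun y hy => h.inner_self hy) hx i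
  rw [pd_inner (h.diff h.smooth hx) (h.diff h.smooth hx), pd_const,
    real_inner_comm (pd i u x)] at e
  linarith

theorem inner_dualFrame_self (i : Fin 2) : (inner ℝ (dualFrame u i x) (u x) : ℝ) = 0 := by
  simp [dualFrame, inner_add_left, real_inner_smul_left, h.inner_pd_self hx]

theorem isNormalAt_normalProj (v : C3) : IsNormalAt u x (normalProj u x v) := by
  constructor
  · intro k
    have := h.inner_pd_self hx k
    rw [real_inner_comm] at this
    simp only [normalProj_eq, inner_sub_left, sum_inner, real_inner_smul_left,
      inner_dualFrame_pd (h.det_ne hx), this]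
    simp
  · simp [normalProj_eq, inner_sub_left, inner_add_left, real_inner_smul_left,
      h.inner_dualFrame_self hx, h.norm_eq x hx]

theorem normalProj_pd (k : Fin 2) : normalProj u x (pd k u x) = 0 := by
  simp [normalProj, tangentCoord_eq, real_inner_comm (dualFrame u _ x) (pd k u x),
    inner_dualFrame_pd (h.det_ne hx), h.inner_pd_self hx]

theorem normalProj_self : normalProj u x (u x) = 0 := by
  have := fun k => h.inner_pd_self hx k
  simp only [real_inner_comm (u x)] at this
  simp [normalProj_eq, this, h.norm_eq x hx]

theorem isNormalAt_secondFundCoeff (i j : Fin 2) : IsNormalAt u x (secondFundCoeff u i j x) :=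
  h.isNormalAt_normalProj hx _

theorem isNormalAt_meanCurv : IsNormalAt u x (meanCurv u x) :=
  IsNormalAt.sum fun i _ => IsNormalAt.sum fun j _ => (h.isNormalAt_secondFundCoeff hx i j).smul _

theorem isNormalAt_normalConn (V : Plane → C3) (i : Fin 2) :
    IsNormalAt u x (normalConn u i V x) := h.isNormalAt_normalProj hx _

theorem pd_pd_comm (i j : Fin 2) : pd i (pd j u) x = pd j (pd i u) x :=
  pd_comm h.smooth h.isOpen hx i j

theorem secondFundCoeff_comm (i j : Fin 2) :
    secondFundCoeff u i j x = secondFundCoeff u j i x := by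
  rw [secondFundCoeff, h.pd_pd_comm hx, secondFundCoeff]

theorem pd_metric (l i j : Fin 2) : pd l (fun y => metric u y i j) x
    = inner ℝ (pd l (pd i u) x) (pd j u x) + inner ℝ (pd i u x) (pd l (pd j u) x) :=
  pd_inner (h.diff (h.smooth_pd i) hx) (h.diff (h.smooth_pd j) hx) l

/-- Koszul's formula: by symmetry of the second derivatives of `u`, the three metric derivatives
collapse to one product. All later arguments use the Christoffel symbols in this form. -/
theorem christoffel_eq (i j k : Fin 2) :
    christoffel u i j k x = inner ℝ (pd i (pd j u) x) (dualFrame u k x) := by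
  simp only [christoffel, dualFrame, inner_sum, real_inner_smul_right, Finset.mul_sum,
    h.pd_metric hx]
  refine Finset.sum_congr rfl fun l _ => ?_
  rw [h.pd_pd_comm hx j i, h.pd_pd_comm hx l i, h.pd_pd_comm hx l j,
    real_inner_comm (pd i (pd l u) x) (pd j u x)]
  ring

theorem christoffel_comm (i j k : Fin 2) : christoffel u i j k x = christoffel u j i k x := by
  rw [h.christoffel_eq hx, h.christoffel_eq hx, h.pd_pd_comm hx]

theorem inner_pd_pd_self (i j : Fin 2) :
    (inner ℝ (pd i (pd j u) x) (u x) : ℝ) = -metric u x i j := by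
  have e := pd_congr_on (W := fun _ => (0 : ℝ)) h.isOpen (fun y hy => h.inner_pd_self hy j) hx i
  rw [pd_inner (h.diff (h.smooth_pd j) hx) (h.diff h.smooth hx), pd_const] at e
  rw [metric_comm, metric_apply]
  linarith

omit h hx in
theorem eq_tangent_add_normal (v : C3) : v = ∑ k, (inner ℝ v (pd k u x) : ℝ) • dualFrame u k x
    + (inner ℝ v (u x) : ℝ) • u x + normalProj u x v := by
  rw [normalProj_eq]; module

/-- The Gauss formula. -/
theorem pd_pd_eq (i j : Fin 2) : pd i (pd j u) x
    = ∑ k, christoffel u i j k x • pd k u x + secondFundCoeff u i j x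
      - metric u x i j • u x := by
  rw [secondFundCoeff, normalProj, h.inner_pd_pd_self hx]
  simp only [tangentCoord_eq, ← h.christoffel_eq hx]
  module

theorem normalProj_pd_dualFrame (j l : Fin 2) : normalProj u x (pd j (dualFrame u l) x)
    = ∑ m, invMetric u x l m • secondFundCoeff u j m x := by
  have e : pd j (dualFrame u l) x = ∑ m, (pd j (fun y => invMetric u y l m) x • pd m u x
      + invMetric u x l m • pd j (pd m u) x) := by
    rw [show dualFrame u l = fun y => ∑ k, invMetric u y l k • pd k u y from rfl, pd_sum]
    · exact Finset.sum_congr rfl fun m _ =>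
        pd_smul (h.diff (h.smooth_invMetric l m) hx) (h.diff (h.smooth_pd m) hx) j
    · exact fun m _ => h.diff ((h.smooth_invMetric l m).smul (h.smooth_pd m)) hx
  rw [e]
  simp only [normalProj_sum, normalProj_add, normalProj_smul, h.normalProj_pd hx, smul_zero,
    zero_add, secondFundCoeff]

/-- Differentiating ⟪θˡ, ∂ₖu⟫ = δ and ⟪θˡ, u⟫ = 0 gives the tangential and radial components; the
normal one comes from the definition of θˡ, as derivatives of the inverse metric only multiply
tangent vectors. -/
theorem pd_dualFrame (j l : Fin 2) : pd j (dualFrame u l) x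
    = -∑ k, christoffel u j k l x • dualFrame u k x
      + ∑ m, invMetric u x l m • secondFundCoeff u j m x - (if l = j then (1 : ℝ) else 0) • u x := by
  have hθ := h.diff (h.smooth_dualFrame l) hx
  have e1 : ∀ k, (inner ℝ (pd j (dualFrame u l) x) (pd k u x) : ℝ) = -christoffel u j k l x := by
    intro k
    have e := pd_congr_on h.isOpen (fun y hy => inner_dualFrame_pd (h.det_ne hy) l k) hx j
    rw [pd_inner hθ (h.diff (h.smooth_pd k) hx), pd_const] at e
    rw [h.christoffel_eq hx, real_inner_comm (dualFrame u l x)]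
    linarith
  have e2 : (inner ℝ (pd j (dualFrame u l) x) (u x) : ℝ) = -(if l = j then (1 : ℝ) else 0) := by
    have e := pd_congr_on h.isOpen (fun y hy => h.inner_dualFrame_self hy l) hx j
    rw [pd_inner hθ (h.diff h.smooth hx), pd_const, inner_dualFrame_pd (h.det_ne hx)] at e
    linarith
  conv_lhs => rw [eq_tangent_add_normal (u := u) (x := x) (pd j (dualFrame u l) x)]
  simp only [e1, e2, h.normalProj_pd_dualFrame hx, neg_smul, Finset.sum_neg_distrib]
  abel

/-- The Weingarten formula. -/
theorem pd_normal {N : Plane → C3} (hN : ContDiffOn ℝ ∞ N Ω) (hn : ∀ y ∈ Ω, IsNormalAt u y (N y))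
    (j : Fin 2) : pd j N x = normalConn u j N x
      - ∑ k, (inner ℝ (secondFundCoeff u j k x) (N x) : ℝ) • dualFrame u k x := by
  have e1 : ∀ k, (inner ℝ (pd j N x) (pd k u x) : ℝ)
      = -inner ℝ (secondFundCoeff u j k x) (N x) := by
    intro k
    have e := pd_congr_on (W := fun _ => (0 : ℝ)) h.isOpen (fun y hy => (hn y hy).1 k) hx j
    rw [pd_inner (h.diff hN hx) (h.diff (h.smooth_pd k) hx), pd_const] at e
    rw [secondFundCoeff, (hn x hx).inner_normalProj_left, real_inner_comm (N x)]
    linarith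
  have e2 : (inner ℝ (pd j N x) (u x) : ℝ) = 0 := by
    have e := pd_congr_on (W := fun _ => (0 : ℝ)) h.isOpen (fun y hy => (hn y hy).2) hx j
    rw [pd_inner (h.diff hN hx) (h.diff h.smooth hx), pd_const, (hn x hx).1] at e
    linarith
  conv_lhs => rw [eq_tangent_add_normal (u := u) (x := x) (pd j N x)]
  simp only [e1, e2, neg_smul, Finset.sum_neg_distrib, normalConn, zero_smul]
  abel

/-- Since gⁱʲ = ⟪θⁱ, θʲ⟫, the parallelism of the metric is read off from `pd_dualFrame`: the normal
and radial parts are orthogonal to the frame. -/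
theorem pd_invMetric (l i j : Fin 2) : pd l (fun y => invMetric u y i j) x
    = -∑ k, (christoffel u l k i x * invMetric u x k j
      + christoffel u l k j x * invMetric u x i k) := by
  have e := pd_congr_on h.isOpen
    (fun y hy => (inner_dualFrame_dualFrame (h.det_ne hy) i j).symm) hx l
  rw [pd_inner (h.diff (h.smooth_dualFrame i) hx) (h.diff (h.smooth_dualFrame j) hx)] at e
  rw [e, real_inner_comm (pd l _ x)]
  have hB := fun i j k => (h.isNormalAt_secondFundCoeff hx i j).inner_dualFrame k
  have hu := fun k => h.inner_dualFrame_self hx k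
  simp only [real_inner_comm (u x)] at hu
  simp only [h.pd_dualFrame hx, inner_sub_left, inner_add_left, inner_neg_left, sum_inner,
    real_inner_smul_left, inner_dualFrame_dualFrame (h.det_ne hx), hB, hu, mul_zero,
    Finset.sum_const_zero, Finset.sum_add_distrib]
  simp only [invMetric_comm u x _ i]
  ring

theorem pd_areaElement (l : Fin 2) : pd l (areaElement u) x
    = areaElement u x * ∑ k, christoffel u l k k x := by
  have hD := h.areaElement_pos hx
  have hd := h.det_ne hx
  -- The square D² = det g is polynomial in the metric, so differentiating it avoids the square
  -- root; the factor 2D is cancelled at the end.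
  have e : pd l (fun y => areaElement u y * areaElement u y) x
      = pd l (fun y => metric u y 0 0 * metric u y 1 1 - metric u y 0 1 * metric u y 0 1) x :=
    pd_congr_on h.isOpen (fun y hy => by
      simp only [areaElement]; rw [Real.mul_self_sqrt (h.det_pos y hy).le, det_metric]) hx l
  have hg := fun i j => h.diff (h.smooth_metric i j) hx
  rw [pd_mul (h.diff h.smooth_areaElement hx) (h.diff h.smooth_areaElement hx),
    pd_sub ((hg 0 0).fun_mul (hg 1 1)) ((hg 0 1).fun_mul (hg 0 1)), pd_mul (hg 0 0) (hg 1 1),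
    pd_mul (hg 0 1) (hg 0 1)] at e
  have hDD : areaElement u x * areaElement u x = (metric u x).det :=
    Real.mul_self_sqrt (h.det_pos x hx).le
  have hs : (metric u x).det * ∑ k, christoffel u l k k x
      = (inner ℝ (pd l (pd 0 u) x) (pd 0 u x)) * metric u x 1 1
        - (inner ℝ (pd l (pd 0 u) x) (pd 1 u x)) * metric u x 0 1
        - (inner ℝ (pd l (pd 1 u) x) (pd 0 u x)) * metric u x 0 1
        + (inner ℝ (pd l (pd 1 u) x) (pd 1 u x)) * metric u x 0 0 := by
    simp only [Fin.sum_univ_two, h.christoffel_eq hx, dualFrame, inner_add_right,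
      real_inner_smul_right, invMetric_eq]
    simp
    field_simp
    ring
  simp only [h.pd_metric hx] at e
  rw [real_inner_comm (pd l (pd 0 u) x) (pd 0 u x), real_inner_comm (pd l (pd 1 u) x) (pd 1 u x),
    real_inner_comm (pd l (pd 1 u) x) (pd 0 u x)] at e
  have : 2 * areaElement u x * pd l (areaElement u) x
      = 2 * areaElement u x * (areaElement u x * ∑ k, christoffel u l k k x) := by
    linear_combination e - 2 * hs + 2 * (∑ k, christoffel u l k k x) * hDD.symm
  exact mul_left_cancel₀ (by positivity) this

end IsSphereImmersionOn
end LegendrianWillmore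
-- The Willmore operator as a divergence.
namespace LegendrianWillmore

/-- The second fundamental form in the direction of the mean curvature vector, `⟪Bᵢⱼ, H⟫`. -/
def secondFundMean (u : Plane → C3) (i j : Fin 2) (x : Plane) : ℝ :=
  inner ℝ (secondFundCoeff u i j x) (meanCurv u x)

/-- The current `√(det g) (½ gˡⁱ ∇^⊥ᵢH + ½ gˡʲ ⟪Bⱼₖ, H⟫ θᵏ - ¼ |H|² θˡ)` without the factor
`√(det g)`; its divergence is the Willmore operator. -/
def willmoreCurrent (u : Plane → C3) (l : Fin 2) (x : Plane) : C3 :=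
  (1 / 2 : ℝ) • ∑ i, invMetric u x l i • normalConn u i (meanCurv u) x
    + (1 / 2 : ℝ) • ∑ j, ∑ k, (invMetric u x l j * secondFundMean u j k x) • dualFrame u k x
    - ((1 / 4 : ℝ) * inner ℝ (meanCurv u x) (meanCurv u x)) • dualFrame u l x

namespace IsSphereImmersionOn

variable {u : Plane → C3} {Ω : Set Plane} (h : IsSphereImmersionOn u Ω) {x : Plane} (hx : x ∈ Ω)
include h

theorem smooth_secondFundMean (i j : Fin 2) : ContDiffOn ℝ ∞ (secondFundMean u i j) Ω :=
  (h.smooth_secondFundCoeff i j).inner ℝ h.smooth_meanCurv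

theorem smooth_normalConn_meanCurv (i : Fin 2) :
    ContDiffOn ℝ ∞ (normalConn u i (meanCurv u)) Ω := h.smooth_normalConn h.smooth_meanCurv i

theorem smooth_willmoreCurrent (l : Fin 2) : ContDiffOn ℝ ∞ (willmoreCurrent u l) Ω := by
  refine ContDiffOn.sub (ContDiffOn.add ?_ ?_) ?_
  · exact ContDiffOn.const_smul _ <| ContDiffOn.sum fun i _ =>
      (h.smooth_invMetric l i).smul (h.smooth_normalConn_meanCurv i)
  · exact ContDiffOn.const_smul _ <| ContDiffOn.sum fun j _ => ContDiffOn.sum fun k _ =>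
      ((h.smooth_invMetric l j).mul (h.smooth_secondFundMean j k)).smul (h.smooth_dualFrame k)
  · exact (contDiffOn_const.mul (h.smooth_meanCurv.inner ℝ h.smooth_meanCurv)).smul
      (h.smooth_dualFrame l)

include hx

theorem secondFundMean_comm (i j : Fin 2) :
    secondFundMean u i j x = secondFundMean u j i x := by
  rw [secondFundMean, h.secondFundCoeff_comm hx, secondFundMean]

omit h hx in
theorem inner_meanCurv_self : (inner ℝ (meanCurv u x) (meanCurv u x) : ℝ)
    = ∑ i, ∑ j, invMetric u x i j * secondFundMean u i j x := by
  have e : ∀ v, (inner ℝ (meanCurv u x) v : ℝ)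
      = ∑ i, ∑ j, invMetric u x i j * inner ℝ (secondFundCoeff u i j x) v := fun v => by
    simp only [meanCurv, sum_inner, real_inner_smul_left]
  exact e _

/-- By the Gauss formula B is ∂ⱼ∂ₖu corrected by tangential and radial terms. Paired with the normal
vector H, the derivatives of the Christoffel symbols and of the metric drop out, and only ∂³u and
one Christoffel sum survive. -/
theorem inner_pd_secondFundCoeff (l j k : Fin 2) :
    (inner ℝ (pd l (secondFundCoeff u j k) x) (meanCurv u x) : ℝ)
      = inner ℝ (pd l (pd j (pd k u)) x) (meanCurv u x)
        - ∑ m, christoffel u j k m x * secondFundMean u l m x := by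
  have e : pd l (secondFundCoeff u j k) x = pd l (pd j (pd k u)) x
      - ∑ m, (pd l (christoffel u j k m) x • pd m u x
        + christoffel u j k m x • pd l (pd m u) x)
      + (pd l (fun y => metric u y j k) x • u x + metric u x j k • pd l u x) := by
    have e0 := pd_congr_on h.isOpen (V := secondFundCoeff u j k) (W := fun y =>
      pd j (pd k u) y - ∑ m, christoffel u j k m y • pd m u y + metric u y j k • u y)
      (fun y hy => by simp only [h.pd_pd_eq hy j k]; module) hx l
    have hs : ∀ m ∈ Finset.univ, DifferentiableAt ℝ (fun y => christoffel u j k m y • pd m u y) x :=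
      fun m _ => h.diff ((h.smooth_christoffel j k m).smul (h.smooth_pd m)) hx
    rw [e0, pd_add, pd_sub, pd_sum hs, pd_smul (h.diff (h.smooth_metric j k) hx)
      (h.diff h.smooth hx)]
    · congr 2
      exact Finset.sum_congr rfl fun m _ => pd_smul (h.diff (h.smooth_christoffel j k m) hx)
        (h.diff (h.smooth_pd m) hx) l
    · exact h.diff (h.smooth_pd_pd j k) hx
    · exact DifferentiableAt.fun_sum hs
    · exact (h.diff (h.smooth_pd_pd j k) hx).fun_sub (DifferentiableAt.fun_sum hs)
    · exact h.diff ((h.smooth_metric j k).smul h.smooth) hx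
  have hn := h.isNormalAt_meanCurv hx
  have h1 := hn.1
  have h2 := hn.2
  simp only [real_inner_comm _ (meanCurv u x)] at h1 h2
  have h3 : ∀ m, (inner ℝ (pd l (pd m u) x) (meanCurv u x) : ℝ) = secondFundMean u l m x :=
    fun m => by rw [secondFundMean, secondFundCoeff, hn.inner_normalProj_left]
  rw [e]
  simp only [inner_add_left, inner_sub_left, sum_inner, real_inner_smul_left, h1, h2, h3,
    mul_zero, zero_add, add_zero]

theorem inner_pd_meanCurv_self (k : Fin 2) :
    (inner ℝ (pd k (meanCurv u) x) (meanCurv u x) : ℝ)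
      = ∑ i, ∑ j, (pd k (fun y => invMetric u y i j) x * secondFundMean u i j x
        + invMetric u x i j * inner ℝ (pd k (secondFundCoeff u i j) x) (meanCurv u x)) := by
  have e : pd k (meanCurv u) x = ∑ i, ∑ j, (pd k (fun y => invMetric u y i j) x •
      secondFundCoeff u i j x + invMetric u x i j • pd k (secondFundCoeff u i j) x) := by
    have hs : ∀ i j, DifferentiableAt ℝ
        (fun y => invMetric u y i j • secondFundCoeff u i j y) x :=
      fun i j => h.diff ((h.smooth_invMetric i j).smul (h.smooth_secondFundCoeff i j)) hx
    rw [show meanCurv u = fun y => ∑ i, ∑ j, invMetric u y i j • secondFundCoeff u i j y from rfl,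
      pd_sum fun i _ => DifferentiableAt.fun_sum fun j _ => hs i j]
    refine Finset.sum_congr rfl fun i _ => ?_
    rw [pd_sum fun j _ => hs i j]
    exact Finset.sum_congr rfl fun j _ => pd_smul (h.diff (h.smooth_invMetric i j) hx)
      (h.diff (h.smooth_secondFundCoeff i j) hx) k
  rw [e]
  simp only [sum_inner, inner_add_left, real_inner_smul_left, secondFundMean]

theorem pd_secondFundMean (l j k : Fin 2) : pd l (secondFundMean u j k) x
    = inner ℝ (pd l (secondFundCoeff u j k) x) (meanCurv u x)
      + inner ℝ (secondFundCoeff u j k x) (normalConn u l (meanCurv u) x) := by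
  rw [show secondFundMean u j k = fun y =>
    (inner ℝ (secondFundCoeff u j k y) (meanCurv u y) : ℝ) from rfl,
    pd_inner (h.diff (h.smooth_secondFundCoeff j k) hx) (h.diff h.smooth_meanCurv hx)]
  have hB := h.isNormalAt_secondFundCoeff hx j k
  have := hB.inner_normalProj_left (v := pd l (meanCurv u) x)
  simp only [real_inner_comm (secondFundCoeff u j k x)] at this
  rw [normalConn, this]

/-- The trace of the Codazzi equation in the direction of the mean curvature vector. -/
theorem trace_codazzi (k : Fin 2) :
    ∑ l, ∑ j, invMetric u x l j * inner ℝ (pd l (secondFundCoeff u j k) x) (meanCurv u x)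
      = inner ℝ (pd k (meanCurv u) x) (meanCurv u x)
        + ∑ l, ∑ j, (∑ m, invMetric u x l j * christoffel u l j m x * secondFundMean u m k x
          + ∑ m, invMetric u x l j * christoffel u l k m x * secondFundMean u j m x) := by
  rw [h.inner_pd_meanCurv_self hx]
  -- In the flat space ℂ³ the Codazzi equation is the symmetry of the third derivatives of `u`;
  -- everything else is Christoffel terms that match on both sides.
  have ht : ∀ l j k, pd l (pd j (pd k u)) x = pd j (pd l (pd k u)) x :=
    fun l j k => pd_comm (h.smooth_pd k) h.isOpen hx l j
  have ht' : ∀ l j k, pd l (pd j (pd k u)) x = pd l (pd k (pd j u)) x :=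
    fun l j k => pd_congr_on h.isOpen (fun y hy => h.pd_pd_comm hy j k) hx l
  simp only [h.inner_pd_secondFundCoeff hx, h.pd_invMetric hx]
  fin_cases k <;>
  · simp only [Fin.sum_univ_two, Fin.zero_eta, Fin.mk_one, Fin.isValue, ht 1 0, ht' 0 1 0,
      ht' 1 1 0, invMetric_comm u x 1 0, h.christoffel_comm hx 1 0, h.secondFundMean_comm hx 1 0]
    ring

end IsSphereImmersionOn
end LegendrianWillmore
namespace LegendrianWillmore
namespace IsSphereImmersionOn

variable {u : Plane → C3} {Ω : Set Plane} (h : IsSphereImmersionOn u Ω) {x : Plane} (hx : x ∈ Ω)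
include h hx

theorem pd_willmoreCurrent (m l : Fin 2) : pd m (willmoreCurrent u l) x
    = (1 / 2 : ℝ) • ∑ i, (pd m (fun y => invMetric u y l i) x • normalConn u i (meanCurv u) x
        + invMetric u x l i • pd m (normalConn u i (meanCurv u)) x)
      + (1 / 2 : ℝ) • ∑ j, ∑ k, ((pd m (fun y => invMetric u y l j) x * secondFundMean u j k x
          + invMetric u x l j * pd m (secondFundMean u j k) x) • dualFrame u k x
        + (invMetric u x l j * secondFundMean u j k x) • pd m (dualFrame u k) x)
      - (((1 / 2 : ℝ) * inner ℝ (pd m (meanCurv u) x) (meanCurv u x)) • dualFrame u l x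
        + ((1 / 4 : ℝ) * inner ℝ (meanCurv u x) (meanCurv u x)) • pd m (dualFrame u l) x) := by
  have hg := fun i => h.diff (h.smooth_invMetric l i) hx
  have hN := fun i => h.diff (h.smooth_normalConn_meanCurv i) hx
  have hβ := fun j k => h.diff (h.smooth_secondFundMean j k) hx
  have hθ := fun k => h.diff (h.smooth_dualFrame k) hx
  have hH := h.diff h.smooth_meanCurv hx
  have d1 := fun i => (hg i).fun_smul (hN i)
  have d2 := fun j k => ((hg j).fun_mul (hβ j k)).fun_smul (hθ k)
  have d2' : ∀ j, DifferentiableAt ℝ (fun y =>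
    ∑ k, (invMetric u y l j * secondFundMean u j k y) • dualFrame u k y) x :=
      fun j => DifferentiableAt.fun_sum fun k _ => d2 j k
  have d3 : DifferentiableAt ℝ (fun y => (1 / 4 : ℝ) * inner ℝ (meanCurv u y) (meanCurv u y)) x :=
    (hH.inner ℝ hH).const_mul _
  have s1 := DifferentiableAt.fun_sum fun i (_ : i ∈ Finset.univ) => d1 i
  have s2 := DifferentiableAt.fun_sum fun i (_ : i ∈ Finset.univ) => d2' i
  rw [show willmoreCurrent u l = fun y => _ from funext fun y => by rw [willmoreCurrent]]
  rw [pd_sub ((s1.fun_const_smul _).fun_add (s2.fun_const_smul _)) (d3.fun_smul (hθ l)),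
    pd_add (s1.fun_const_smul _) (s2.fun_const_smul _), pd_const_smul _ s1, pd_const_smul _ s2,
    pd_sum fun i _ => d1 i, pd_sum fun i _ => d2' i, pd_smul d3 (hθ l),
    pd_const_mul _ (hH.inner ℝ hH), pd_inner hH hH,
    real_inner_comm (pd m (meanCurv u) x) (meanCurv u x)]
  congr 2
  · congr 1
    exact Finset.sum_congr rfl fun i _ => pd_smul (hg i) (hN i) m
  · congr 1
    refine Finset.sum_congr rfl fun j _ => ?_
    rw [pd_sum fun k _ => d2 j k]
    refine Finset.sum_congr rfl fun k _ => ?_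
    rw [pd_smul ((hg j).fun_mul (hβ j k)) (hθ k), pd_mul (hg j) (hβ j k)]
  · module

/-- The Willmore equation is in divergence form. -/
theorem sum_pd_willmoreCurrent :
    ∑ l, pd l (fun y => areaElement u y • willmoreCurrent u l y) x
      = areaElement u x • willmoreOperator u x := by
  have e : ∀ l, pd l (fun y => areaElement u y • willmoreCurrent u l y) x
      = areaElement u x • ((∑ k, christoffel u l k k x) • willmoreCurrent u l x
        + pd l (willmoreCurrent u l) x) := fun l => by
    rw [pd_smul (h.diff h.smooth_areaElement hx) (h.diff (h.smooth_willmoreCurrent l) hx),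
      h.pd_areaElement hx]
    module
  simp only [e, ← Finset.smul_sum]
  congr 1
  -- The tangential terms ⟪B, ∇^⊥H⟫ produced here by Weingarten cancel those produced by
  -- differentiating ⟪B, H⟫.
  have hN : ∀ l i, pd l (normalConn u i (meanCurv u)) x
      = normalConn u l (normalConn u i (meanCurv u)) x - ∑ k,
        (inner ℝ (secondFundCoeff u l k x) (normalConn u i (meanCurv u) x) : ℝ) • dualFrame u k x :=
    fun l i => h.pd_normal hx (h.smooth_normalConn_meanCurv i)
      (fun y hy => h.isNormalAt_normalConn hy _ i) l
  have c0 := h.trace_codazzi hx 0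
  have c1 := h.trace_codazzi hx 1
  have hs := inner_meanCurv_self (u := u) (x := x)
  have hH : meanCurv u x = ∑ i, ∑ j, invMetric u x i j • secondFundCoeff u i j x := rfl
  rw [willmoreOperator, normalLaplacian, simonsOperator, ← real_inner_self_eq_norm_sq]
  simp only [h.pd_willmoreCurrent hx, hN, h.pd_dualFrame hx, h.pd_invMetric hx,
    h.pd_secondFundMean hx, willmoreCurrent]
  change _ = (1 / 2 : ℝ) • (_ + ∑ i, ∑ j, ∑ k, ∑ l, (invMetric u x i k * invMetric u x j l *
    secondFundMean u i j x) • secondFundCoeff u k l x - _)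
  generalize meanCurv u x = Hv at hH hs c0 c1 ⊢
  simp only [Fin.sum_univ_two, Fin.isValue, invMetric_comm u x 1 0, h.christoffel_comm hx 1 0,
    h.secondFundMean_comm hx 1 0, h.secondFundCoeff_comm hx 1 0] at hs hH c0 c1 ⊢
  simp only [Fin.isValue, if_true, one_ne_zero, zero_ne_one, if_false]
  generalize (inner ℝ Hv Hv : ℝ) = s at hs ⊢
  -- Along θᵏ the traced Codazzi equation balances the derivative of ¼|H|². Along `u` the trace of
  -- ⟪B, H⟫ is |H|², so the radial terms cancel. What remains is normal, and `hH` recognises the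
  -- trace of B in the term -¼|H|²H.
  linear_combination (norm := module) (1 / 2 : ℝ) • c0 • dualFrame u 0 x
    + (1 / 2 : ℝ) • c1 • dualFrame u 1 x + (1 / 2 : ℝ) • hs • u x + (1 / 4 * s : ℝ) • hH

end IsSphereImmersionOn
end LegendrianWillmore
-- Legendrian surfaces: the cubic form and the Maslov form.
namespace LegendrianWillmore

/-- `u` is a smooth Legendrian immersion of the open set `Ω` into the unit sphere. -/
structure IsLegendrianOn (u : Plane → C3) (Ω : Set Plane) : Prop
    extends IsSphereImmersionOn u Ω where
  inner_pd_I_self : ∀ x ∈ Ω, ∀ i, (inner ℝ (pd i u x) (Complex.I • u x) : ℝ) = 0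

/-- The cubic form `Cᵢⱼₖ = ⟪∂ᵢ∂ⱼu, i ∂ₖu⟫` of a Legendrian surface. -/
def cubicForm (u : Plane → C3) (i j k : Fin 2) (x : Plane) : ℝ :=
  inner ℝ (pd i (pd j u) x) (Complex.I • pd k u x)

/-- The components `Hₖ = ⟪H, i ∂ₖu⟫` of the Maslov form of a Legendrian surface. -/
def maslov (u : Plane → C3) (k : Fin 2) (x : Plane) : ℝ :=
  inner ℝ (meanCurv u x) (Complex.I • pd k u x)

/-- The components `⟪∂ⱼH, i ∂ₖu⟫` of the covariant derivative of the Maslov form. -/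
def maslovDeriv (u : Plane → C3) (j k : Fin 2) (x : Plane) : ℝ :=
  inner ℝ (pd j (meanCurv u) x) (Complex.I • pd k u x)

theorem inner_complex_eq (v w : C3) : (inner ℂ v w : ℂ)
    = (inner ℝ v w : ℝ) + (inner ℝ (Complex.I • v) w : ℝ) * Complex.I := by
  simp only [PiLp.inner_apply, Complex.inner, Complex.ofReal_sum, Finset.sum_mul,
    ← Finset.sum_add_distrib]
  refine Finset.sum_congr rfl fun k _ => ?_
  apply Complex.ext
  · simp
  · simp; ring

namespace IsLegendrianOn

variable {u : Plane → C3} {Ω : Set Plane} (h : IsLegendrianOn u Ω) {x : Plane} (hx : x ∈ Ω)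
include h

theorem smooth_I_pd (k : Fin 2) : ContDiffOn ℝ ∞ (fun y => Complex.I • pd k u y) Ω :=
  contDiffOn_I_smul (h.smooth_pd k)

theorem smooth_maslovDeriv (j k : Fin 2) : ContDiffOn ℝ ∞ (maslovDeriv u j k) Ω :=
  (contDiffOn_pd h.smooth_meanCurv h.isOpen j).inner ℝ (h.smooth_I_pd k)

include hx

/-- A Legendrian surface in `S⁵` is Lagrangian for the Kähler form of `ℂ³`. -/
theorem inner_pd_I_pd (i j : Fin 2) :
    (inner ℝ (pd i u x) (Complex.I • pd j u x) : ℝ) = 0 := by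
  -- The derivative of α(∂ⱼu) = 0 is a sum of a term symmetric in i, j and an antisymmetric one, so
  -- each vanishes separately.
  have key : ∀ i j, (inner ℝ (pd i (pd j u) x) (Complex.I • u x) : ℝ)
      + inner ℝ (pd j u x) (Complex.I • pd i u x) = 0 := fun i j => by
    have e := pd_congr_on (W := fun _ => (0 : ℝ)) h.isOpen
      (fun y hy => h.inner_pd_I_self y hy j) hx i
    rwa [pd_inner (h.diff (h.smooth_pd j) hx) (h.diff (contDiffOn_I_smul h.smooth) hx), pd_const,
      pd_I_smul (h.diff h.smooth hx)] at e
  have e1 := key i j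
  have e2 := key j i
  rw [h.pd_pd_comm hx] at e1
  rw [inner_I_smul_comm (pd j u x)] at e1
  linarith

theorem inner_pd_pd_I_self (i j : Fin 2) :
    (inner ℝ (pd i (pd j u) x) (Complex.I • u x) : ℝ) = 0 := by
  have e := pd_congr_on (W := fun _ => (0 : ℝ)) h.isOpen
    (fun y hy => h.inner_pd_I_self y hy j) hx i
  rw [pd_inner (h.diff (h.smooth_pd j) hx) (h.diff (contDiffOn_I_smul h.smooth) hx), pd_const,
    pd_I_smul (h.diff h.smooth hx), h.inner_pd_I_pd hx, add_zero] at e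
  exact e

/-- The Hermitian Gram matrix of u, ∂₀u, ∂₁u is the real block matrix with blocks 1 and g, so these
vectors are a complex basis of ℂ³. The six real conditions say that `v` is Hermitian-orthogonal to
this basis. -/
theorem eq_zero_of_inner_eq_zero {v : C3} (h0 : (inner ℝ v (u x) : ℝ) = 0)
    (h1 : (inner ℝ v (Complex.I • u x) : ℝ) = 0) (h2 : ∀ k, (inner ℝ v (pd k u x) : ℝ) = 0)
    (h3 : ∀ k, (inner ℝ v (Complex.I • pd k u x) : ℝ) = 0) : v = 0 := by
  have li : LinearIndependent ℂ ![u x, pd 0 u x, pd 1 u x] := by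
    have f0 : (inner ℂ (u x) (u x) : ℂ) = 1 := by
      rw [inner_complex_eq, h.inner_self hx, inner_I_smul_left]; simp
    have f1 : ∀ i j, (inner ℂ (pd i u x) (pd j u x) : ℂ) = metric u x i j := fun i j => by
      rw [inner_complex_eq, inner_I_smul_left, h.inner_pd_I_pd hx]; simp [metric_apply]
    have f2 : ∀ i, (inner ℂ (pd i u x) (u x) : ℂ) = 0 := fun i => by
      rw [inner_complex_eq, inner_I_smul_left, h.inner_pd_self hx, h.inner_pd_I_self x hx]; simp
    have f3 : ∀ i, (inner ℂ (u x) (pd i u x) : ℂ) = 0 := fun i => by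
      rw [← inner_conj_symm, f2, map_zero]
    rw [Fintype.linearIndependent_iff]
    intro c hc
    simp only [Fin.sum_univ_three, Matrix.cons_val] at hc
    have hd : ((metric u x 0 0 : ℂ) * metric u x 1 1 - metric u x 0 1 * metric u x 0 1) ≠ 0 := by
      have := h.det_ne hx
      rw [det_metric] at this
      exact_mod_cast this
    have g0 := congrArg (fun w => (inner ℂ (u x) w : ℂ)) hc
    have g1 := congrArg (fun w => (inner ℂ (pd 0 u x) w : ℂ)) hc
    have g2 := congrArg (fun w => (inner ℂ (pd 1 u x) w : ℂ)) hc
    simp only [inner_add_right, inner_smul_right, f0, f1, f2, f3, inner_zero_right,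
      metric_comm u x 1 0] at g0 g1 g2
    have c0 : c 0 = 0 := by linear_combination g0
    have c1 : c 1 = 0 := by
      refine (mul_eq_zero.1 (?_ : ((metric u x 0 0 : ℂ) * metric u x 1 1
        - metric u x 0 1 * metric u x 0 1) * c 1 = 0)).resolve_left hd
      linear_combination (metric u x 1 1 : ℂ) * g1 - metric u x 0 1 * g2
    have c2 : c 2 = 0 := by
      refine (mul_eq_zero.1 (?_ : ((metric u x 0 0 : ℂ) * metric u x 1 1
        - metric u x 0 1 * metric u x 0 1) * c 2 = 0)).resolve_left hd
      linear_combination (metric u x 0 0 : ℂ) * g2 - metric u x 0 1 * g1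
    intro i; fin_cases i <;> assumption
  have hs := li.span_eq_top_of_card_eq_finrank (by simp)
  have hz : ∀ w ∈ Submodule.span ℂ (Set.range ![u x, pd 0 u x, pd 1 u x]),
      (inner ℂ v w : ℂ) = 0 := by
    intro w hw
    induction hw using Submodule.span_induction with
    | mem w hw =>
      obtain ⟨i, rfl⟩ := hw
      rw [inner_complex_eq, inner_I_smul_left]
      fin_cases i <;> simp [h0, h1, h2, h3]
    | zero => simp
    | add a b _ _ ha hb => rw [inner_add_right, ha, hb, add_zero]
    | smul c a _ ha => rw [inner_smul_right, ha, mul_zero]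
  exact inner_self_eq_zero.1 (hz v (hs ▸ Submodule.mem_top))

theorem inner_dualFrame_I_self (k : Fin 2) :
    (inner ℝ (dualFrame u k x) (Complex.I • u x) : ℝ) = 0 := by
  simp [dualFrame, inner_add_left, real_inner_smul_left, h.inner_pd_I_self x hx]

theorem inner_dualFrame_I_pd (k j : Fin 2) :
    (inner ℝ (dualFrame u k x) (Complex.I • pd j u x) : ℝ) = 0 := by
  simp [dualFrame, inner_add_left, real_inner_smul_left, h.inner_pd_I_pd hx]

theorem isNormalAt_I_self : IsNormalAt u x (Complex.I • u x) :=
  ⟨fun k => by rw [real_inner_comm, h.inner_pd_I_self x hx],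
    by rw [real_inner_comm, inner_I_smul_self]⟩

theorem isNormalAt_I_pd (k : Fin 2) : IsNormalAt u x (Complex.I • pd k u x) :=
  ⟨fun j => by rw [real_inner_comm, h.inner_pd_I_pd hx],
    by rw [inner_I_smul_left, h.inner_pd_I_self x hx, neg_zero]⟩

theorem isNormalAt_I_dualFrame (k : Fin 2) : IsNormalAt u x (Complex.I • dualFrame u k x) :=
  ⟨fun j => by rw [inner_I_smul_left, h.inner_dualFrame_I_pd hx, neg_zero],
    by rw [inner_I_smul_left, h.inner_dualFrame_I_self hx, neg_zero]⟩

/-- The difference of the two sides is tested against the six vectors of `eq_zero_of_inner_eq_zero`.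
This expansion reduces identities between normal fields to scalar identities. -/
theorem eq_sum_of_isNormalAt {n : C3} (hn : IsNormalAt u x n) :
    n = ∑ k, (inner ℝ n (Complex.I • pd k u x) : ℝ) • (Complex.I • dualFrame u k x)
      + (inner ℝ n (Complex.I • u x) : ℝ) • (Complex.I • u x) := by
  rw [← sub_eq_zero]
  have hθ := fun k => h.isNormalAt_I_dualFrame hx k
  have hu := h.isNormalAt_I_self hx
  apply h.eq_zero_of_inner_eq_zero hx
  · simp [inner_sub_left, inner_add_left, real_inner_smul_left, (hθ _).2, hu.2, hn.2]
  · simp [inner_sub_left, inner_add_left, real_inner_smul_left, inner_I_smul_I_smul,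
      h.inner_dualFrame_self hx, norm_smul, h.norm_eq x hx]
  · intro k
    simp [inner_sub_left, inner_add_left, real_inner_smul_left, (hθ _).1, hu.1, hn.1]
  · intro k
    have := h.inner_pd_self hx k
    rw [real_inner_comm] at this
    fin_cases k <;>
    simp [inner_sub_left, inner_add_left, real_inner_smul_left, inner_I_smul_I_smul,
      inner_dualFrame_pd (h.det_ne hx)] <;> simp_all

theorem cubicForm_comm (i j k : Fin 2) : cubicForm u i j k x = cubicForm u j i k x := by
  rw [cubicForm, h.pd_pd_comm hx, cubicForm]

/-- Derivative of the Lagrangian condition ⟪∂ⱼu, i∂ₖu⟫ = 0. Together with the symmetry of second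
derivatives it makes the cubic form totally symmetric. -/
theorem cubicForm_comm' (i j k : Fin 2) : cubicForm u i j k x = cubicForm u i k j x := by
  have e := pd_congr_on (W := fun _ => (0 : ℝ)) h.isOpen
    (fun y hy => h.inner_pd_I_pd hy j k) hx i
  rw [pd_inner (h.diff (h.smooth_pd j) hx) (h.diff (h.smooth_I_pd k) hx), pd_const,
    pd_I_smul (h.diff (h.smooth_pd k) hx), inner_I_smul_comm (pd j u x)] at e
  rw [cubicForm, cubicForm]
  linarith

theorem inner_secondFundCoeff_I_pd (i j k : Fin 2) :
    (inner ℝ (secondFundCoeff u i j x) (Complex.I • pd k u x) : ℝ) = cubicForm u i j k x :=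
  (h.isNormalAt_I_pd hx k).inner_normalProj_left

theorem secondFundCoeff_eq (i j : Fin 2) : secondFundCoeff u i j x
    = ∑ k, cubicForm u i j k x • (Complex.I • dualFrame u k x) := by
  conv_lhs => rw [h.eq_sum_of_isNormalAt hx (h.isNormalAt_secondFundCoeff hx i j)]
  rw [show (inner ℝ (secondFundCoeff u i j x) (Complex.I • u x) : ℝ) = 0 from
    (h.isNormalAt_I_self hx).inner_normalProj_left.trans (h.inner_pd_pd_I_self hx i j)]
  simp only [h.inner_secondFundCoeff_I_pd hx, zero_smul, add_zero]

theorem I_smul_secondFundCoeff (i j : Fin 2) : Complex.I • secondFundCoeff u i j x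
    = -∑ k, cubicForm u i j k x • dualFrame u k x := by
  rw [h.secondFundCoeff_eq hx, Finset.smul_sum]
  simp only [I_smul_smul, I_smul_I_smul, smul_neg, Finset.sum_neg_distrib]

theorem inner_meanCurv_I_self : (inner ℝ (meanCurv u x) (Complex.I • u x) : ℝ) = 0 := by
  simp only [meanCurv, sum_inner, real_inner_smul_left, h.secondFundCoeff_eq hx,
    inner_I_smul_I_smul, h.inner_dualFrame_self hx]
  simp

theorem meanCurv_eq : meanCurv u x = ∑ k, maslov u k x • (Complex.I • dualFrame u k x) := by
  conv_lhs => rw [h.eq_sum_of_isNormalAt hx (h.isNormalAt_meanCurv hx)]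
  rw [h.inner_meanCurv_I_self hx]
  simp [maslov]

theorem I_smul_pd_pd (i j : Fin 2) : Complex.I • pd i (pd j u) x
    = ∑ k, christoffel u i j k x • (Complex.I • pd k u x)
      - ∑ k, cubicForm u i j k x • dualFrame u k x - metric u x i j • (Complex.I • u x) := by
  rw [h.pd_pd_eq hx, smul_sub, smul_add, h.I_smul_secondFundCoeff hx, I_smul_smul,
    Finset.smul_sum]
  simp only [I_smul_smul]
  abel

/-- Multiplication by `i` makes B tangent, so the second fundamental form does not contribute
against a normal vector; the metric term is the source of all Reeb components below. -/
theorem inner_normal_I_pd_pd {n : C3} (hn : IsNormalAt u x n) (i j : Fin 2) :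
    (inner ℝ n (Complex.I • pd i (pd j u) x) : ℝ)
      = ∑ k, christoffel u i j k x * inner ℝ n (Complex.I • pd k u x)
        - metric u x i j * inner ℝ n (Complex.I • u x) := by
  rw [h.I_smul_pd_pd hx]
  simp only [inner_sub_right, inner_sum, real_inner_smul_right, hn.inner_dualFrame, mul_zero,
    Finset.sum_const_zero, sub_zero]

theorem pd_maslov (j k : Fin 2) : pd j (maslov u k) x
    = maslovDeriv u j k x + ∑ m, christoffel u j k m x * maslov u m x := by
  rw [show maslov u k = fun y => (inner ℝ (meanCurv u y) (Complex.I • pd k u y) : ℝ) from rfl,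
    pd_inner (h.diff h.smooth_meanCurv hx) (h.diff (h.smooth_I_pd k) hx),
    pd_I_smul (h.diff (h.smooth_pd k) hx), h.inner_normal_I_pd_pd hx (h.isNormalAt_meanCurv hx),
    h.inner_meanCurv_I_self hx, mul_zero, sub_zero]
  rfl

/-- Total symmetry of the cubic form moves the index k onto a derivative. The derivative ∂ₗHₖ then
contains the third derivatives ∂ₗ∂ₖ∂ᵢu, which are symmetric in l and k; this is what proves
closedness. -/
theorem maslov_eq (k : Fin 2) : maslov u k x
    = ∑ i, (inner ℝ (pd k (pd i u) x) (Complex.I • dualFrame u i x) : ℝ) := by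
  have e : ∀ i, (inner ℝ (pd k (pd i u) x) (Complex.I • dualFrame u i x) : ℝ)
      = ∑ j, invMetric u x i j * cubicForm u i j k x := fun i => by
    rw [dualFrame, Finset.smul_sum, inner_sum]
    simp only [I_smul_smul, real_inner_smul_right]
    refine Finset.sum_congr rfl fun j _ => ?_
    rw [h.cubicForm_comm' hx, h.cubicForm_comm hx, cubicForm]
  simp only [e, maslov, meanCurv, sum_inner, real_inner_smul_left,
    h.inner_secondFundCoeff_I_pd hx]

/-- The Maslov form is closed. -/
theorem maslovDeriv_comm (j k : Fin 2) : maslovDeriv u j k x = maslovDeriv u k j x := by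
  have hd := fun k i => h.diff (h.smooth_pd_pd k i) hx
  have hθ := fun i => h.diff (h.smooth_dualFrame i) hx
  have hIθ := fun i => h.diff (contDiffOn_I_smul (h.smooth_dualFrame i)) hx
  have e : ∀ l k, pd l (maslov u k) x
      = ∑ i, (inner ℝ (pd l (pd k (pd i u)) x) (Complex.I • dualFrame u i x)
        + inner ℝ (pd k (pd i u) x) (Complex.I • pd l (dualFrame u i) x)) := fun l k => by
    rw [pd_congr_on h.isOpen (fun y hy => h.maslov_eq hy k) hx l,
      pd_sum fun i _ => (hd k i).inner ℝ (hIθ i)]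
    refine Finset.sum_congr rfl fun i _ => ?_
    rw [pd_inner (hd k i) (hIθ i), pd_I_smul (hθ i)]
  have e2 : ∀ k i m, (inner ℝ (pd k (pd i u) x) (Complex.I • dualFrame u m x) : ℝ)
      = ∑ p, invMetric u x m p * cubicForm u k i p x := fun k i m => by
    rw [dualFrame, Finset.smul_sum, inner_sum]
    simp only [I_smul_smul, real_inner_smul_right, cubicForm]
  have e3 : ∀ k i l m, (inner ℝ (pd k (pd i u) x) (Complex.I • secondFundCoeff u l m x) : ℝ)
      = -∑ p, cubicForm u l m p x * christoffel u k i p x := fun k i l m => by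
    rw [h.I_smul_secondFundCoeff hx, inner_neg_right, inner_sum]
    simp only [real_inner_smul_right, h.christoffel_eq hx]
  -- After summation over i the two double sums are exchanged by l ↔ k, because the cubic form is
  -- symmetric. Hence ∂ₗHₖ is symmetric, and so is the covariant derivative.
  have e4 : ∀ k i l, (inner ℝ (pd k (pd i u) x) (Complex.I • pd l (dualFrame u i) x) : ℝ)
      = -∑ m, ∑ p, christoffel u l m i x * (invMetric u x m p * cubicForm u k i p x)
        - ∑ m, ∑ p, invMetric u x i m * (cubicForm u l m p x * christoffel u k i p x) :=
    fun k i l => by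
    rw [h.pd_dualFrame hx, smul_sub, smul_add, smul_neg, Finset.smul_sum, Finset.smul_sum,
      inner_sub_right, inner_add_right, inner_neg_right, inner_sum, inner_sum]
    simp only [I_smul_smul, real_inner_smul_right, e2, e3, h.inner_pd_pd_I_self hx, mul_zero,
      sub_zero, Finset.mul_sum, mul_neg, Finset.sum_neg_distrib]
    rfl
  have key : ∀ j k, maslovDeriv u j k x = pd j (maslov u k) x
      - ∑ m, christoffel u j k m x * maslov u m x := fun j k => by
    rw [h.pd_maslov hx]; ring
  have ht : ∀ l j k, pd l (pd j (pd k u)) x = pd j (pd l (pd k u)) x :=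
    fun l j k => pd_comm (h.smooth_pd k) h.isOpen hx l j
  have main : maslovDeriv u 1 0 x = maslovDeriv u 0 1 x := by
    simp only [key, e, e4, Fin.sum_univ_two, Fin.isValue, ht 1 0, h.christoffel_comm hx 1 0,
      invMetric_comm u x 1 0, h.cubicForm_comm hx 1 0, h.cubicForm_comm' hx 0 1 0,
      h.cubicForm_comm' hx 1 1 0]
    ring
  fin_cases j <;> fin_cases k <;> first | rfl | exact main | exact main.symm

end IsLegendrianOn
end LegendrianWillmore
-- The Bochner formula and the Willmore operator of a Legendrian surface.
namespace LegendrianWillmore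

theorem contactJ_of_inner_eq_zero {z v : C3} (hv : (inner ℝ v (Complex.I • z) : ℝ) = 0) :
    contactJ z v = Complex.I • v := by
  simp [contactJ, contactForm, reeb, hv]

/-- The divergence `gⁱʲ ∇ᵢHⱼ` of the Maslov form. -/
def maslovDiv (u : Plane → C3) (x : Plane) : ℝ :=
  ∑ i, ∑ j, invMetric u x i j * maslovDeriv u i j x

namespace IsLegendrianOn

variable {u : Plane → C3} {Ω : Set Plane} (h : IsLegendrianOn u Ω) {x : Plane} (hx : x ∈ Ω)
include h

include hx

theorem JH_eq : JH u x = Complex.I • meanCurv u x :=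
  contactJ_of_inner_eq_zero (h.inner_meanCurv_I_self hx)

/-- The sign appears because multiplication by `i` is skew when it is moved to the other factor of
the inner product. -/
theorem surfDiv_JH : surfDiv u (JH u) x = -maslovDiv u x := by
  simp only [surfDiv, maslovDiv, pd_congr_on h.isOpen (fun y hy => h.JH_eq hy) hx,
    pd_I_smul (h.diff h.smooth_meanCurv hx), inner_I_smul_left, maslovDeriv, mul_neg,
    Finset.sum_neg_distrib]

theorem contactJ_surfGrad (a : Plane → ℝ) : contactJ (u x) (surfGrad u a x)
    = ∑ k, pd k a x • (Complex.I • dualFrame u k x) := by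
  have e : surfGrad u a x = ∑ k, pd k a x • dualFrame u k x := by
    simp only [surfGrad, dualFrame, Finset.smul_sum]
    exact Finset.sum_congr rfl fun i _ => Finset.sum_congr rfl fun j _ => by module
  rw [e, contactJ_of_inner_eq_zero, Finset.smul_sum]
  · simp only [I_smul_smul]
  · simp [inner_add_left, real_inner_smul_left, h.inner_dualFrame_I_self hx]

theorem inner_normalConn_meanCurv_I_pd (j k : Fin 2) :
    (inner ℝ (normalConn u j (meanCurv u) x) (Complex.I • pd k u x) : ℝ) = maslovDeriv u j k x :=
  (h.isNormalAt_I_pd hx k).inner_normalProj_left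

/-- H has no Reeb component, but its derivative does, since iu itself rotates: ∂ⱼ(iu) = i∂ⱼu. -/
theorem inner_pd_meanCurv_I_self (j : Fin 2) :
    (inner ℝ (pd j (meanCurv u) x) (Complex.I • u x) : ℝ) = -maslov u j x := by
  have e := pd_congr_on (W := fun _ => (0 : ℝ)) h.isOpen
    (fun y hy => h.inner_meanCurv_I_self hy) hx j
  rw [pd_inner (h.diff h.smooth_meanCurv hx) (h.diff (contDiffOn_I_smul h.smooth) hx), pd_const,
    pd_I_smul (h.diff h.smooth hx)] at e
  rw [maslov]; linarith

theorem inner_normalConn_meanCurv_I_self (j : Fin 2) :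
    (inner ℝ (normalConn u j (meanCurv u) x) (Complex.I • u x) : ℝ) = -maslov u j x :=
  ((h.isNormalAt_I_self hx).inner_normalProj_left).trans (h.inner_pd_meanCurv_I_self hx j)

theorem inner_normalConn_normalConn_I_pd (i j k : Fin 2) :
    (inner ℝ (normalConn u i (normalConn u j (meanCurv u)) x) (Complex.I • pd k u x) : ℝ)
      = pd i (maslovDeriv u j k) x - ∑ m, christoffel u i k m x * maslovDeriv u j m x
        - metric u x i k * maslov u j x := by
  have e := pd_congr_on h.isOpen (fun y hy => h.inner_normalConn_meanCurv_I_pd hy j k) hx i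
  rw [pd_inner (h.diff (h.smooth_normalConn_meanCurv j) hx) (h.diff (h.smooth_I_pd k) hx),
    pd_I_smul (h.diff (h.smooth_pd k) hx),
    h.inner_normal_I_pd_pd hx (h.isNormalAt_normalConn hx _ j)] at e
  simp only [h.inner_normalConn_meanCurv_I_pd hx, h.inner_normalConn_meanCurv_I_self hx] at e
  rw [normalConn, (h.isNormalAt_I_pd hx k).inner_normalProj_left]
  linarith

/-- One derivative of the Maslov form comes from differentiating the component -Hⱼ, the other from
the rotation of iu. This doubling is the coefficient 2 of Div(JH) R. -/
theorem inner_normalConn_normalConn_I_self (i j : Fin 2) :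
    (inner ℝ (normalConn u i (normalConn u j (meanCurv u)) x) (Complex.I • u x) : ℝ)
      = -maslovDeriv u i j x - maslovDeriv u j i x
        - ∑ m, christoffel u i j m x * maslov u m x := by
  have e := pd_congr_on h.isOpen (fun y hy => h.inner_normalConn_meanCurv_I_self hy j) hx i
  rw [pd_inner (h.diff (h.smooth_normalConn_meanCurv j) hx)
    (h.diff (contDiffOn_I_smul h.smooth) hx), pd_I_smul (h.diff h.smooth hx),
    h.inner_normalConn_meanCurv_I_pd hx, pd_neg, h.pd_maslov hx] at e
  rw [normalConn, (h.isNormalAt_I_self hx).inner_normalProj_left]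
  linarith

theorem secondFundMean_eq (i j : Fin 2) : secondFundMean u i j x
    = ∑ k, ∑ l, cubicForm u i j k x * invMetric u x k l * maslov u l x := by
  rw [secondFundMean, h.secondFundCoeff_eq hx, h.meanCurv_eq hx]
  simp only [sum_inner, inner_sum, real_inner_smul_left, real_inner_smul_right,
    inner_I_smul_I_smul, inner_dualFrame_dualFrame (h.det_ne hx)]
  rw [Finset.sum_comm]
  exact Finset.sum_congr rfl fun k _ => Finset.sum_congr rfl fun l _ => by ring

/-- The Weingarten part of ∂ₖH pairs with the tangent part iB of i∂ᵢ∂ⱼu, giving the terms that the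
Gauss equation would supply; the last term comes from the Reeb components of both factors. -/
theorem inner_pd_meanCurv_I_pd_pd (k i j : Fin 2) :
    (inner ℝ (pd k (meanCurv u) x) (Complex.I • pd i (pd j u) x) : ℝ)
      = ∑ m, christoffel u i j m x * maslovDeriv u k m x
        + ∑ m, ∑ l, cubicForm u i j m x * invMetric u x m l * secondFundMean u k l x
        + metric u x i j * maslov u k x := by
  have e : ∀ m, (inner ℝ (pd k (meanCurv u) x) (dualFrame u m x) : ℝ)
      = -∑ l, invMetric u x m l * secondFundMean u k l x := fun m => by
    rw [h.pd_normal hx h.smooth_meanCurv (fun y hy => h.isNormalAt_meanCurv hy), inner_sub_left,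
      (h.isNormalAt_normalConn hx _ k).inner_dualFrame]
    simp only [sum_inner, real_inner_smul_left, inner_dualFrame_dualFrame (h.det_ne hx),
      secondFundMean, zero_sub, invMetric_comm u x m]
    exact congrArg _ (Finset.sum_congr rfl fun l _ => mul_comm _ _)
  rw [h.I_smul_pd_pd hx]
  simp only [inner_sub_right, inner_sum, real_inner_smul_right, e,
    h.inner_pd_meanCurv_I_self hx, maslovDeriv, Finset.mul_sum, mul_neg, Finset.sum_neg_distrib]
  simp only [sub_neg_eq_add, mul_assoc]

/-- The Ricci identity for the Maslov form. -/
theorem pd_maslovDeriv_sub (i k j : Fin 2) :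
    pd i (maslovDeriv u k j) x - pd k (maslovDeriv u i j) x
      = inner ℝ (pd k (meanCurv u) x) (Complex.I • pd i (pd j u) x)
        - inner ℝ (pd i (meanCurv u) x) (Complex.I • pd k (pd j u) x) := by
  have e : ∀ i k, pd i (maslovDeriv u k j) x
      = inner ℝ (pd i (pd k (meanCurv u)) x) (Complex.I • pd j u x)
        + inner ℝ (pd k (meanCurv u) x) (Complex.I • pd i (pd j u) x) := fun i k => by
    rw [show maslovDeriv u k j = fun y =>
      (inner ℝ (pd k (meanCurv u) y) (Complex.I • pd j u y) : ℝ) from rfl,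
      pd_inner (h.diff (contDiffOn_pd h.smooth_meanCurv h.isOpen k) hx)
        (h.diff (h.smooth_I_pd j) hx), pd_I_smul (h.diff (h.smooth_pd j) hx)]
  -- Second derivatives of H commute in ℂ³, so no curvature tensor is needed: the curvature is
  -- contained in the two remaining products.
  rw [e, e, pd_comm h.smooth_meanCurv h.isOpen hx]
  ring

theorem pd_maslovDiv (k : Fin 2) : pd k (maslovDiv u) x
    = ∑ i, ∑ j, (pd k (fun y => invMetric u y i j) x * maslovDeriv u i j x
      + invMetric u x i j * pd k (maslovDeriv u i j) x) := by
  have hs : ∀ i j, DifferentiableAt ℝ (fun y => invMetric u y i j * maslovDeriv u i j y) x :=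
    fun i j => (h.diff (h.smooth_invMetric i j) hx).fun_mul (h.diff (h.smooth_maslovDeriv i j) hx)
  rw [show maslovDiv u = fun y => ∑ i, ∑ j, invMetric u y i j * maslovDeriv u i j y from rfl,
    pd_sum fun i _ => DifferentiableAt.fun_sum fun j _ => hs i j]
  refine Finset.sum_congr rfl fun i _ => ?_
  rw [pd_sum fun j _ => hs i j]
  exact Finset.sum_congr rfl fun j _ => pd_mul (h.diff (h.smooth_invMetric i j) hx)
    (h.diff (h.smooth_maslovDeriv i j) hx) k

theorem inner_normalLaplacian_I_self :
    (inner ℝ (normalLaplacian u (meanCurv u) x) (Complex.I • u x) : ℝ) = -2 * maslovDiv u x := by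
  simp only [normalLaplacian, sum_inner, inner_sub_left, real_inner_smul_left,
    h.inner_normalConn_normalConn_I_self hx, h.inner_normalConn_meanCurv_I_self hx, maslovDiv]
  simp only [Fin.sum_univ_two, invMetric_comm u x 1 0, h.maslovDeriv_comm hx 1 0]
  ring

/-- The Bochner formula for the Maslov form. -/
theorem inner_normalLaplacian_I_pd (k : Fin 2) :
    (inner ℝ (normalLaplacian u (meanCurv u) x) (Complex.I • pd k u x) : ℝ)
      = pd k (maslovDiv u) x
        + ∑ i, ∑ j, invMetric u x i j * maslov u i x * secondFundMean u k j x
        - ∑ i, ∑ j, ∑ p, ∑ q, invMetric u x i p * invMetric u x j q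
            * secondFundMean u i j x * cubicForm u p q k x := by
  have hg := fun i j => invMetric_mul_metric (h.det_ne hx) i j
  -- Closedness is used under the derivative: it brings k to the front, so that the commutation
  -- formula can exchange it with i.
  have hS : ∀ i j k, pd i (maslovDeriv u j k) x = pd i (maslovDeriv u k j) x :=
    fun i j k => pd_congr_on h.isOpen (fun y hy => h.maslovDeriv_comm hy j k) hx i
  have r00 := h.pd_maslovDeriv_sub hx 0 k 0
  have r01 := h.pd_maslovDeriv_sub hx 0 k 1
  have r10 := h.pd_maslovDeriv_sub hx 1 k 0
  have r11 := h.pd_maslovDeriv_sub hx 1 k 1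
  have hm : ∀ m, maslov u m x = ∑ i, ∑ j, invMetric u x i j * cubicForm u i j m x := fun m => by
    simp only [maslov, meanCurv, sum_inner, real_inner_smul_left, h.inner_secondFundCoeff_I_pd hx]
  have m0 := hm 0
  have m1 := hm 1
  have g00 := hg 0 0
  have g01 := hg 0 1
  have g10 := hg 1 0
  have g11 := hg 1 1
  simp only [normalLaplacian, sum_inner, inner_sub_left, real_inner_smul_left,
    h.inner_normalConn_normalConn_I_pd hx, h.inner_normalConn_meanCurv_I_pd hx,
    h.pd_maslovDiv hx, h.pd_invMetric hx]
  simp only [h.inner_pd_meanCurv_I_pd_pd hx] at r00 r01 r10 r11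
  fin_cases k <;>
  · simp only [Fin.sum_univ_two, Fin.zero_eta, Fin.mk_one, Fin.isValue, invMetric_comm u x 1 0,
      h.christoffel_comm hx 1 0, h.maslovDeriv_comm hx 1 0, hS _ 1 0, metric_comm u x 1 0,
      h.secondFundMean_comm hx 1 0, h.cubicForm_comm hx 1 0, h.cubicForm_comm' hx 0 1 0,
      h.cubicForm_comm' hx 1 1 0, if_true, one_ne_zero, zero_ne_one, if_false]
      at m0 m1 r00 r01 r10 r11 g00 g01 g10 g11 ⊢
    -- The commutation formula is contracted with the inverse metric. Its metric terms give (2 -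
    -- 1)Hₖ and cancel the -Hₖ coming from the Reeb components in Δ^⊥H; this is the role of the
    -- relations g⁻¹g = 1. The relations `m0`, `m1` replace a traced cubic form by the Maslov form,
    -- producing the B(JH,JH) term. The two alternatives are k = 0 and k = 1.
    first
    | linear_combination invMetric u x 0 0 * r00 + invMetric u x 0 1 * (r01 + r10)
        + invMetric u x 1 1 * r11 + maslov u 0 x * (g11 - g00) - 2 * maslov u 1 x * g10
        - (invMetric u x 0 0 * secondFundMean u 0 0 x + invMetric u x 0 1 * secondFundMean u 0 1 x)
          * m0
        - (invMetric u x 0 1 * secondFundMean u 0 0 x + invMetric u x 1 1 * secondFundMean u 0 1 x)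
          * m1
    | linear_combination invMetric u x 0 0 * r00 + invMetric u x 0 1 * (r01 + r10)
        + invMetric u x 1 1 * r11 + maslov u 1 x * (g00 - g11) - 2 * maslov u 0 x * g01
        - (invMetric u x 0 0 * secondFundMean u 0 1 x + invMetric u x 0 1 * secondFundMean u 1 1 x)
          * m0
        - (invMetric u x 0 1 * secondFundMean u 0 1 x + invMetric u x 1 1 * secondFundMean u 1 1 x)
          * m1

/-- The Willmore operator of a Legendrian surface. -/
theorem willmoreOperator_eq :
    willmoreOperator u x = (1 / 2 : ℝ) • legendrianWillmoreField u x := by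
  have hgrad : contactJ (u x) (surfGrad u (surfDiv u (JH u)) x)
      = -∑ k, pd k (maslovDiv u) x • (Complex.I • dualFrame u k x) := by
    rw [h.contactJ_surfGrad hx, ← Finset.sum_neg_distrib]
    refine Finset.sum_congr rfl fun k _ => ?_
    rw [pd_congr_on h.isOpen (fun y hy => h.surfDiv_JH hy) hx, pd_neg, neg_smul]
  have hB : secondFund u x (JH u x) (JH u x) = ∑ k, (∑ i, ∑ j, invMetric u x i j * maslov u i x
      * secondFundMean u k j x) • (Complex.I • dualFrame u k x) := by
    have e : ∀ i, tangentCoord u x (JH u x) i = -∑ m, invMetric u x i m * maslov u m x :=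
      fun i => by
      rw [tangentCoord_eq, h.JH_eq hx, h.meanCurv_eq hx]
      simp only [Finset.smul_sum, I_smul_smul, I_smul_I_smul, sum_inner, smul_neg,
        inner_neg_left, real_inner_smul_left, inner_dualFrame_dualFrame (h.det_ne hx),
        Finset.sum_neg_distrib, invMetric_comm u x i]
      exact congrArg _ (Finset.sum_congr rfl fun l _ => mul_comm _ _)
    simp only [secondFund, e, h.secondFundCoeff_eq hx, h.secondFundMean_eq hx, Fin.sum_univ_two,
      Fin.isValue, invMetric_comm u x 1 0, h.cubicForm_comm hx 1 0, h.cubicForm_comm' hx 0 1 0,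
      h.cubicForm_comm' hx 1 1 0]
    module
  have hL : normalLaplacian u (meanCurv u) x
      = ∑ k, (pd k (maslovDiv u) x
        + ∑ i, ∑ j, invMetric u x i j * maslov u i x * secondFundMean u k j x
        - ∑ i, ∑ j, ∑ p, ∑ q, invMetric u x i p * invMetric u x j q
            * secondFundMean u i j x * cubicForm u p q k x) • (Complex.I • dualFrame u k x)
        + (-2 * maslovDiv u x) • (Complex.I • u x) := by
    have hn : IsNormalAt u x (normalLaplacian u (meanCurv u) x) :=
      IsNormalAt.sum fun i _ => IsNormalAt.sum fun j _ => by
        rw [sub_eq_add_neg, ← neg_one_smul ℝ (∑ k, _)]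
        exact ((h.isNormalAt_normalConn hx _ i).add ((IsNormalAt.sum fun k _ =>
          (h.isNormalAt_normalConn hx _ k).smul _).smul _)).smul _
    conv_lhs => rw [h.eq_sum_of_isNormalAt hx hn]
    simp only [h.inner_normalLaplacian_I_pd hx, h.inner_normalLaplacian_I_self hx]
  have hQ : simonsOperator u x (meanCurv u x) = ∑ k, (∑ i, ∑ j, ∑ p, ∑ q,
      invMetric u x i p * invMetric u x j q * secondFundMean u i j x * cubicForm u p q k x)
        • (Complex.I • dualFrame u k x) := by
    change ∑ i, ∑ j, ∑ p, ∑ q, (invMetric u x i p * invMetric u x j q *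
      secondFundMean u i j x) • secondFundCoeff u p q x = _
    simp only [h.secondFundCoeff_eq hx, Fin.sum_univ_two]
    module
  rw [willmoreOperator, legendrianWillmoreField, hgrad, hB, hL, hQ, h.surfDiv_JH hx, reeb]
  congr 1
  -- The Simons terms of `hL` and `hQ` cancel; the signs of Div(JH) = -div and R = -iu match the
  -- gradient and Reeb terms.
  simp only [Fin.sum_univ_two]
  module

end IsLegendrianOn
end LegendrianWillmore
-- The first variation of the Willmore integrand: algebra and divergence form.
namespace LegendrianWillmore

/-- The first variation `⟪∂ᵢV, ∂ⱼu⟫ + ⟪∂ᵢu, ∂ⱼV⟫` of the metric in the direction `V`. -/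
def metricVar (u V : Plane → C3) (i j : Fin 2) (x : Plane) : ℝ :=
  inner ℝ (pd i V x) (pd j u x) + inner ℝ (pd i u x) (pd j V x)

/-- The first variation of the area element. -/
def areaVar (u V : Plane → C3) (x : Plane) : ℝ :=
  areaElement u x * ((1 / 2) * ∑ p, ∑ q, invMetric u x p q * metricVar u V p q x)

/-- The first variation of `√(det g) θˡ`. -/
def dualFrameVar (u V : Plane → C3) (l : Fin 2) (x : Plane) : C3 :=
  areaElement u x • (((1 / 2) * ∑ p, ∑ q, invMetric u x p q * metricVar u V p q x) •
      dualFrame u l x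
    - ∑ p, ∑ q, (invMetric u x l p * metricVar u V p q x) • dualFrame u q x
    + ∑ k, invMetric u x l k • pd k V x)

/-- The mean curvature vector `H - 2u` of the surface in `ℂ³`. -/
def flatMeanCurv (u : Plane → C3) (x : Plane) : C3 := meanCurv u x - (2 : ℝ) • u x

/-- The first variation of the Willmore integrand in coordinates. -/
def energyVar (u V : Plane → C3) (x : Plane) : ℝ :=
  (1 / 2) * inner ℝ (flatMeanCurv u x) (∑ l, pd l (dualFrameVar u V l) x)
    - (1 / 4) * inner ℝ (flatMeanCurv u x) (flatMeanCurv u x) * areaVar u V x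

/-- The vector field whose divergence is the difference of the first variation of the Willmore
integrand and its Euler–Lagrange form. -/
def energyVarFlux (u V : Plane → C3) (l : Fin 2) (x : Plane) : ℝ :=
  (1 / 2) * inner ℝ (flatMeanCurv u x) (dualFrameVar u V l x)
    - inner ℝ (areaElement u x • willmoreCurrent u l x) (V x)

namespace IsSphereImmersionOn

variable {u : Plane → C3} {Ω : Set Plane} (h : IsSphereImmersionOn u Ω) {x : Plane} (hx : x ∈ Ω)
include h

theorem smooth_metricVar {V : Plane → C3} (hV : ContDiffOn ℝ ∞ V Ω) (i j : Fin 2) :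
    ContDiffOn ℝ ∞ (metricVar u V i j) Ω :=
  ((contDiffOn_pd hV h.isOpen i).inner ℝ (h.smooth_pd j)).add
    ((h.smooth_pd i).inner ℝ (contDiffOn_pd hV h.isOpen j))

theorem smooth_dualFrameVar {V : Plane → C3} (hV : ContDiffOn ℝ ∞ V Ω) (l : Fin 2) :
    ContDiffOn ℝ ∞ (dualFrameVar u V l) Ω := by
  refine h.smooth_areaElement.smul (ContDiffOn.add (ContDiffOn.sub ?_ ?_) ?_)
  · exact ContDiffOn.smul (ContDiffOn.mul contDiffOn_const
      (ContDiffOn.sum fun p _ => ContDiffOn.sum fun q _ =>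
        (h.smooth_invMetric p q).mul (h.smooth_metricVar hV p q))) (h.smooth_dualFrame l)
  · exact ContDiffOn.sum fun p _ => ContDiffOn.sum fun q _ =>
      ((h.smooth_invMetric l p).mul (h.smooth_metricVar hV p q)).smul (h.smooth_dualFrame q)
  · exact ContDiffOn.sum fun k _ => (h.smooth_invMetric l k).smul (contDiffOn_pd hV h.isOpen k)

theorem smooth_flatMeanCurv : ContDiffOn ℝ ∞ (flatMeanCurv u) Ω :=
  h.smooth_meanCurv.sub (h.smooth.const_smul _)

theorem smooth_energyVarFlux {V : Plane → C3} (hV : ContDiffOn ℝ ∞ V Ω) (l : Fin 2) :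
    ContDiffOn ℝ ∞ (energyVarFlux u V l) Ω :=
  (contDiffOn_const.mul (h.smooth_flatMeanCurv.inner ℝ (h.smooth_dualFrameVar hV l))).sub
    ((h.smooth_areaElement.smul (h.smooth_willmoreCurrent l)).inner ℝ hV)

include hx

theorem inner_flatMeanCurv_self : (inner ℝ (flatMeanCurv u x) (flatMeanCurv u x) : ℝ)
    = inner ℝ (meanCurv u x) (meanCurv u x) + 4 := by
  have := (h.isNormalAt_meanCurv hx).2
  simp only [flatMeanCurv, inner_sub_left, inner_sub_right, real_inner_smul_left,
    real_inner_smul_right, this, real_inner_comm (meanCurv u x) (u x), h.inner_self hx]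
  ring

theorem pd_flatMeanCurv (l : Fin 2) : pd l (flatMeanCurv u) x
    = normalConn u l (meanCurv u) x - ∑ k, secondFundMean u l k x • dualFrame u k x
      - (2 : ℝ) • pd l u x := by
  rw [show flatMeanCurv u = fun y => meanCurv u y - (2 : ℝ) • u y from rfl,
    pd_sub (h.diff h.smooth_meanCurv hx) ((h.diff h.smooth hx).fun_const_smul _),
    pd_const_smul _ (h.diff h.smooth hx),
    h.pd_normal hx h.smooth_meanCurv fun y hy => h.isNormalAt_meanCurv hy]
  rfl

/-- Collects all terms of first order in V in the divergence of `energyVarFlux`. The contribution of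
-2∂ₗu in ∂ₗh is minus the area variation, and it cancels the 4 in |h|² = |H|² + 4. -/
theorem sum_inner_willmoreCurrent (V : Plane → C3) :
    areaElement u x * ∑ l, inner ℝ (willmoreCurrent u l x) (pd l V x)
      = (1 / 2) * ∑ l, inner ℝ (pd l (flatMeanCurv u) x) (dualFrameVar u V l x)
        + (1 / 4) * inner ℝ (flatMeanCurv u x) (flatMeanCurv u x) * areaVar u V x := by
  have hθV : ∀ l k, (inner ℝ (dualFrame u l x) (pd k V x) : ℝ)
      = ∑ p, invMetric u x l p * inner ℝ (pd p u x) (pd k V x) := fun l k => by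
    simp only [dualFrame, sum_inner, real_inner_smul_left]
  have huθ : ∀ l k, (inner ℝ (pd l u x) (dualFrame u k x) : ℝ) = if k = l then 1 else 0 :=
    fun l k => by rw [real_inner_comm, inner_dualFrame_pd (h.det_ne hx)]
  have hN := fun l k => (h.isNormalAt_normalConn hx (meanCurv u) l).inner_dualFrame k
  rw [h.inner_flatMeanCurv_self hx, inner_meanCurv_self]
  simp only [willmoreCurrent, inner_meanCurv_self, h.pd_flatMeanCurv hx, dualFrameVar, areaVar,
    inner_add_left, inner_sub_left, inner_add_right, inner_sub_right, inner_sum, sum_inner,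
    real_inner_smul_left, real_inner_smul_right, hθV, huθ, hN,
    inner_dualFrame_dualFrame (h.det_ne hx), metricVar, real_inner_comm (pd _ u x) (pd _ V x)]
  simp only [Fin.sum_univ_two, Fin.isValue, invMetric_comm u x 1 0, h.secondFundMean_comm hx 1 0,
    if_true, one_ne_zero, zero_ne_one, if_false]
  ring

/-- The first variation formula for the Willmore integrand. -/
theorem energyVar_eq {V : Plane → C3} (hV : ContDiffOn ℝ ∞ V Ω) : energyVar u V x
    = areaElement u x * inner ℝ (willmoreOperator u x) (V x)
      + ∑ l, pd l (energyVarFlux u V l) x := by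
  have hX := fun l => h.diff (h.smooth_dualFrameVar hV l) hx
  have hh := h.diff h.smooth_flatMeanCurv hx
  have hZ : ∀ l, DifferentiableAt ℝ (fun y => areaElement u y • willmoreCurrent u l y) x :=
    fun l => h.diff (h.smooth_areaElement.smul (h.smooth_willmoreCurrent l)) hx
  have e : ∀ l, pd l (energyVarFlux u V l) x
      = (1 / 2) * (inner ℝ (pd l (flatMeanCurv u) x) (dualFrameVar u V l x)
        + inner ℝ (flatMeanCurv u x) (pd l (dualFrameVar u V l) x))
      - (inner ℝ (pd l (fun y => areaElement u y • willmoreCurrent u l y) x) (V x)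
        + areaElement u x * inner ℝ (willmoreCurrent u l x) (pd l V x)) := fun l => by
    rw [show energyVarFlux u V l = fun y =>
      (1 / 2) * (inner ℝ (flatMeanCurv u y) (dualFrameVar u V l y) : ℝ)
        - inner ℝ (areaElement u y • willmoreCurrent u l y) (V y) from rfl,
      pd_sub ((hh.inner ℝ (hX l)).const_mul _) ((hZ l).inner ℝ (h.diff hV hx)),
      pd_const_mul _ (hh.inner ℝ (hX l)), pd_inner hh (hX l), pd_inner (hZ l) (h.diff hV hx),
      real_inner_smul_left]
  have e1 := h.sum_inner_willmoreCurrent hx V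
  have e2 := congrArg (fun w => (inner ℝ w (V x) : ℝ)) (h.sum_pd_willmoreCurrent hx)
  simp only [sum_inner, real_inner_smul_left] at e2
  simp only [e, energyVar, inner_sum, Finset.sum_sub_distrib, Finset.sum_add_distrib,
    ← Finset.mul_sum, e2]
  linear_combination e1

/-- Linearity in the variation field lets a partition of unity cut the field instead of the surface.
-/
theorem energyVar_sum {ι : Type*} (s : Finset ι) {V : ι → Plane → C3}
    (hV : ∀ k ∈ s, ContDiffOn ℝ ∞ (V k) Ω) :
    energyVar u (fun y => ∑ k ∈ s, V k y) x = ∑ k ∈ s, energyVar u (V k) x := by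
  have em : ∀ y ∈ Ω, ∀ i j, metricVar u (fun y => ∑ k ∈ s, V k y) i j y
      = ∑ k ∈ s, metricVar u (V k) i j y := fun y hy i j => by
    simp only [metricVar, pd_sum fun k hk => h.diff (hV k hk) hy, sum_inner, inner_sum,
      Finset.sum_add_distrib]
  have ed : ∀ l, ∀ y ∈ Ω, dualFrameVar u (fun y => ∑ k ∈ s, V k y) l y
      = ∑ k ∈ s, dualFrameVar u (V k) l y := fun l y hy => by
    simp only [dualFrameVar, em y hy, pd_sum fun k hk => h.diff (hV k hk) hy, Finset.mul_sum,
      Finset.sum_smul, Finset.smul_sum, smul_add, smul_sub, Finset.sum_add_distrib,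
      Finset.sum_sub_distrib, Fin.sum_univ_two, add_smul, mul_add]
  have ea : areaVar u (fun y => ∑ k ∈ s, V k y) x = ∑ k ∈ s, areaVar u (V k) x := by
    simp only [areaVar, em x hx, Fin.sum_univ_two, Finset.mul_sum, Finset.sum_add_distrib, mul_add]
  have ep : ∀ l, pd l (dualFrameVar u (fun y => ∑ k ∈ s, V k y) l) x
      = ∑ k ∈ s, pd l (dualFrameVar u (V k) l) x := fun l => by
    rw [pd_congr_on h.isOpen (ed l) hx,
      pd_sum fun k hk => h.diff (h.smooth_dualFrameVar (hV k hk) l) hx]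
  simp only [energyVar, ea, ep, inner_sum, Finset.mul_sum, Finset.sum_sub_distrib]
  rw [Finset.sum_comm]

end IsSphereImmersionOn

theorem energyVar_of_eventuallyEq_zero {u V : Plane → C3} {x : Plane}
    (hV : V =ᶠ[nhds x] fun _ => 0) : energyVar u V x = 0 := by
  have e : ∀ᶠ y in nhds x, ∀ l, dualFrameVar u V l y = 0 := by
    filter_upwards [hV.eventuallyEq_nhds] with y hy l
    simp [dualFrameVar, metricVar, pd_congr hy]
  have ep : ∀ l, pd l (dualFrameVar u V l) x = 0 := fun l => by
    rw [pd_congr (W := fun _ => (0 : C3)) (e.mono fun y hy => hy l), pd_const]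
  simp [energyVar, areaVar, metricVar, ep, pd_congr hV]

end LegendrianWillmore
-- Time derivatives of families of immersions.
namespace LegendrianWillmore

/-- The Willmore integrand `(¼ |H|² + 1) √(det g)` in coordinates. -/
def energyDensity (u : Plane → C3) (x : Plane) : ℝ :=
  (1 / 4 * ‖meanCurv u x‖ ^ 2 + 1) * areaElement u x

namespace IsSphereImmersionOn

variable {u : Plane → C3} {Ω : Set Plane} (h : IsSphereImmersionOn u Ω) {x : Plane} (hx : x ∈ Ω)
include h hx

/-- This is √g times the Laplace–Beltrami operator applied to `u`: the Christoffel terms of the area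
element and of the frame cancel, and the trace of the radial part -gᵢⱼu contributes -2u. -/
theorem sum_pd_areaElement_smul_dualFrame :
    ∑ l, pd l (fun y => areaElement u y • dualFrame u l y) x
      = areaElement u x • flatMeanCurv u x := by
  have e : ∀ l, pd l (fun y => areaElement u y • dualFrame u l y) x
      = areaElement u x • ((∑ k, christoffel u l k k x) • dualFrame u l x
        + pd l (dualFrame u l) x) := fun l => by
    rw [pd_smul (h.diff h.smooth_areaElement hx) (h.diff (h.smooth_dualFrame l) hx),
      h.pd_areaElement hx]
    module
  simp only [e, ← Finset.smul_sum, flatMeanCurv, meanCurv, h.pd_dualFrame hx]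
  congr 1
  simp only [Fin.sum_univ_two, Fin.isValue, h.christoffel_comm hx 1 0, if_true]
  module

/-- Since |H - 2u|² = |H|² + 4, the curvature term 1 is absorbed. In this form the time derivative
requires only that of √g θˡ, which involves first derivatives of the map. -/
theorem energyDensity_eq : energyDensity u x
    = (1 / 4) * (inner ℝ (∑ l, pd l (fun y => areaElement u y • dualFrame u l y) x)
        (∑ l, pd l (fun y => areaElement u y • dualFrame u l y) x) / areaElement u x) := by
  have hD := (h.areaElement_pos hx).ne'
  rw [h.sum_pd_areaElement_smul_dualFrame hx, real_inner_smul_left, real_inner_smul_right,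
    h.inner_flatMeanCurv_self hx, energyDensity, ← real_inner_self_eq_norm_sq]
  field_simp

end IsSphereImmersionOn

section TimeDerivative

variable {F : Type*} [NormedAddCommGroup F] [NormedSpace ℝ F] {G : Set (ℝ × Plane)}
  {W : ℝ × Plane → F} {q : ℝ × Plane}

/-- The time derivative of a family. -/
def dt (W : ℝ × Plane → F) (q : ℝ × Plane) : F := fderiv ℝ W q (1, 0)

/-- The coordinate derivative `∂ᵢ` of a family at fixed time. -/
def dx (i : Fin 2) (W : ℝ × Plane → F) (q : ℝ × Plane) : F := pd i (fun y => W (q.1, y)) q.2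

theorem dx_eq (hW : DifferentiableAt ℝ W q) (i : Fin 2) :
    dx i W q = fderiv ℝ W q (0, EuclideanSpace.single i 1) := by
  have h : HasFDerivAt (fun y => W (q.1, y)) (fderiv ℝ W q ∘L ContinuousLinearMap.inr ℝ ℝ Plane)
      q.2 := hW.hasFDerivAt.comp q.2 (hasFDerivAt_prodMk_right q.1 q.2)
  rw [dx, pd, h.fderiv]; simp

theorem hasDerivAt_dt (hW : DifferentiableAt ℝ W q) :
    HasDerivAt (fun s => W (s, q.2)) (dt W q) q.1 := by
  have h : HasFDerivAt (fun s => W (s, q.2)) (fderiv ℝ W q ∘L ContinuousLinearMap.inl ℝ ℝ Plane)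
      q.1 := hW.hasFDerivAt.comp q.1 (hasFDerivAt_prodMk_left q.1 q.2)
  simpa [dt] using h.hasDerivAt

theorem contDiffOn_dt (hW : ContDiffOn ℝ ∞ W G) (hG : IsOpen G) : ContDiffOn ℝ ∞ (dt W) G :=
  (hW.fderiv_of_isOpen hG (m := ∞) (by simp)).clm_apply contDiffOn_const

theorem contDiffOn_dx (hW : ContDiffOn ℝ ∞ W G) (hG : IsOpen G) (i : Fin 2) :
    ContDiffOn ℝ ∞ (dx i W) G :=
  ((hW.fderiv_of_isOpen hG (m := ∞) (by simp)).clm_apply contDiffOn_const).congr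
    fun _ hq => dx_eq (hW.differentiableAt_of_isOpen hG hq) i

/-- Time and space derivatives commute, by symmetry of the second derivative on the product. -/
theorem hasDerivAt_dx (hW : ContDiffOn ℝ ∞ W G) (hG : IsOpen G) (hq : q ∈ G) (i : Fin 2) :
    HasDerivAt (fun s => dx i W (s, q.2)) (pd i (fun y => dt W (q.1, y)) q.2) q.1 := by
  have hs : IsSymmSndFDerivAt ℝ W q :=
    (hW.contDiffAt (hG.mem_nhds hq)).isSymmSndFDerivAt (by simpa using ENat.LEInfty.out)
  have hd : DifferentiableAt ℝ (fderiv ℝ W) q :=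
    (hW.fderiv_of_isOpen hG (m := ∞) (by simp)).differentiableAt_of_isOpen hG hq
  have key : ∀ a b : ℝ × Plane, fderiv ℝ (fun y => fderiv ℝ W y a) q b
      = fderiv ℝ (fderiv ℝ W) q b a := fun a b => by
    rw [fderiv_clm_apply hd (differentiableAt_const a)]; simp
  have e : pd i (fun y => dt W (q.1, y)) q.2 = dt (dx i W) q := by
    have h1 := dx_eq ((contDiffOn_dt hW hG).differentiableAt_of_isOpen hG hq) i
    have h2 : dx i W =ᶠ[nhds q] fun y => fderiv ℝ W y (0, EuclideanSpace.single i 1) :=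
      Filter.mem_of_superset (hG.mem_nhds hq) fun y hy =>
        dx_eq (hW.differentiableAt_of_isOpen hG hy) i
    change dx i (dt W) q = _
    rw [h1, dt, h2.fderiv_eq, key]
    change fderiv ℝ (fun y => fderiv ℝ W y (1, 0)) q _ = _
    rw [key]
    exact hs _ _
  rw [e]
  exact hasDerivAt_dt ((contDiffOn_dx hW hG i).differentiableAt_of_isOpen hG hq)

end TimeDerivative

/-- `U` is a smooth family of immersions into the unit sphere, parametrized by the open set `G` of
pairs of a time and a point. -/
structure IsSphereImmersionFamilyOn (U : ℝ × Plane → C3) (G : Set (ℝ × Plane)) : Prop where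
  isOpen : IsOpen G
  smooth : ContDiffOn ℝ ∞ U G
  norm_eq : ∀ q ∈ G, ‖U q‖ = 1
  det_pos : ∀ q ∈ G, 0 < (metric (fun y => U (q.1, y)) q.2).det

namespace IsSphereImmersionFamilyOn

variable {U : ℝ × Plane → C3} {G : Set (ℝ × Plane)} (h : IsSphereImmersionFamilyOn U G)
  {q : ℝ × Plane} (hq : q ∈ G)
include h

theorem slice (t : ℝ) : IsSphereImmersionOn (fun y => U (t, y)) {y | (t, y) ∈ G} where
  isOpen := h.isOpen.preimage (by fun_prop)
  smooth := h.smooth.comp (contDiff_prodMk_right t).contDiffOn fun _ hy => hy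
  norm_eq y hy := h.norm_eq (t, y) hy
  det_pos y hy := h.det_pos (t, y) hy

theorem smooth_metric (i j : Fin 2) :
    ContDiffOn ℝ ∞ (fun q => metric (fun y => U (q.1, y)) q.2 i j) G :=
  (contDiffOn_dx h.smooth h.isOpen i).inner ℝ (contDiffOn_dx h.smooth h.isOpen j)

theorem smooth_det : ContDiffOn ℝ ∞ (fun q => (metric (fun y => U (q.1, y)) q.2).det) G := by
  simp only [det_metric]
  exact ((h.smooth_metric 0 0).mul (h.smooth_metric 1 1)).sub
    ((h.smooth_metric 0 1).mul (h.smooth_metric 0 1))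

theorem smooth_invMetric (i j : Fin 2) :
    ContDiffOn ℝ ∞ (fun q => invMetric (fun y => U (q.1, y)) q.2 i j) G := by
  have hd := h.smooth_det.inv fun y hy => (h.det_pos y hy).ne'
  simp only [invMetric_eq]
  fin_cases i <;> fin_cases j
  · exact hd.mul (h.smooth_metric 1 1)
  · exact hd.mul (h.smooth_metric 0 1).neg
  · exact hd.mul (h.smooth_metric 0 1).neg
  · exact hd.mul (h.smooth_metric 0 0)

theorem smooth_areaElement :
    ContDiffOn ℝ ∞ (fun q => areaElement (fun y => U (q.1, y)) q.2) G :=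
  h.smooth_det.sqrt fun y hy => (h.det_pos y hy).ne'

theorem smooth_areaElement_smul_dualFrame (l : Fin 2) : ContDiffOn ℝ ∞ (fun q : ℝ × Plane =>
    areaElement (fun y => U (q.1, y)) q.2 • dualFrame (fun y => U (q.1, y)) l q.2) G :=
  h.smooth_areaElement.smul <| ContDiffOn.sum fun k _ =>
    (h.smooth_invMetric l k).smul (contDiffOn_dx h.smooth h.isOpen k)

theorem smooth_energyDensity :
    ContDiffOn ℝ ∞ (fun q => energyDensity (fun y => U (q.1, y)) q.2) G := by
  have hE : ContDiffOn ℝ ∞ (fun q : ℝ × Plane => ∑ l, dx l (fun q : ℝ × Plane =>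
      areaElement (fun y => U (q.1, y)) q.2 • dualFrame (fun y => U (q.1, y)) l q.2) q) G :=
    ContDiffOn.sum fun l _ => contDiffOn_dx (h.smooth_areaElement_smul_dualFrame l) h.isOpen l
  refine ((contDiffOn_const (c := (1 / 4 : ℝ))).mul ((hE.inner ℝ hE).div h.smooth_areaElement fun q hq =>
    ((h.slice q.1).areaElement_pos (x := q.2) hq).ne')).congr fun q hq => ?_
  exact (h.slice q.1).energyDensity_eq (x := q.2) hq

include hq

theorem hasDerivAt_pd (i : Fin 2) : HasDerivAt (fun s => pd i (fun y => U (s, y)) q.2)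
    (pd i (fun y => dt U (q.1, y)) q.2) q.1 :=
  hasDerivAt_dx h.smooth h.isOpen hq i

theorem hasDerivAt_metric (i j : Fin 2) : HasDerivAt (fun s => metric (fun y => U (s, y)) q.2 i j)
    (metricVar (fun y => U (q.1, y)) (fun y => dt U (q.1, y)) i j q.2) q.1 := by
  have e := (h.hasDerivAt_pd hq i).inner ℝ (h.hasDerivAt_pd hq j)
  rw [add_comm] at e
  exact e

theorem hasDerivAt_det : HasDerivAt (fun s => (metric (fun y => U (s, y)) q.2).det)
    ((metric (fun y => U (q.1, y)) q.2).det * ∑ i, ∑ j, invMetric (fun y => U (q.1, y)) q.2 i j *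
      metricVar (fun y => U (q.1, y)) (fun y => dt U (q.1, y)) i j q.2) q.1 := by
  have hm := h.hasDerivAt_metric hq
  have e := ((hm 0 0).fun_mul (hm 1 1)).fun_sub ((hm 0 1).fun_mul (hm 1 0))
  have hd := (h.det_pos q hq).ne'
  simp only [Matrix.det_fin_two]
  refine e.congr_deriv ?_
  rw [← Matrix.det_fin_two]
  simp only [invMetric_eq, Fin.sum_univ_two]
  simp
  field_simp
  rw [metric_comm _ _ 1 0]
  ring

theorem hasDerivAt_invMetric (i j : Fin 2) :
    HasDerivAt (fun s => invMetric (fun y => U (s, y)) q.2 i j)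
      (-∑ k, ∑ l, invMetric (fun y => U (q.1, y)) q.2 i k *
        metricVar (fun y => U (q.1, y)) (fun y => dt U (q.1, y)) k l q.2 *
        invMetric (fun y => U (q.1, y)) q.2 l j) q.1 := by
  have hm := h.hasDerivAt_metric hq
  have hd := (h.det_pos q hq).ne'
  have hi := (h.hasDerivAt_det hq).fun_inv hd
  have hc : metricVar (fun y => U (q.1, y)) (fun y => dt U (q.1, y)) 1 0 q.2
      = metricVar (fun y => U (q.1, y)) (fun y => dt U (q.1, y)) 0 1 q.2 := by
    rw [metricVar, metricVar, real_inner_comm, add_comm]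
    congr 1
    rw [real_inner_comm]
  have hdet := det_metric (fun y => U (q.1, y)) q.2
  fin_cases i <;> fin_cases j <;> simp only [invMetric_eq] at hi ⊢
  · refine (hi.fun_mul (hm 1 1)).congr_deriv ?_
    simp [Fin.sum_univ_two, hc]
    field_simp
    rw [hdet]; ring
  · refine (hi.fun_mul (hm 0 1).fun_neg).congr_deriv ?_
    simp [Fin.sum_univ_two, hc]
    field_simp
    rw [hdet]; ring
  · refine (hi.fun_mul (hm 0 1).fun_neg).congr_deriv ?_
    simp [Fin.sum_univ_two, hc]
    field_simp
    rw [hdet]; ring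
  · refine (hi.fun_mul (hm 0 0)).congr_deriv ?_
    simp [Fin.sum_univ_two, hc]
    field_simp
    rw [hdet]; ring

theorem hasDerivAt_areaElement : HasDerivAt (fun s => areaElement (fun y => U (s, y)) q.2)
    (areaVar (fun y => U (q.1, y)) (fun y => dt U (q.1, y)) q.2) q.1 := by
  have hd := h.det_pos q hq
  have e := (h.hasDerivAt_det hq).sqrt hd.ne'
  refine e.congr_deriv ?_
  have hs := Real.sq_sqrt hd.le
  have hD : 0 < √(metric (fun y => U (q.1, y)) q.2).det := Real.sqrt_pos.2 hd
  rw [areaVar, areaElement]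
  field_simp
  rw [hs]
  ring

theorem hasDerivAt_areaElement_smul_dualFrame (l : Fin 2) :
    HasDerivAt (fun s => areaElement (fun y => U (s, y)) q.2 •
      dualFrame (fun y => U (s, y)) l q.2)
      (dualFrameVar (fun y => U (q.1, y)) (fun y => dt U (q.1, y)) l q.2) q.1 := by
  have hθ : HasDerivAt (fun s => dualFrame (fun y => U (s, y)) l q.2) _ q.1 :=
    HasDerivAt.fun_sum fun k (_ : k ∈ Finset.univ) =>
      (h.hasDerivAt_invMetric hq l k).fun_smul (h.hasDerivAt_pd hq k)
  refine ((h.hasDerivAt_areaElement hq).fun_smul hθ).congr_deriv ?_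
  rw [dualFrameVar, areaVar]
  simp only [dualFrame, Fin.sum_univ_two]
  module

theorem hasDerivAt_energyDensity : HasDerivAt (fun s => energyDensity (fun y => U (s, y)) q.2)
    (energyVar (fun y => U (q.1, y)) (fun y => dt U (q.1, y)) q.2) q.1 := by
  have hT := fun l => hasDerivAt_dx (h.smooth_areaElement_smul_dualFrame l) h.isOpen hq l
  have hq' : q.2 ∈ {y | (q.1, y) ∈ G} := hq
  have hD := ((h.slice q.1).areaElement_pos hq').ne'
  -- The time derivative of √g θˡ is identified at all points of the slice, since it is
  -- differentiated in space afterwards.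
  have e : ∀ l, pd l (fun y => dt (fun q : ℝ × Plane => areaElement (fun y => U (q.1, y)) q.2 •
      dualFrame (fun y => U (q.1, y)) l q.2) (q.1, y)) q.2
      = pd l (dualFrameVar (fun y => U (q.1, y)) (fun y => dt U (q.1, y)) l) q.2 := fun l => by
    refine pd_congr_on (h.slice q.1).isOpen (fun y hy => ?_) hq' l
    exact (hasDerivAt_dt ((h.smooth_areaElement_smul_dualFrame l).differentiableAt_of_isOpen
      h.isOpen hy)).unique (h.hasDerivAt_areaElement_smul_dualFrame (q := (q.1, y)) hy l)
  simp only [e] at hT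
  have hE := HasDerivAt.fun_sum fun l (_ : l ∈ Finset.univ) => hT l
  have key := ((hE.inner ℝ hE).fun_div (h.hasDerivAt_areaElement hq) hD).const_mul (1 / 4)
  have hev : ∀ᶠ s in nhds q.1, (s, q.2) ∈ G :=
    (Continuous.prodMk_left q.2).continuousAt.preimage_mem_nhds (h.isOpen.mem_nhds hq)
  refine (key.congr_of_eventuallyEq
    (hev.mono fun s hs => (h.slice s).energyDensity_eq hs)).congr_deriv ?_
  have hS := (h.slice q.1).sum_pd_areaElement_smul_dualFrame hq'
  simp only [dx]
  rw [hS, energyVar, real_inner_comm (areaElement _ _ • flatMeanCurv _ _)]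
  simp only [real_inner_smul_left, real_inner_smul_right]
  field_simp
  ring

end IsSphereImmersionFamilyOn
end LegendrianWillmore
-- Change of coordinates.
namespace LegendrianWillmore

/-- The Jacobian matrix of a change of coordinates. -/
def jacobian (ψ : Plane → Plane) (x : Plane) : Matrix (Fin 2) (Fin 2) ℝ :=
  Matrix.of fun i a => pd a ψ x i

theorem det_jacobian (ψ : Plane → Plane) (x : Plane) :
    (jacobian ψ x).det = (fderiv ℝ ψ x).det := by
  rw [ContinuousLinearMap.det, ← LinearMap.det_toMatrix (EuclideanSpace.basisFun (Fin 2) ℝ).toBasis]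
  congr 1

section

variable {F : Type*} [NormedAddCommGroup F] [NormedSpace ℝ F] {u : Plane → F} {ψ : Plane → Plane}
  {x : Plane}

theorem pd_comp (hu : DifferentiableAt ℝ u (ψ x)) (hψ : DifferentiableAt ℝ ψ x) (a : Fin 2) :
    pd a (fun y => u (ψ y)) x = ∑ i, jacobian ψ x i a • pd i u (ψ x) := by
  have h : HasFDerivAt (fun y => u (ψ y)) (fderiv ℝ u (ψ x) ∘L fderiv ℝ ψ x) x :=
    hu.hasFDerivAt.comp x hψ.hasFDerivAt
  have e : fderiv ℝ ψ x (EuclideanSpace.single a 1)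
      = ∑ i, jacobian ψ x i a • EuclideanSpace.single i (1 : ℝ) := by
    ext k; fin_cases k <;> simp [jacobian, pd]
  simp only [pd, h.fderiv, ContinuousLinearMap.comp_apply, e, map_sum, map_smul]

end

variable {u : Plane → C3} {ψ : Plane → Plane} {x : Plane}

theorem metric_comp (hu : DifferentiableAt ℝ u (ψ x)) (hψ : DifferentiableAt ℝ ψ x) :
    metric (fun y => u (ψ y)) x = (jacobian ψ x).transpose * metric u (ψ x) * jacobian ψ x := by
  ext a b
  simp only [metric_apply, pd_comp hu hψ, sum_inner, inner_sum, real_inner_smul_left,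
    real_inner_smul_right, Matrix.mul_apply, Matrix.transpose_apply, Finset.sum_mul]
  exact Finset.sum_congr rfl fun i _ => Finset.sum_congr rfl fun j _ => by ring

theorem areaElement_comp (hu : DifferentiableAt ℝ u (ψ x)) (hψ : DifferentiableAt ℝ ψ x) :
    areaElement (fun y => u (ψ y)) x = |(fderiv ℝ ψ x).det| * areaElement u (ψ x) := by
  rw [areaElement, areaElement, metric_comp hu hψ, Matrix.det_mul, Matrix.det_mul,
    Matrix.det_transpose, det_jacobian, mul_right_comm, ← sq, Real.sqrt_mul (sq_nonneg _),
    Real.sqrt_sq_eq_abs]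

namespace IsSphereImmersionOn

variable {Ω Ω' : Set Plane} (h : IsSphereImmersionOn u Ω) (hΩ' : IsOpen Ω')
  (hψ : ContDiffOn ℝ ∞ ψ Ω') (hm : Set.MapsTo ψ Ω' Ω) (hd : ∀ y ∈ Ω', (fderiv ℝ ψ y).det ≠ 0)
include h hΩ' hψ hm hd

theorem comp : IsSphereImmersionOn (fun y => u (ψ y)) Ω' where
  isOpen := hΩ'
  smooth := h.smooth.comp hψ hm
  norm_eq y hy := h.norm_eq _ (hm hy)
  det_pos y hy := by
    have h0 := h.det_pos _ (hm hy)
    have h1 := hd y hy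
    rw [metric_comp (h.diff h.smooth (hm hy)) (hψ.differentiableAt_of_isOpen hΩ' hy),
      Matrix.det_mul, Matrix.det_mul, Matrix.det_transpose, det_jacobian, mul_right_comm, ← sq]
    exact mul_pos (sq_pos_of_ne_zero h1) h0

theorem normalProj_comp (hx : x ∈ Ω') (w : C3) :
    normalProj (fun y => u (ψ y)) x w = normalProj u (ψ x) w := by
  have h' := h.comp hΩ' hψ hm hd
  have hp := pd_comp (h.diff h.smooth (hm hx)) (hψ.differentiableAt_of_isOpen hΩ' hx)
  have hn := h.isNormalAt_normalProj (hm hx) w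
  have hn' := h'.isNormalAt_normalProj hx w
  set n := normalProj u (ψ x) w with hnd
  have hnv : IsNormalAt (fun y => u (ψ y)) x n :=
    ⟨fun a => by rw [hp]; simp [inner_add_right, real_inner_smul_right, hn.1], hn.2⟩
  -- Inverting the Jacobian shows that both parametrizations have the same tangent plane, hence the
  -- same normal projection.
  have hz : ∀ k, normalProj (fun y => u (ψ y)) x (pd k u (ψ x)) = 0 := by
    intro k
    have e : pd k u (ψ x) = ∑ a, (jacobian ψ x)⁻¹ a k • pd a (fun y => u (ψ y)) x := by
      have hi := Matrix.mul_nonsing_inv (jacobian ψ x)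
        (by rw [det_jacobian]; exact (hd x hx).isUnit)
      have hi' := fun i => congrFun (congrFun hi i) k
      simp only [Matrix.mul_apply, Matrix.one_apply, Fin.sum_univ_two] at hi'
      simp only [hp, Fin.sum_univ_two]
      have h0 := hi' 0
      have h1 := hi' 1
      fin_cases k <;> simp at h0 h1 ⊢ <;>
        linear_combination (norm := module) -h0 • pd 0 u (ψ x) - h1 • pd 1 u (ψ x)
    rw [e, normalProj_sum]
    exact Finset.sum_eq_zero fun a _ => by rw [normalProj_smul, h'.normalProj_pd hx, smul_zero]
  have ew : w = n + (∑ i, tangentCoord u (ψ x) w i • pd i u (ψ x)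
      + (inner ℝ w (u (ψ x)) : ℝ) • u (ψ x)) := by rw [hnd, normalProj]; abel
  have hself := h'.normalProj_self hx
  rw [ew, normalProj_add, normalProj_add, normalProj_sum, hnv.normalProj_eq_self, normalProj_smul,
    hself]
  simp [normalProj_smul, hz]

/-- The second derivatives of ψ multiply tangent vectors, which the normal projection kills; so B
transforms as a tensor. -/
theorem secondFundCoeff_comp (hx : x ∈ Ω') (a b : Fin 2) :
    secondFundCoeff (fun y => u (ψ y)) a b x
      = ∑ i, ∑ j, (jacobian ψ x i a * jacobian ψ x j b) • secondFundCoeff u i j (ψ x) := by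
  have hψd := fun {y} (hy : y ∈ Ω') => hψ.differentiableAt_of_isOpen hΩ' hy
  have hJ : ∀ j, DifferentiableAt ℝ (fun y => jacobian ψ y j b) x := fun j =>
    (EuclideanSpace.proj (𝕜 := ℝ) j).differentiableAt.comp x
      ((contDiffOn_pd hψ hΩ' b).differentiableAt_of_isOpen hΩ' hx)
  have hc : ∀ j, DifferentiableAt ℝ (fun y => pd j u (ψ y)) x := fun j =>
    (h.diff (h.smooth_pd j) (hm hx)).comp x (hψd hx)
  rw [secondFundCoeff, h.normalProj_comp hΩ' hψ hm hd hx,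
    pd_congr_on hΩ' (fun y hy => pd_comp (h.diff h.smooth (hm hy)) (hψd hy) b) hx,
    pd_sum fun j _ => (hJ j).fun_smul (hc j), normalProj_sum, Finset.sum_comm]
  refine Finset.sum_congr rfl fun j _ => ?_
  rw [pd_smul (hJ j) (hc j), normalProj_add, normalProj_smul, normalProj_smul,
    h.normalProj_pd (hm hx), pd_comp (h.diff (h.smooth_pd j) (hm hx)) (hψd hx), normalProj_sum,
    smul_zero, zero_add, Finset.smul_sum]
  refine Finset.sum_congr rfl fun i _ => ?_
  rw [normalProj_smul, smul_smul, mul_comm, secondFundCoeff]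

/-- The mean curvature vector does not depend on the coordinates. -/
theorem meanCurv_comp (hx : x ∈ Ω') : meanCurv (fun y => u (ψ y)) x = meanCurv u (ψ x) := by
  have hJ : IsUnit (jacobian ψ x).det := by rw [det_jacobian]; exact (hd x hx).isUnit
  have hg : jacobian ψ x * invMetric (fun y => u (ψ y)) x * (jacobian ψ x).transpose
      = invMetric u (ψ x) := by
    rw [invMetric, metric_comp (h.diff h.smooth (hm hx)) (hψ.differentiableAt_of_isOpen hΩ' hx),
      Matrix.mul_inv_rev, Matrix.mul_inv_rev, ← Matrix.mul_assoc, Matrix.mul_nonsing_inv _ hJ,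
      Matrix.one_mul, Matrix.mul_assoc,
      Matrix.nonsing_inv_mul _ (by rwa [Matrix.det_transpose]), Matrix.mul_one, invMetric]
  simp only [meanCurv, h.secondFundCoeff_comp hΩ' hψ hm hd hx, ← hg, Matrix.mul_apply,
    Matrix.transpose_apply, Fin.sum_univ_two]
  module

end IsSphereImmersionOn

theorem meanCurv_congr {v w : Plane → C3} (h : v =ᶠ[nhds x] w) : meanCurv v x = meanCurv w x := by
  have h1 : ∀ i, pd i v =ᶠ[nhds x] pd i w := fun i => pd_eventuallyEq h i
  have hg : metric v x = metric w x := by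
    ext i j; simp only [metric_apply, (h1 _).eq_of_nhds]
  simp only [meanCurv, invMetric, hg, secondFundCoeff, normalProj, tangentCoord,
    (h1 _).eq_of_nhds, pd_congr (h1 _), h.eq_of_nhds]

theorem areaElement_congr {v w : Plane → C3} (h : v =ᶠ[nhds x] w) :
    areaElement v x = areaElement w x := by
  have hg : metric v x = metric w x := by
    ext i j; simp only [metric_apply, pd_congr h]
  rw [areaElement, hg, areaElement]

end LegendrianWillmore
-- The divergence theorem, chart transitions and the area measure.
namespace LegendrianWillmore

open MeasureTheory

set_option linter.unusedSectionVars false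

/-- The divergence theorem for functions which vanish outside a compact set. -/
theorem setIntegral_pd_eq_zero {Y : Plane → ℝ} {Ω C : Set Plane} (hΩ : IsOpen Ω)
    (hY : ContDiffOn ℝ ∞ Y Ω) (hC : IsCompact C) (hCΩ : C ⊆ Ω) (h0 : ∀ x ∈ Ω, x ∉ C → Y x = 0)
    (l : Fin 2) : ∫ x in C, pd l Y x = 0 := by
  -- Extension by zero is smooth on the whole plane: it agrees with Y near each point of C and
  -- vanishes on the open complement. Integration by parts against the constant 1 then gives the
  -- claim.
  set Z : Plane → ℝ := C.indicator Y with hZ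
  have hZΩ : ∀ x ∈ Ω, Z =ᶠ[nhds x] Y := fun x hx =>
    Filter.mem_of_superset (hΩ.mem_nhds hx) fun y hy => by
      by_cases hyC : y ∈ C
      · exact Set.indicator_of_mem hyC Y
      · change C.indicator Y y = Y y
        rw [Set.indicator_of_notMem hyC, h0 y hy hyC]
  have hZC : ∀ x ∉ C, Z =ᶠ[nhds x] fun _ => 0 := fun x hx =>
    Filter.mem_of_superset (hC.isClosed.isOpen_compl.mem_nhds hx) fun y hy =>
      Set.indicator_of_notMem hy Y
  have hZs : ContDiff ℝ ∞ Z := contDiff_iff_contDiffAt.2 fun x => by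
    by_cases hx : x ∈ C
    · exact (hY.contDiffAt (hΩ.mem_nhds (hCΩ hx))).congr_of_eventuallyEq (hZΩ x (hCΩ hx))
    · exact contDiffAt_const.congr_of_eventuallyEq (hZC x hx)
  have hsupp : HasCompactSupport Z := HasCompactSupport.intro hC fun x hx =>
    Set.indicator_of_notMem hx Y
  have hpd : Continuous (pd l Z) :=
    (hZs.continuous_fderiv (by simp)).clm_apply continuous_const
  have hpds : HasCompactSupport (pd l Z) := HasCompactSupport.intro hC fun x hx => by
    rw [pd_congr (hZC x hx), pd_const]
  have e := integral_mul_fderiv_eq_neg_fderiv_mul_of_integrable (μ := (volume : Measure Plane))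
    (f := fun _ => (1 : ℝ)) (g := Z) (v := EuclideanSpace.single l 1) (by simp)
    (by simp only [one_mul]; exact hpd.integrable_of_hasCompactSupport hpds)
    (by simp only [one_mul]; exact hZs.continuous.integrable_of_hasCompactSupport hsupp)
    (by fun_prop) (by exact fun x _ => (hZs.differentiable (by simp)).differentiableAt)
  have e1 : ∫ x, pd l Z x = 0 := by simpa [pd] using e
  rw [← setIntegral_eq_integral_of_forall_compl_eq_zero (s := C)
    (fun x hx => by rw [pd_congr (hZC x hx), pd_const])] at e1
  rw [← e1]
  exact setIntegral_congr_fun hC.measurableSet fun x hx => (pd_congr (hZΩ x (hCΩ hx)) l).symm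

section Charts

variable {M : Type*} [TopologicalSpace M] [ChartedSpace Plane M] [IsManifold (𝓡 2) ∞ M]
  {e e' : OpenPartialHomeomorph M Plane}

theorem contDiffOn_comp_symm {F : Type*} [NormedAddCommGroup F] [NormedSpace ℝ F] {f : M → F}
    (hf : ContMDiff (𝓡 2) 𝓘(ℝ, F) ∞ f) (he : e ∈ IsManifold.maximalAtlas (𝓡 2) ∞ M) :
    ContDiffOn ℝ ∞ (f ∘ e.symm) e.target :=
  contMDiffOn_iff_contDiffOn.1 (hf.comp_contMDiffOn (contMDiffOn_symm_of_mem_maximalAtlas he))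

/-- The change of coordinates from `e` to `e'`. -/
def transition (e e' : OpenPartialHomeomorph M Plane) (y : Plane) : Plane := e' (e.symm y)

/-- The domain of the change of coordinates. -/
def overlap (e e' : OpenPartialHomeomorph M Plane) : Set Plane :=
  e.target ∩ e.symm ⁻¹' e'.source

theorem isOpen_overlap : IsOpen (overlap e e') := e.isOpen_inter_preimage_symm e'.open_source

theorem transition_mem {y : Plane} (hy : y ∈ overlap e e') :
    transition e e' y ∈ overlap e' e :=
  ⟨e'.map_source hy.2, by
    rw [Set.mem_preimage, transition, e'.left_inv hy.2]; exact e.map_target hy.1⟩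

theorem symm_transition {y : Plane} (hy : y ∈ overlap e e') :
    e'.symm (transition e e' y) = e.symm y := e'.left_inv hy.2

theorem transition_transition {y : Plane} (hy : y ∈ overlap e e') :
    transition e' e (transition e e' y) = y := by
  rw [transition, symm_transition hy, e.right_inv hy.1]

theorem contDiffOn_transition (he : e ∈ IsManifold.maximalAtlas (𝓡 2) ∞ M)
    (he' : e' ∈ IsManifold.maximalAtlas (𝓡 2) ∞ M) :
    ContDiffOn ℝ ∞ (transition e e') (overlap e e') :=
  contMDiffOn_iff_contDiffOn.1 ((contMDiffOn_of_mem_maximalAtlas he').comp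
    ((contMDiffOn_symm_of_mem_maximalAtlas he).mono Set.inter_subset_left) fun _ hy => hy.2)

theorem det_transition_ne (he : e ∈ IsManifold.maximalAtlas (𝓡 2) ∞ M)
    (he' : e' ∈ IsManifold.maximalAtlas (𝓡 2) ∞ M) {y : Plane} (hy : y ∈ overlap e e') :
    (fderiv ℝ (transition e e') y).det ≠ 0 := by
  have h1 := ((contDiffOn_transition he he').differentiableAt_of_isOpen isOpen_overlap
    hy).hasFDerivAt
  have h2 := ((contDiffOn_transition he' he).differentiableAt_of_isOpen isOpen_overlap
    (transition_mem hy)).hasFDerivAt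
  have h3 : HasFDerivAt (fun y => transition e' e (transition e e' y)) _ y := h2.comp y h1
  have h4 : HasFDerivAt (fun y => transition e' e (transition e e' y))
      (ContinuousLinearMap.id ℝ Plane) y :=
    (hasFDerivAt_id y).congr_of_eventuallyEq (Filter.mem_of_superset
      (isOpen_overlap.mem_nhds hy) fun z hz => transition_transition hz)
  have h5 := congrArg ContinuousLinearMap.det (h3.unique h4)
  have h6 : ContinuousLinearMap.det (fderiv ℝ (transition e' e) (transition e e' y) ∘L
      fderiv ℝ (transition e e') y) = (fderiv ℝ (transition e' e) (transition e e' y)).det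
        * (fderiv ℝ (transition e e') y).det := LinearMap.det_comp _ _
  rw [h6] at h5
  have h7 : (ContinuousLinearMap.id ℝ Plane).det = 1 := LinearMap.det_id
  rw [h7] at h5
  exact right_ne_zero_of_mul_eq_one h5

variable {f : M → C3}

theorem comp_symm_eventuallyEq {y : Plane} (hy : y ∈ overlap e e') :
    f ∘ e.symm =ᶠ[nhds y] fun z => (f ∘ e'.symm) (transition e e' z) :=
  Filter.mem_of_superset (isOpen_overlap.mem_nhds hy) fun z hz => by
    change f (e.symm z) = f (e'.symm (transition e e' z))
    rw [symm_transition hz]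

theorem areaElement_transition (hf : ContMDiff (𝓡 2) 𝓘(ℝ, C3) ∞ f)
    (he : e ∈ IsManifold.maximalAtlas (𝓡 2) ∞ M) (he' : e' ∈ IsManifold.maximalAtlas (𝓡 2) ∞ M)
    {y : Plane} (hy : y ∈ overlap e e') : areaElement (f ∘ e.symm) y
      = |(fderiv ℝ (transition e e') y).det| * areaElement (f ∘ e'.symm) (transition e e' y) := by
  rw [areaElement_congr (comp_symm_eventuallyEq (e' := e') hy), areaElement_comp]
  · exact (contDiffOn_comp_symm hf he').differentiableAt_of_isOpen e'.open_target
      (transition_mem hy).1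
  · exact (contDiffOn_transition he he').differentiableAt_of_isOpen isOpen_overlap hy

/-- The set of points of the chart at which `f` is an immersion. -/
def immersedTarget (f : M → C3) (e : OpenPartialHomeomorph M Plane) : Set Plane :=
  {x ∈ e.target | 0 < (metric (f ∘ e.symm) x).det}

theorem continuousOn_det {u : Plane → C3} {Ω : Set Plane} (hΩ : IsOpen Ω)
    (hu : ContDiffOn ℝ ∞ u Ω) : ContinuousOn (fun x => (metric u x).det) Ω := by
  have hc := fun i => (contDiffOn_pd hu hΩ i).continuousOn
  simp only [det_metric, metric_apply]
  exact (((hc 0).inner (hc 0)).mul ((hc 1).inner (hc 1))).sub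
    (((hc 0).inner (hc 1)).mul ((hc 0).inner (hc 1)))

theorem isSphereImmersionOn_immersedTarget (hf : ContMDiff (𝓡 2) 𝓘(ℝ, C3) ∞ f)
    (hn : ∀ p, ‖f p‖ = 1) (he : e ∈ IsManifold.maximalAtlas (𝓡 2) ∞ M) :
    IsSphereImmersionOn (f ∘ e.symm) (immersedTarget f e) where
  isOpen := (continuousOn_det e.open_target (contDiffOn_comp_symm hf he)).isOpen_inter_preimage
    e.open_target isOpen_Ioi
  smooth := (contDiffOn_comp_symm hf he).mono fun _ hx => hx.1
  norm_eq _ _ := hn _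
  det_pos _ hx := hx.2

/-- The mean curvature vector does not depend on the chart. -/
theorem meanCurv_chart (hf : ContMDiff (𝓡 2) 𝓘(ℝ, C3) ∞ f)
    (hn : ∀ p, ‖f p‖ = 1) (he : e ∈ IsManifold.maximalAtlas (𝓡 2) ∞ M)
    (he' : e' ∈ IsManifold.maximalAtlas (𝓡 2) ∞ M) {p : M} (hp : p ∈ e.source)
    (hp' : p ∈ e'.source) (hi : e' p ∈ immersedTarget f e') :
    meanCurv (f ∘ e.symm) (e p) = meanCurv (f ∘ e'.symm) (e' p) := by
  have h := isSphereImmersionOn_immersedTarget hf hn he'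
  have ht := contDiffOn_transition he he'
  have hpo : e p ∈ overlap e e' := ⟨e.map_source hp, by
    rw [Set.mem_preimage, e.left_inv hp]; exact hp'⟩
  have hpt : transition e e' (e p) = e' p := by rw [transition, e.left_inv hp]
  have hO : IsOpen (overlap e e' ∩ transition e e' ⁻¹' immersedTarget f e') :=
    ht.continuousOn.isOpen_inter_preimage isOpen_overlap h.isOpen
  rw [meanCurv_congr (comp_symm_eventuallyEq (e' := e') hpo), h.meanCurv_comp hO
    (ht.mono Set.inter_subset_left) (fun y hy => hy.2)
    (fun y hy => det_transition_ne he he' hy.1) ⟨hpo, by rwa [Set.mem_preimage, hpt]⟩, hpt]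

theorem willmoreDensity_eq (hf : ContMDiff (𝓡 2) 𝓘(ℝ, C3) ∞ f)
    (hn : ∀ p, ‖f p‖ = 1) (he : e ∈ IsManifold.maximalAtlas (𝓡 2) ∞ M) {p : M}
    (hp : p ∈ e.source) (hi : e p ∈ immersedTarget f e) :
    willmoreDensity f p = 1 / 4 * ‖meanCurv (f ∘ e.symm) (e p)‖ ^ 2 + 1 := by
  rw [willmoreDensity, meanCurv_chart hf hn
    (IsManifold.chart_mem_maximalAtlas p) he (mem_chart_source Plane p) hp hi]

end Charts

section Measure

variable {M : Type*} [TopologicalSpace M] [ChartedSpace Plane M] [IsManifold (𝓡 2) ∞ M]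
  [MeasurableSpace M] [BorelSpace M] {e e' : OpenPartialHomeomorph M Plane} {f : M → C3}

theorem aemeasurable_symm (e : OpenPartialHomeomorph M Plane) :
    AEMeasurable e.symm ((volume : Measure Plane).restrict e.target) :=
  e.continuousOn_symm.aemeasurable e.open_target.measurableSet

theorem chartAreaMeasure_apply (f : M → C3) (e : OpenPartialHomeomorph M Plane) {A : Set M}
    (hA : MeasurableSet A) : chartAreaMeasure f e A
      = ∫⁻ x in e.target ∩ e.symm ⁻¹' A, ENNReal.ofReal (areaElement (f ∘ e.symm) x) := by
  rw [chartAreaMeasure, Measure.map_apply_of_aemeasurable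
    ((aemeasurable_symm e).mono_ac (withDensity_absolutelyContinuous _ _)) hA,
    withDensity_apply' _ _, Measure.restrict_restrict' e.open_target.measurableSet,
    Set.inter_comm]
  rfl

/-- Change of variables for the transition map, whose Jacobian factor is exactly the ratio of the
two area elements. -/
theorem chartAreaMeasure_inter_source (hf : ContMDiff (𝓡 2) 𝓘(ℝ, C3) ∞ f)
    (he : e ∈ IsManifold.maximalAtlas (𝓡 2) ∞ M) (he' : e' ∈ IsManifold.maximalAtlas (𝓡 2) ∞ M)
    {A : Set M} (hA : MeasurableSet A) :
    chartAreaMeasure f e (A ∩ e'.source) = chartAreaMeasure f e' (A ∩ e.source) := by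
  rw [chartAreaMeasure_apply f e (hA.inter e'.open_source.measurableSet),
    chartAreaMeasure_apply f e' (hA.inter e.open_source.measurableSet)]
  set S := e.target ∩ e.symm ⁻¹' (A ∩ e'.source) with hS
  have hSo : S ⊆ overlap e e' := fun y hy => ⟨hy.1, hy.2.2⟩
  have himg : e'.target ∩ e'.symm ⁻¹' (A ∩ e.source) = transition e e' '' S := by
    ext y
    constructor
    · rintro ⟨h1, h2, h3⟩
      have hy : y ∈ overlap e' e := ⟨h1, h3⟩
      have := transition_mem hy
      exact ⟨transition e' e y, ⟨this.1, by
        rw [Set.mem_preimage, symm_transition hy]; exact ⟨h2, e'.map_target h1⟩⟩,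
        transition_transition hy⟩
    · rintro ⟨z, hz, rfl⟩
      have := transition_mem (hSo hz)
      exact ⟨this.1, (symm_transition (hSo hz)).symm ▸ hz.2.1, this.2⟩
  -- The inverse chart is continuous only on the target, so measurability is obtained from its
  -- restriction to that subtype.
  have hSm : MeasurableSet S := by
    obtain ⟨B, hB, hBe⟩ := (measurable_iff_comap_le.1
      (continuousOn_iff_continuous_domRestrict.1 e.continuousOn_symm).measurable) _
      ⟨A ∩ e'.source, hA.inter e'.open_source.measurableSet, rfl⟩
    have : S = e.target ∩ B := by
      ext y
      constructor
      · rintro ⟨h1, h2⟩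
        exact ⟨h1, (Set.ext_iff.1 hBe ⟨y, h1⟩).2 h2⟩
      · rintro ⟨h1, h2⟩
        exact ⟨h1, (Set.ext_iff.1 hBe ⟨y, h1⟩).1 h2⟩
    rw [this]
    exact e.open_target.measurableSet.inter hB
  rw [himg, lintegral_image_eq_lintegral_abs_det_fderiv_mul volume hSm (fun y hy =>
    (((contDiffOn_transition he he').differentiableAt_of_isOpen isOpen_overlap
      (hSo hy)).hasFDerivAt.hasFDerivWithinAt))
    (Set.LeftInvOn.injOn fun y hy => transition_transition (hSo hy))]
  refine setLIntegral_congr_fun hSm fun y hy => ?_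
  rw [areaElement_transition hf he he' (hSo hy), ENNReal.ofReal_mul (abs_nonneg _)]

theorem areaMeasure_restrict_source (hf : ContMDiff (𝓡 2) 𝓘(ℝ, C3) ∞ f)
    (he : e ∈ IsManifold.maximalAtlas (𝓡 2) ∞ M) :
    (areaMeasure f).restrict e.source = (chartAreaMeasure f e).restrict e.source := by
  apply le_antisymm
  · have hle : areaMeasure f ≤ (chartAreaMeasure f e).restrict e.source
        + (⊤ : Measure M).restrict e.sourceᶜ := by
      refine iSup₂_le fun e' he' => ?_
      rw [← Measure.restrict_add_restrict_compl (μ := chartAreaMeasure f e')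
        e.open_source.measurableSet]
      refine add_le_add ?_ (Measure.restrict_mono le_rfl le_top)
      · refine Measure.le_iff.2 fun A hA => ?_
        rw [Measure.restrict_apply hA, Measure.restrict_apply hA]
        have h1 := chartAreaMeasure_inter_source hf he' he (hA.inter e.open_source.measurableSet)
        rw [Set.inter_assoc, Set.inter_self] at h1
        rw [h1]
        exact measure_mono Set.inter_subset_left
    refine (Measure.restrict_mono le_rfl hle).trans ?_
    rw [Measure.restrict_add, Measure.restrict_restrict e.open_source.measurableSet,
      Measure.restrict_restrict e.open_source.measurableSet, Set.inter_self, Set.inter_compl_self,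
      Measure.restrict_empty, add_zero]
  · exact Measure.restrict_mono le_rfl (le_iSup₂_of_le e he le_rfl)

theorem continuousOn_areaElement (hf : ContMDiff (𝓡 2) 𝓘(ℝ, C3) ∞ f)
    (he : e ∈ IsManifold.maximalAtlas (𝓡 2) ∞ M) :
    ContinuousOn (areaElement (f ∘ e.symm)) e.target :=
  (continuousOn_det e.open_target (contDiffOn_comp_symm hf he)).sqrt

end Measure
end LegendrianWillmore
-- Integration over compact subsets of a chart, and differentiation under the integral.
namespace LegendrianWillmore

open MeasureTheory

set_option linter.unusedSectionVars false

section Integration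

variable {M : Type*} [TopologicalSpace M] [T2Space M] [ChartedSpace Plane M]
  [IsManifold (𝓡 2) ∞ M] [MeasurableSpace M] [BorelSpace M]
  {e : OpenPartialHomeomorph M Plane} {f : M → C3}

theorem areaMeasure_restrict_of_subset (hf : ContMDiff (𝓡 2) 𝓘(ℝ, C3) ∞ f)
    (he : e ∈ IsManifold.maximalAtlas (𝓡 2) ∞ M) {S : Set M} (hS : MeasurableSet S)
    (hSe : S ⊆ e.source) :
    (areaMeasure f).restrict S = (chartAreaMeasure f e).restrict S := by
  have h := congrArg (fun μ => μ.restrict S) (areaMeasure_restrict_source hf he)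
  simpa only [Measure.restrict_restrict hS, Set.inter_eq_left.2 hSe] using h

theorem isCompact_image {S : Set M} (hS : IsCompact S) (hSe : S ⊆ e.source) :
    IsCompact (e '' S) := hS.image_of_continuousOn (e.continuousOn.mono hSe)

theorem image_subset_target {S : Set M} (hSe : S ⊆ e.source) : e '' S ⊆ e.target := by
  rintro _ ⟨p, hp, rfl⟩; exact e.map_source (hSe hp)

theorem isLocallyFiniteMeasure_areaMeasure (hf : ContMDiff (𝓡 2) 𝓘(ℝ, C3) ∞ f) :
    IsLocallyFiniteMeasure (areaMeasure f) := ⟨fun p => by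
  have : LocallyCompactSpace M := ChartedSpace.locallyCompactSpace Plane M
  obtain ⟨S, hSn, hSe, hS⟩ := local_compact_nhds
    ((chartAt Plane p).open_source.mem_nhds (mem_chart_source Plane p))
  refine ⟨S, hSn, ?_⟩
  have he : chartAt Plane p ∈ IsManifold.maximalAtlas (𝓡 2) ∞ M :=
    IsManifold.chart_mem_maximalAtlas p
  have hSm := hS.isClosed.measurableSet
  rw [← Measure.restrict_apply_self, areaMeasure_restrict_of_subset hf he hSm hSe,
    Measure.restrict_apply_self, chartAreaMeasure_apply f _ hSm,
    ← (chartAt Plane p).image_eq_target_inter_inv_preimage hSe]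
  exact (((continuousOn_areaElement hf he).mono (image_subset_target hSe)).integrableOn_compact
    (isCompact_image hS hSe)).lintegral_lt_top⟩

theorem integrableOn_areaMeasure (hf : ContMDiff (𝓡 2) 𝓘(ℝ, C3) ∞ f) {S : Set M}
    (hS : IsCompact S) {g : M → ℝ} (hg : ContinuousOn g S) :
    IntegrableOn g S (areaMeasure f) :=
  haveI := isLocallyFiniteMeasure_areaMeasure hf
  hg.integrableOn_compact hS

theorem setIntegral_areaMeasure (hf : ContMDiff (𝓡 2) 𝓘(ℝ, C3) ∞ f)
    (he : e ∈ IsManifold.maximalAtlas (𝓡 2) ∞ M) {S : Set M} (hS : IsCompact S)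
    (hSe : S ⊆ e.source) {g : M → ℝ} (hg : ContinuousOn g S) :
    ∫ p in S, g p ∂(areaMeasure f)
      = ∫ x in e '' S, areaElement (f ∘ e.symm) x * g (e.symm x) := by
  have hSm := hS.isClosed.measurableSet
  have hae := (aemeasurable_symm e).mono_ac (withDensity_absolutelyContinuous
    (volume.restrict e.target) fun x => ENNReal.ofReal (areaElement (f ∘ e.symm) x))
  have hres : (chartAreaMeasure f e).restrict S = Measure.map e.symm
      ((volume.restrict (e '' S)).withDensity
        fun x => ENNReal.ofReal (areaElement (f ∘ e.symm) x)) := by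
    change (Measure.map e.symm ((volume.restrict e.target).withDensity
        fun x => ENNReal.ofReal (areaElement (f ∘ e.symm) x))).restrict S = _
    rw [Measure.restrict_map_of_aemeasurable hae hSm, restrict_withDensity',
      Measure.restrict_restrict' e.open_target.measurableSet,
      e.image_eq_target_inter_inv_preimage hSe, Set.inter_comm]
  have hCm : MeasurableSet (e '' S) := (isCompact_image hS hSe).isClosed.measurableSet
  have hsub : e '' S ⊆ e.target := image_subset_target hSe
  have hρ : AEMeasurable (areaElement (f ∘ e.symm)) (volume.restrict (e '' S)) :=
    ((continuousOn_areaElement hf he).mono hsub).aemeasurable hCm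
  rw [areaMeasure_restrict_of_subset hf he hSm hSe, hres, integral_map,
    integral_withDensity_eq_integral_toReal_smul₀ hρ.ennreal_ofReal (by simp)]
  · refine setIntegral_congr_fun hCm fun x _ => ?_
    change ENNReal.toReal (ENNReal.ofReal √_) • _ = _
    rw [ENNReal.toReal_ofReal (Real.sqrt_nonneg _), smul_eq_mul]
    rfl
  · exact ((aemeasurable_symm e).mono_measure (Measure.restrict_mono hsub le_rfl)).mono_ac
      (withDensity_absolutelyContinuous _ _)
  · rw [← hres]
    exact hg.aestronglyMeasurable hSm

end Integration

section ParametricIntegral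

/-- Differentiation under the integral sign for a family of functions on a compact set. -/
theorem hasDerivAt_setIntegral_of_contDiffOn {G : Set (ℝ × Plane)} (hG : IsOpen G)
    {L : ℝ × Plane → ℝ} (hL : ContDiffOn ℝ ∞ L G) {C : Set Plane} (hC : IsCompact C)
    (hCG : ∀ x ∈ C, ((0 : ℝ), x) ∈ G) {φ : Plane → ℝ} (hφ : ContinuousOn φ C) :
    HasDerivAt (fun t => ∫ x in C, φ x * L (t, x)) (∫ x in C, φ x * dt L (0, x)) 0 := by
  have hsub : ({0} : Set ℝ) ×ˢ C ⊆ G := by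
    rintro ⟨t, x⟩ ⟨ht, hx⟩
    obtain rfl : t = 0 := ht
    exact hCG x hx
  -- The tube lemma gives one time interval that works for all points of C; compactness of the
  -- closed interval times C gives a constant dominating bound.
  obtain ⟨T, X, hT, -, h0T, hCX, hTX⟩ := generalized_tube_lemma isCompact_singleton hC hG hsub
  obtain ⟨ε, hε, hball⟩ := Metric.nhds_basis_closedBall.mem_iff.1
    (hT.mem_nhds (h0T (Set.mem_singleton 0)))
  have hK : IsCompact (Metric.closedBall (0 : ℝ) ε ×ˢ C) := (isCompact_closedBall 0 ε).prod hC
  have hKG : Metric.closedBall (0 : ℝ) ε ×ˢ C ⊆ G := fun q hq => hTX ⟨hball hq.1, hCX hq.2⟩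
  have hc1 : ContinuousOn (fun q : ℝ × Plane => φ q.2 * dt L q) (Metric.closedBall (0 : ℝ) ε ×ˢ C) :=
    (hφ.comp continuousOn_snd fun q hq => hq.2).mul ((contDiffOn_dt hL hG).continuousOn.mono hKG)
  obtain ⟨B, hB⟩ := hK.exists_bound_of_continuousOn hc1
  have hCm := hC.isClosed.measurableSet
  have hslice : ∀ t ∈ Metric.closedBall (0 : ℝ) ε, ContinuousOn (fun x => φ x * L (t, x)) C :=
    fun t ht => hφ.mul (hL.continuousOn.comp (Continuous.prodMk_right t).continuousOn
      fun x hx => hKG ⟨ht, hx⟩)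
  have h0 : (0 : ℝ) ∈ Metric.closedBall (0 : ℝ) ε := Metric.mem_closedBall_self hε.le
  refine (hasDerivAt_integral_of_dominated_loc_of_deriv_le (bound := fun _ => B)
    (F' := fun t x => φ x * dt L (t, x)) (Metric.closedBall_mem_nhds 0 hε) ?_ ?_ ?_ ?_ ?_ ?_).2
  · filter_upwards [Metric.closedBall_mem_nhds (0 : ℝ) hε] with t ht
    exact (hslice t ht).aestronglyMeasurable hCm
  · exact (hslice 0 h0).integrableOn_compact hC
  · exact (hc1.comp (Continuous.prodMk_right 0).continuousOn
      fun x hx => ⟨h0, hx⟩).aestronglyMeasurable hCm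
  · filter_upwards [ae_restrict_mem hCm] with x hx t ht
    exact hB (t, x) ⟨ht, hx⟩
  · exact integrableOn_const hC.measure_lt_top.ne
  · filter_upwards [ae_restrict_mem hCm] with x hx t ht
    exact (hasDerivAt_dt (q := (t, x))
      (hL.differentiableAt_of_isOpen hG (hKG ⟨ht, hx⟩))).const_mul _

end ParametricIntegral
end LegendrianWillmore
-- The first variation formula in a chart.
namespace LegendrianWillmore

open MeasureTheory

set_option linter.unusedSectionVars false

theorem energyVar_congr {u V V' : Plane → C3} {x : Plane} (hV : V =ᶠ[nhds x] V') :
    energyVar u V x = energyVar u V' x := by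
  have e : ∀ᶠ y in nhds x, ∀ l, dualFrameVar u V l y = dualFrameVar u V' l y := by
    filter_upwards [hV.eventuallyEq_nhds] with y hy l
    simp [dualFrameVar, metricVar, pd_congr hy]
  have ep : ∀ l, pd l (dualFrameVar u V l) x = pd l (dualFrameVar u V' l) x := fun l =>
    pd_congr (e.mono fun y hy => hy l) l
  simp [energyVar, areaVar, metricVar, ep, pd_congr hV]

theorem energyVarFlux_of_eventuallyEq_zero {u V : Plane → C3} {x : Plane}
    (hV : V =ᶠ[nhds x] fun _ => 0) (l : Fin 2) : energyVarFlux u V l x = 0 := by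
  simp [energyVarFlux, dualFrameVar, metricVar, pd_congr hV, hV.eq_of_nhds]

namespace IsSphereImmersionOn

variable {u : Plane → C3} {Ω : Set Plane} (h : IsSphereImmersionOn u Ω)
include h

theorem smooth_energyVar {V : Plane → C3} (hV : ContDiffOn ℝ ∞ V Ω) :
    ContDiffOn ℝ ∞ (energyVar u V) Ω := by
  have ha : ContDiffOn ℝ ∞ (areaVar u V) Ω :=
    h.smooth_areaElement.mul <| contDiffOn_const.mul <|
      ContDiffOn.sum fun p _ => ContDiffOn.sum fun q _ =>
        (h.smooth_invMetric p q).mul (h.smooth_metricVar hV p q)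
  exact (contDiffOn_const.mul (h.smooth_flatMeanCurv.inner ℝ (ContDiffOn.sum fun l _ =>
    contDiffOn_pd (h.smooth_dualFrameVar hV l) h.isOpen l))).sub
    ((contDiffOn_const.mul (h.smooth_flatMeanCurv.inner ℝ h.smooth_flatMeanCurv)).mul ha)

/-- The divergence form is used to read off smoothness from the current. -/
theorem smooth_willmoreOperator : ContDiffOn ℝ ∞ (willmoreOperator u) Ω := by
  refine ((h.smooth_areaElement.inv fun x hx => (h.areaElement_pos hx).ne').smul
    (ContDiffOn.sum fun l (_ : l ∈ Finset.univ) =>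
      contDiffOn_pd (h.smooth_areaElement.smul (h.smooth_willmoreCurrent l)) h.isOpen l)).congr
    fun x hx => ?_
  change _ = (areaElement u x)⁻¹ • ∑ l, pd l (fun y => areaElement u y • willmoreCurrent u l y) x
  rw [h.sum_pd_willmoreCurrent hx, inv_smul_smul₀ (h.areaElement_pos hx).ne']

/-- Orthogonality to `u` makes the Willmore operator an admissible variation field in the sphere. -/
theorem isNormalAt_willmoreOperator {x : Plane} (hx : x ∈ Ω) :
    IsNormalAt u x (willmoreOperator u x) := by
  have hH := h.isNormalAt_meanCurv hx
  have hL : IsNormalAt u x (normalLaplacian u (meanCurv u) x) :=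
    IsNormalAt.sum fun i _ => IsNormalAt.sum fun j _ => by
      rw [sub_eq_add_neg, ← neg_one_smul ℝ (∑ k, _)]
      exact ((h.isNormalAt_normalConn hx _ i).add ((IsNormalAt.sum fun k _ =>
        (h.isNormalAt_normalConn hx _ k).smul _).smul _)).smul _
  have hQ : IsNormalAt u x (simonsOperator u x (meanCurv u x)) :=
    IsNormalAt.sum fun i _ => IsNormalAt.sum fun j _ => IsNormalAt.sum fun k _ =>
      IsNormalAt.sum fun l _ => (h.isNormalAt_secondFundCoeff hx k l).smul _
  rw [willmoreOperator, sub_eq_add_neg, ← neg_smul]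
  exact ((hL.add hQ).add (hH.smul _)).smul _

/-- The first variation formula for a variation field with compact support in the chart. -/
theorem setIntegral_energyVar {V : Plane → C3} (hV : ContDiffOn ℝ ∞ V Ω) {C : Set Plane}
    (hC : IsCompact C) (hCΩ : C ⊆ Ω) (h0 : ∀ x ∈ Ω, x ∉ C → V x = 0) :
    ∫ x in C, energyVar u V x
      = ∫ x in C, areaElement u x * inner ℝ (willmoreOperator u x) (V x) := by
  have hc1 : ContinuousOn (fun x => areaElement u x * (inner ℝ (willmoreOperator u x) (V x) : ℝ))
      C := (h.smooth_areaElement.mul (h.smooth_willmoreOperator.inner ℝ hV)).continuousOn.mono hCΩ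
  have hc2 : ∀ l, ContinuousOn (pd l (energyVarFlux u V l)) C := fun l =>
    (contDiffOn_pd (h.smooth_energyVarFlux hV l) h.isOpen l).continuousOn.mono hCΩ
  have hY : ∀ l, ∫ x in C, pd l (energyVarFlux u V l) x = 0 := fun l =>
    setIntegral_pd_eq_zero h.isOpen (h.smooth_energyVarFlux hV l) hC hCΩ (fun x hx hxC =>
      energyVarFlux_of_eventuallyEq_zero (Filter.mem_of_superset
        ((h.isOpen.inter hC.isClosed.isOpen_compl).mem_nhds ⟨hx, hxC⟩)
          fun y hy => h0 y hy.1 hy.2) l) l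
  rw [setIntegral_congr_fun hC.isClosed.measurableSet fun x hx => h.energyVar_eq (hCΩ hx) hV,
    integral_add (hc1.integrableOn_compact hC)
      (integrable_finsetSum _ fun l _ => (hc2 l).integrableOn_compact hC),
    integral_finsetSum _ fun l _ => (hc2 l).integrableOn_compact hC]
  simp [hY]

end IsSphereImmersionOn

section Family

variable {M : Type*} [TopologicalSpace M] [T2Space M] [ChartedSpace Plane M]
  [IsManifold (𝓡 2) ∞ M] [MeasurableSpace M] [BorelSpace M]
  {e : OpenPartialHomeomorph M Plane} {f : M → C3}

/-- A smooth family of maps to the unit sphere. -/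
structure IsSmoothFamily (F : ℝ → M → C3) : Prop where
  smooth : ContMDiff (𝓘(ℝ, ℝ).prod (𝓡 2)) 𝓘(ℝ, C3) ∞ (fun q : ℝ × M => F q.1 q.2)
  norm_eq : ∀ t p, ‖F t p‖ = 1

/-- The velocity at time `0` of a family of maps. -/
def velocity (F : ℝ → M → C3) (p : M) : C3 := deriv (fun t => F t p) 0

/-- A family of maps in a chart. -/
def chartFamily (F : ℝ → M → C3) (e : OpenPartialHomeomorph M Plane) (q : ℝ × Plane) : C3 :=
  F q.1 (e.symm q.2)

/-- The set of pairs of a time and a point at which the family is an immersion. -/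
def immersedFamilyTarget (F : ℝ → M → C3) (e : OpenPartialHomeomorph M Plane) :
    Set (ℝ × Plane) := {q | q.2 ∈ immersedTarget (F q.1) e}

/-- `f` is an immersion at all points of `S`, as seen in all charts. -/
def ImmersedOn (f : M → C3) (S : Set M) : Prop :=
  ∀ e ∈ IsManifold.maximalAtlas (𝓡 2) ∞ M, ∀ p ∈ e.source, p ∈ S → e p ∈ immersedTarget f e

namespace IsSmoothFamily

variable {F : ℝ → M → C3} (hF : IsSmoothFamily F)
  (he : e ∈ IsManifold.maximalAtlas (𝓡 2) ∞ M)
include hF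

theorem smooth_at (t : ℝ) : ContMDiff (𝓡 2) 𝓘(ℝ, C3) ∞ (F t) :=
  hF.smooth.comp (contMDiff_const.prodMk contMDiff_id)

theorem hasDerivAt_velocity (p : M) : HasDerivAt (fun t => F t p) (velocity F p) 0 := by
  have h : ContMDiff 𝓘(ℝ, ℝ) 𝓘(ℝ, C3) ∞ (fun t => F t p) :=
    hF.smooth.comp (contMDiff_id.prodMk contMDiff_const)
  exact ((contMDiff_iff_contDiff.1 h).differentiable (by simp)).differentiableAt.hasDerivAt

include he

theorem smooth_chartFamily : ContDiffOn ℝ ∞ (chartFamily F e) (Set.univ ×ˢ e.target) := by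
  have h2 : ContMDiffOn 𝓘(ℝ, ℝ × Plane) (𝓡 2) ∞ (fun q : ℝ × Plane => e.symm q.2)
      (Set.univ ×ˢ e.target) :=
    (contMDiffOn_symm_of_mem_maximalAtlas he).comp contDiff_snd.contMDiff.contMDiffOn
      fun q hq => hq.2
  have h1 : ContMDiffOn 𝓘(ℝ, ℝ × Plane) 𝓘(ℝ, ℝ) ∞ (fun q : ℝ × Plane => q.1)
      (Set.univ ×ˢ e.target) := contDiff_fst.contMDiff.contMDiffOn
  exact contMDiffOn_iff_contDiffOn.1 (hF.smooth.comp_contMDiffOn (h1.prodMk h2))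

theorem isSphereImmersionFamilyOn :
    IsSphereImmersionFamilyOn (chartFamily F e) (immersedFamilyTarget F e) where
  isOpen := by
    have hO : IsOpen (Set.univ ×ˢ e.target : Set (ℝ × Plane)) := isOpen_univ.prod e.open_target
    have hc := fun i => (contDiffOn_dx (hF.smooth_chartFamily he) hO i).continuousOn
    have hd : ContinuousOn (fun q : ℝ × Plane => (metric (F q.1 ∘ e.symm) q.2).det)
        (Set.univ ×ˢ e.target) := by
      simp only [det_metric, metric_apply]
      exact (((hc 0).inner (hc 0)).mul ((hc 1).inner (hc 1))).sub
        (((hc 0).inner (hc 1)).mul ((hc 0).inner (hc 1)))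
    have h := hd.isOpen_inter_preimage hO isOpen_Ioi (t := Set.Ioi 0)
    convert h using 1
    ext q
    simp [immersedFamilyTarget, immersedTarget]
  smooth := (hF.smooth_chartFamily he).mono fun q hq => ⟨trivial, hq.1⟩
  norm_eq q _ := hF.norm_eq _ _
  det_pos q hq := hq.2

theorem dt_chartFamily {x : Plane} (hx : x ∈ e.target) :
    dt (chartFamily F e) (0, x) = velocity F (e.symm x) :=
  (hasDerivAt_dt (q := (0, x)) ((hF.smooth_chartFamily he).differentiableAt_of_isOpen
    (isOpen_univ.prod e.open_target) ⟨trivial, hx⟩)).unique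
      (hF.hasDerivAt_velocity (e.symm x))

theorem smooth_velocity : ContDiffOn ℝ ∞ (velocity F ∘ e.symm) e.target := by
  have h := contDiffOn_dt (hF.smooth_chartFamily he) (isOpen_univ.prod e.open_target)
  exact (h.comp (contDiff_prodMk_right (0 : ℝ)).contDiffOn fun x hx => ⟨trivial, hx⟩).congr
    fun x hx => (hF.dt_chartFamily he hx).symm

/-- Being immersed is an open condition in time and space, and S is compact. Energies are only
compared for such small times, as `F t` may degenerate later. -/
theorem eventually_immersed {S : Set M} (hS : IsCompact S) (hSe : S ⊆ e.source)
    (hi : ImmersedOn (F 0) S) :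
    ∀ᶠ t in nhds (0 : ℝ), ∀ p ∈ S, e p ∈ immersedTarget (F t) e := by
  have hG := (hF.isSphereImmersionFamilyOn he).isOpen
  have h := (isCompact_image hS hSe).eventually_forall_of_forall_eventually
    (P := fun t x => (t, x) ∈ immersedFamilyTarget F e) (x₀ := (0 : ℝ)) (by
      rintro _ ⟨p, hp, rfl⟩
      have h0 : ((0 : ℝ), e p) ∈ immersedFamilyTarget F e := hi e he p (hSe hp) hp
      exact hG.mem_nhds h0)
  filter_upwards [h] with t ht p hp
  exact ht _ ⟨p, hp, rfl⟩

theorem continuousOn_willmoreDensity {t : ℝ} {S : Set M} (hSe : S ⊆ e.source)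
    (hi : ∀ p ∈ S, e p ∈ immersedTarget (F t) e) :
    ContinuousOn (willmoreDensity (F t)) S := by
  have h := isSphereImmersionOn_immersedTarget (hF.smooth_at t) (hF.norm_eq t) he
  have hc : ContinuousOn (fun p => 1 / 4 * ‖meanCurv (F t ∘ e.symm) (e p)‖ ^ 2 + 1) S :=
    (continuousOn_const.mul ((h.smooth_meanCurv.continuousOn.comp
      (e.continuousOn.mono hSe) hi).norm.pow 2)).add continuousOn_const
  exact hc.congr fun p hp => willmoreDensity_eq (hF.smooth_at t) (hF.norm_eq t) he (hSe hp)
    (hi p hp)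

/-- The first variation of the part of the Willmore energy over a compact subset of a chart,
weighted by a fixed function. -/
theorem hasDerivAt_setIntegral {S : Set M} (hS : IsCompact S) (hSe : S ⊆ e.source)
    (hi : ImmersedOn (F 0) S) {φ : M → ℝ} (hφ : ContinuousOn φ S) :
    HasDerivAt (fun t => ∫ p in S, φ p * willmoreDensity (F t) p ∂(areaMeasure (F t)))
      (∫ x in e '' S, φ (e.symm x) * energyVar (F 0 ∘ e.symm) (velocity F ∘ e.symm) x) 0 := by
  have hfam := hF.isSphereImmersionFamilyOn he
  have hC := isCompact_image hS hSe
  have hCt : e '' S ⊆ e.target := image_subset_target hSe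
  have hsymm : ∀ x ∈ e '' S, e.symm x ∈ S := by
    rintro _ ⟨p, hp, rfl⟩; rwa [e.left_inv (hSe hp)]
  have hCG : ∀ x ∈ e '' S, ((0 : ℝ), x) ∈ immersedFamilyTarget F e := by
    rintro _ ⟨p, hp, rfl⟩
    exact hi e he p (hSe hp) hp
  have key := hasDerivAt_setIntegral_of_contDiffOn hfam.isOpen hfam.smooth_energyDensity hC hCG
    (hφ.comp (e.continuousOn_symm.mono hCt) hsymm)
  have e1 : ∫ x in e '' S, φ (e.symm x) * energyVar (F 0 ∘ e.symm) (velocity F ∘ e.symm) x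
      = ∫ x in e '' S, (φ ∘ e.symm) x *
        dt (fun q => energyDensity (fun y => chartFamily F e (q.1, y)) q.2) (0, x) := by
    refine setIntegral_congr_fun hC.isClosed.measurableSet fun x hx => ?_
    have h1 := hasDerivAt_dt (hfam.smooth_energyDensity.differentiableAt_of_isOpen hfam.isOpen
      (hCG x hx))
    have h2 := hfam.hasDerivAt_energyDensity (hCG x hx)
    -- Equality near x, not only at x, is needed because `energyVar` differentiates the field.
    have h3 : (fun y => dt (chartFamily F e) (0, y)) =ᶠ[nhds x] velocity F ∘ e.symm :=
      Filter.mem_of_superset (e.open_target.mem_nhds (hCt hx)) fun y hy =>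
        hF.dt_chartFamily he hy
    change _ * energyVar (fun y => chartFamily F e (0, y)) _ x = _
    rw [← energyVar_congr h3, ← h2.unique h1]
    rfl
  rw [e1]
  refine key.congr_of_eventuallyEq ?_
  filter_upwards [hF.eventually_immersed he hS hSe hi] with t ht
  refine (setIntegral_areaMeasure (hF.smooth_at t) he hS hSe
    (hφ.mul (hF.continuousOn_willmoreDensity he hSe ht))).trans ?_
  refine setIntegral_congr_fun hC.isClosed.measurableSet ?_
  rintro _ ⟨p, hp, rfl⟩
  have hw := willmoreDensity_eq (hF.smooth_at t) (hF.norm_eq t) he (hSe hp) (ht p hp)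
  simp only [e.left_inv (hSe hp), hw, Pi.mul_apply, Function.comp_apply, energyDensity]
  change _ = φ p * ((1 / 4 * ‖meanCurv (F t ∘ e.symm) (e p)‖ ^ 2 + 1) *
    areaElement (F t ∘ e.symm) (e p))
  ring

end IsSmoothFamily
end Family
end LegendrianWillmore
-- Partitions of unity: a vanishing Willmore operator implies criticality.
namespace LegendrianWillmore

open MeasureTheory

set_option linter.unusedSectionVars false

section Global

variable {M : Type*} [TopologicalSpace M] [T2Space M] [ChartedSpace Plane M]
  [IsManifold (𝓡 2) ∞ M] [MeasurableSpace M] [BorelSpace M]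
  {e : OpenPartialHomeomorph M Plane} {f : M → C3}

/-- The functions `φᵢ` form a smooth partition of unity on `K`, with supports in the domains of the
charts `cᵢ`. -/
structure IsChartPartition {ι : Type*} [Fintype ι] (c : ι → OpenPartialHomeomorph M Plane)
    (φ : ι → M → ℝ) (K : Set M) : Prop where
  mem_atlas : ∀ i, c i ∈ IsManifold.maximalAtlas (𝓡 2) ∞ M
  smooth : ∀ i, ContMDiff (𝓡 2) 𝓘(ℝ, ℝ) ∞ (φ i)
  subset_source : ∀ i, K ∩ tsupport (φ i) ⊆ (c i).source
  sum_eq_one : ∀ p ∈ K, ∑ i, φ i p = 1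

theorem exists_isChartPartition [SecondCountableTopology M] {K : Set M} (hK : IsCompact K) :
    ∃ (s : Finset M) (φ : s → M → ℝ),
      IsChartPartition (fun i : s => chartAt Plane (i : M)) φ K := by
  have : LocallyCompactSpace M := ChartedSpace.locallyCompactSpace Plane M
  obtain ⟨s, -, hs⟩ := hK.elim_nhds_subcover (fun p : M => (chartAt Plane p).source)
    fun p _ => (chartAt Plane p).open_source.mem_nhds (mem_chart_source Plane p)
  obtain ⟨φ, hφ⟩ := SmoothPartitionOfUnity.exists_isSubordinate (𝓡 2) hK.isClosed
    (fun i : s => (chartAt Plane (i : M)).source) (fun i => (chartAt Plane (i : M)).open_source)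
    (hs.trans fun p hp => by
      obtain ⟨i, hi, hp⟩ := Set.mem_iUnion₂.1 hp
      exact Set.mem_iUnion.2 ⟨⟨i, hi⟩, hp⟩)
  refine ⟨s, fun i => φ i, fun i => IsManifold.chart_mem_maximalAtlas _,
    fun i => (φ i).contMDiff, fun i => Set.inter_subset_right.trans (hφ i), fun p hp => ?_⟩
  rw [← φ.sum_eq_one hp, finsum_eq_sum_of_fintype]

namespace IsChartPartition

variable {ι : Type*} [Fintype ι] {c : ι → OpenPartialHomeomorph M Plane} {φ : ι → M → ℝ}
  {K K' : Set M}

theorem mono (h : IsChartPartition c φ K) (hK : K' ⊆ K) : IsChartPartition c φ K' where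
  mem_atlas := h.mem_atlas
  smooth := h.smooth
  subset_source i := (Set.inter_subset_inter_left _ hK).trans (h.subset_source i)
  sum_eq_one p hp := h.sum_eq_one p (hK hp)

/-- The energy over K is split by ∑ φᵢ = 1 into integrals over compact subsets of charts, each of
which has a known derivative. The weights do not depend on time, so they are not differentiated. -/
theorem hasDerivAt_willmoreEnergy (h : IsChartPartition c φ K) (hK : IsCompact K)
    {F : ℝ → M → C3} (hF : IsSmoothFamily F) (hi : ImmersedOn (F 0) K) :
    HasDerivAt (fun t => willmoreEnergy (F t) K) (∑ i, ∫ x in c i '' (K ∩ tsupport (φ i)),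
      φ i ((c i).symm x) * energyVar (F 0 ∘ (c i).symm) (velocity F ∘ (c i).symm) x) 0 := by
  have hS : ∀ i, IsCompact (K ∩ tsupport (φ i)) := fun i => hK.inter_right (isClosed_tsupport _)
  have hiS : ∀ i, ImmersedOn (F 0) (K ∩ tsupport (φ i)) :=
    fun i e he p hp hpS => hi e he p hp hpS.1
  have key := HasDerivAt.fun_sum fun i (_ : i ∈ Finset.univ) => hF.hasDerivAt_setIntegral
    (h.mem_atlas i) (hS i) (h.subset_source i) (hiS i) (h.smooth i).continuous.continuousOn
  refine key.congr_of_eventuallyEq ?_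
  have hev := Filter.eventually_all.2 fun i =>
    hF.eventually_immersed (h.mem_atlas i) (hS i) (h.subset_source i) (hiS i)
  filter_upwards [hev] with t ht
  have hz : ∀ i, ∀ p ∈ K \ (K ∩ tsupport (φ i)), φ i p * willmoreDensity (F t) p = 0 :=
    fun i p hp => by
      rw [image_eq_zero_of_notMem_tsupport fun hps => hp.2 ⟨hp.1, hps⟩, zero_mul]
  have hint : ∀ i, IntegrableOn (fun p => φ i p * willmoreDensity (F t) p) K
      (areaMeasure (F t)) := fun i =>
    (integrableOn_areaMeasure (hF.smooth_at t) (hS i) ((h.smooth i).continuous.continuousOn.mul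
      (hF.continuousOn_willmoreDensity (h.mem_atlas i) (h.subset_source i)
        (ht i)))).of_forall_sdiff_eq_zero hK.isClosed.measurableSet (hz i)
  calc willmoreEnergy (F t) K
      = ∫ p in K, ∑ i, φ i p * willmoreDensity (F t) p ∂(areaMeasure (F t)) :=
        setIntegral_congr_fun hK.isClosed.measurableSet fun p hp => by
          simp only [← Finset.sum_mul, h.sum_eq_one p hp, one_mul]
    _ = ∑ i, ∫ p in K, φ i p * willmoreDensity (F t) p ∂(areaMeasure (F t)) :=
        integral_finsetSum _ fun i _ => hint i
    _ = _ := Finset.sum_congr rfl fun i _ =>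
        (setIntegral_eq_of_subset_of_forall_sdiff_eq_zero hK.isClosed.measurableSet
          Set.inter_subset_left (hz i)).trans rfl

end IsChartPartition

theorem IsSmoothFamily.hasDerivAt_willmoreEnergy {F : ℝ → M → C3} (hF : IsSmoothFamily F)
    (he : e ∈ IsManifold.maximalAtlas (𝓡 2) ∞ M) {K : Set M} (hK : IsCompact K)
    (hKe : K ⊆ e.source) (hi : ImmersedOn (F 0) K) :
    HasDerivAt (fun t => willmoreEnergy (F t) K)
      (∫ x in e '' K, energyVar (F 0 ∘ e.symm) (velocity F ∘ e.symm) x) 0 := by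
  have key := hF.hasDerivAt_setIntegral he hK hKe hi (continuousOn_const (c := (1 : ℝ)))
  simp only [one_mul] at key
  exact key

omit [T2Space M] [MeasurableSpace M] [BorelSpace M] in
theorem ImmersedOn.immersedTarget_eq (hi : ImmersedOn f Set.univ)
    (he : e ∈ IsManifold.maximalAtlas (𝓡 2) ∞ M) : immersedTarget f e = e.target :=
  Set.Subset.antisymm (fun _ hx => hx.1) fun x hx => by
    have := hi e he (e.symm x) (e.map_target hx) trivial
    rwa [e.right_inv hx] at this

/-- The first variation formula for variations with compact support in a chart. -/
theorem setIntegral_energyVar_chart (hf : ContMDiff (𝓡 2) 𝓘(ℝ, C3) ∞ f)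
    (hn : ∀ p, ‖f p‖ = 1) (hi : ImmersedOn f Set.univ)
    (he : e ∈ IsManifold.maximalAtlas (𝓡 2) ∞ M) {V : M → C3}
    (hV : ContDiffOn ℝ ∞ (V ∘ e.symm) e.target) {S : Set M} (hS : IsCompact S)
    (hSe : S ⊆ e.source) (h0 : ∀ p ∉ S, V p = 0) :
    ∫ x in e '' S, energyVar (f ∘ e.symm) (V ∘ e.symm) x
      = ∫ x in e '' S, areaElement (f ∘ e.symm) x
          * inner ℝ (willmoreOperator (f ∘ e.symm) x) (V (e.symm x)) := by
  have h := isSphereImmersionOn_immersedTarget hf hn he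
  rw [hi.immersedTarget_eq he] at h
  exact h.setIntegral_energyVar hV (isCompact_image hS hSe) (image_subset_target hSe)
    fun x hx hxS => h0 _ fun hxs => hxS ⟨_, hxs, e.right_inv hx⟩

/-- A map to the sphere with vanishing Willmore operator is a critical point. -/
theorem isWillmore_of_willmoreOperator_eq_zero [SecondCountableTopology M]
    (hf : ContMDiff (𝓡 2) 𝓘(ℝ, C3) ∞ f)
    (hn : ∀ p, ‖f p‖ = 1) (hi : ImmersedOn f Set.univ)
    (hW : ∀ e ∈ IsManifold.maximalAtlas (𝓡 2) ∞ M, ∀ p ∈ e.source,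
      willmoreOperator (f ∘ e.symm) (e p) = 0) : IsWillmore f := by
  intro K F hv
  have hF : IsSmoothFamily F := ⟨hv.smooth, hv.mem_sphere⟩
  have hK := hv.isCompact
  have hi0 : ∀ S, ImmersedOn f S := fun S e he p hp _ => hi e he p hp trivial
  obtain ⟨s, φ, hP⟩ := exists_isChartPartition hK
  set c : s → OpenPartialHomeomorph M Plane := fun i => chartAt Plane (i : M)
  have hD := hP.hasDerivAt_willmoreEnergy hK hF (by rw [hv.start]; exact hi0 K)
  rw [hv.start] at hD
  convert hD using 1
  symm
  have hV0 : ∀ p ∉ K, velocity F p = 0 := fun p hp => by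
    simp only [velocity, hv.support _ p hp, deriv_const]
  set S : s → Set M := fun i => K ∩ tsupport (φ i) with hSdef
  have hS : ∀ i, IsCompact (S i) := fun i => hK.inter_right (isClosed_tsupport _)
  have hSc : ∀ i, S i ⊆ (c i).source := hP.subset_source
  -- The weights φᵢ already split the integral; a second use of the same partition splits the field,
  -- giving double sums over i and j.
  set V : s → M → C3 := fun j p => φ j p • velocity F p with hVdef
  have hVS : ∀ j, ∀ p ∉ S j, V j p = 0 := fun j p hp => by
    by_cases hpK : p ∈ K
    · simp only [hVdef, image_eq_zero_of_notMem_tsupport fun hps => hp ⟨hpK, hps⟩, zero_smul]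
    · simp only [hVdef, hV0 p hpK, smul_zero]
  have hVsum : velocity F = fun p => ∑ j, V j p := funext fun p => by
    by_cases hpK : p ∈ K
    · simp only [hVdef, ← Finset.sum_smul, hP.sum_eq_one p hpK, one_smul]
    · simp only [hVdef, hV0 p hpK, smul_zero, Finset.sum_const_zero]
  have hVs : ∀ i j, ContDiffOn ℝ ∞ (V j ∘ (c i).symm) (c i).target := fun i j =>
    (contDiffOn_comp_symm (hP.smooth j) (hP.mem_atlas i)).smul
      (hF.smooth_velocity (hP.mem_atlas i))
  have hu : ∀ i, IsSphereImmersionOn (f ∘ (c i).symm) (c i).target := fun i => by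
    have h := isSphereImmersionOn_immersedTarget hf hn (hP.mem_atlas i)
    rwa [hi.immersedTarget_eq (hP.mem_atlas i)] at h
  have hφc : ∀ i, ContinuousOn (fun x => φ i ((c i).symm x)) (c i).target := fun i =>
    (contDiffOn_comp_symm (hP.smooth i) (hP.mem_atlas i)).continuousOn
  have hCm : ∀ i, MeasurableSet (c i '' S i) := fun i =>
    (isCompact_image (hS i) (hSc i)).isClosed.measurableSet
  have hsplit : ∀ i, ∫ x in c i '' S i, φ i ((c i).symm x) *
      energyVar (f ∘ (c i).symm) (velocity F ∘ (c i).symm) x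
      = ∑ j, ∫ x in c i '' S i, φ i ((c i).symm x) *
        energyVar (f ∘ (c i).symm) (V j ∘ (c i).symm) x := fun i => by
    rw [← integral_finsetSum]
    · refine setIntegral_congr_fun (hCm i) fun x hx => ?_
      have := (hu i).energyVar_sum (image_subset_target (hSc i) hx) Finset.univ
        (V := fun j => V j ∘ (c i).symm) fun j _ => hVs i j
      simp only [← Finset.mul_sum, ← this]
      rw [hVsum]
      rfl
    · exact fun j _ => (((hφc i).mul ((hu i).smooth_energyVar (hVs i j)).continuousOn).mono
        (image_subset_target (hSc i))).integrableOn_compact (isCompact_image (hS i) (hSc i))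
  have hloc : ∀ i j, ∫ x in c i '' S i, φ i ((c i).symm x) *
        energyVar (f ∘ (c i).symm) (V j ∘ (c i).symm) x
      = ∫ x in c i '' (S j ∩ tsupport (φ i)), φ i ((c i).symm x) *
        energyVar (f ∘ (c i).symm) (V j ∘ (c i).symm) x := fun i j => by
    refine setIntegral_eq_of_subset_of_forall_sdiff_eq_zero (hCm i)
      (Set.image_mono fun p hp => ⟨hp.1.1, hp.2⟩) ?_
    rintro _ ⟨⟨p, hp, rfl⟩, hpn⟩
    have hpS : p ∉ S j := fun hpj => hpn ⟨p, ⟨hpj, hp.2⟩, rfl⟩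
    have hpo : c i p ∈ (c i).target ∩ (c i).symm ⁻¹' (S j)ᶜ :=
      ⟨(c i).map_source (hSc i hp), by
        rw [Set.mem_preimage, (c i).left_inv (hSc i hp)]; exact hpS⟩
    have hz : V j ∘ (c i).symm =ᶠ[nhds (c i p)] fun _ => 0 := Filter.mem_of_superset
      (((c i).isOpen_inter_preimage_symm (hS j).isClosed.isOpen_compl).mem_nhds hpo)
      fun y hy => hVS j _ hy.2
    rw [energyVar_of_eventuallyEq_zero hz, mul_zero]
  -- For fixed j the sum over i is the derivative of an actual energy: slowing the time of F by φⱼ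
  -- gives a family with velocity φⱼ times that of F. Its energy over Sⱼ is also differentiable in
  -- the single chart j, and uniqueness of the derivative identifies the two values without
  -- transforming `energyVar` between charts. In the single chart the integral is that of √g⟪W, Vⱼ⟫,
  -- which vanishes.
  have hj : ∀ j, ∑ i, ∫ x in c i '' (S j ∩ tsupport (φ i)), φ i ((c i).symm x) *
        energyVar (f ∘ (c i).symm) (V j ∘ (c i).symm) x = 0 := fun j => by
    set Fj : ℝ → M → C3 := fun t p => F (t * φ j p) p with hFj
    have hFjs : IsSmoothFamily Fj := by
      refine ⟨?_, fun t p => hv.mem_sphere _ p⟩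
      have hφj : ContMDiff (𝓘(ℝ, ℝ).prod (𝓡 2)) 𝓘(ℝ, ℝ) ∞ (fun q : ℝ × M => q.1 * φ j q.2) :=
        contMDiff_fst.mul ((hP.smooth j).comp contMDiff_snd)
      exact hv.smooth.comp (hφj.prodMk contMDiff_snd)
    have hFj0 : Fj 0 = f := by
      rw [← hv.start]; funext p; simp [hFj]
    have hFjv : velocity Fj = V j := funext fun p => by
      have h1 : HasDerivAt (fun t : ℝ => t * φ j p) (φ j p) 0 := by
        simpa using (hasDerivAt_id (0 : ℝ)).mul_const (φ j p)
      have h2 : HasDerivAt (fun t => F t p) (velocity F p) ((0 : ℝ) * φ j p) := by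
        rw [zero_mul]; exact hF.hasDerivAt_velocity p
      exact (HasDerivAt.scomp (0 : ℝ) h2 h1).deriv
    have d1 := (hP.mono (K' := S j) Set.inter_subset_left).hasDerivAt_willmoreEnergy (hS j) hFjs
      (by rw [hFj0]; exact hi0 _)
    have d2 := hFjs.hasDerivAt_willmoreEnergy (hP.mem_atlas j) (hS j) (hSc j)
      (by rw [hFj0]; exact hi0 _)
    rw [hFj0, hFjv] at d1 d2
    rw [d1.unique d2, setIntegral_energyVar_chart hf hn hi (hP.mem_atlas j) (hVs j j) (hS j)
      (hSc j) (hVS j)]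
    refine setIntegral_eq_zero_of_forall_eq_zero ?_
    rintro _ ⟨p, hp, rfl⟩
    rw [hW _ (hP.mem_atlas j) p (hSc j hp), inner_zero_left, mul_zero]
  calc _ = ∑ i, ∑ j, ∫ x in c i '' (S j ∩ tsupport (φ i)), φ i ((c i).symm x) *
        energyVar (f ∘ (c i).symm) (V j ∘ (c i).symm) x :=
      Finset.sum_congr rfl fun i _ => (hsplit i).trans (Finset.sum_congr rfl fun j _ => hloc i j)
    _ = 0 := by rw [Finset.sum_comm]; exact Finset.sum_eq_zero fun j _ => hj j

end Global
end LegendrianWillmore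
-- Test variations: criticality implies a vanishing Willmore operator.
namespace LegendrianWillmore

open MeasureTheory

set_option linter.unusedSectionVars false

theorem setIntegral_pos_of_continuousOn {C : Set Plane} (hC : IsCompact C) {g : Plane → ℝ}
    (hg : ContinuousOn g C) (h0 : ∀ x ∈ C, 0 ≤ g x) {x : Plane} (hx : C ∈ nhds x)
    (hgx : g x ≠ 0) : 0 < ∫ y in C, g y := by
  refine (setIntegral_pos_iff_support_of_nonneg_ae
    (ae_restrict_of_forall_mem hC.isClosed.measurableSet h0) (hg.integrableOn_compact hC)).2 ?_
  exact Measure.measure_pos_of_mem_nhds _ (Filter.inter_mem ((hg.continuousAt hx).eventually_ne hgx) hx)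

section Variation

variable {M : Type*} [TopologicalSpace M] [ChartedSpace Plane M] {f : M → C3}

/-- The variation of a map to the unit sphere in the direction of the field `X`, pushed back to
the sphere by rescaling. -/
def sphereVariation (f X : M → C3) (t : ℝ) (p : M) : C3 :=
  (√(1 + t ^ 2 * inner ℝ (X p) (X p)))⁻¹ • (f p + t • X p)

theorem one_add_sq_mul_inner_pos (t : ℝ) (v : C3) : 0 < 1 + t ^ 2 * (inner ℝ v v : ℝ) := by
  have := mul_nonneg (sq_nonneg t) (real_inner_self_nonneg (x := v))
  linarith

theorem contDiff_sphereVariation : ContDiff ℝ ∞ (fun q : ℝ × C3 × C3 =>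
    (√(1 + q.1 ^ 2 * (inner ℝ q.2.2 q.2.2 : ℝ)))⁻¹ • (q.2.1 + q.1 • q.2.2)) := by
  have hv : ContDiff ℝ ∞ (fun q : ℝ × C3 × C3 => q.2.2) := contDiff_snd.snd
  have h1 : ContDiff ℝ ∞ (fun q : ℝ × C3 × C3 => 1 + q.1 ^ 2 * (inner ℝ q.2.2 q.2.2 : ℝ)) :=
    contDiff_const.add ((contDiff_fst.pow 2).mul (hv.inner ℝ hv))
  exact ((h1.sqrt fun q => (one_add_sq_mul_inner_pos _ _).ne').inv fun q =>
    (Real.sqrt_pos.2 (one_add_sq_mul_inner_pos _ _)).ne').smul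
      (contDiff_snd.fst.add (contDiff_fst.smul hv))

theorem isVariation_sphereVariation {X : M → C3} (hf : ContMDiff (𝓡 2) 𝓘(ℝ, C3) ∞ f)
    (hn : ∀ p, ‖f p‖ = 1) (hX : ContMDiff (𝓡 2) 𝓘(ℝ, C3) ∞ X)
    (hXf : ∀ p, inner ℝ (X p) (f p) = (0 : ℝ)) {K : Set M} (hK : IsCompact K)
    (h0 : ∀ p ∉ K, X p = 0) : IsVariation f K (sphereVariation f X) where
  smooth := by
    have h : ContMDiff (𝓘(ℝ, ℝ).prod (𝓡 2)) 𝓘(ℝ, ℝ × C3 × C3) ∞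
        (fun q : ℝ × M => (q.1, f q.2, X q.2)) :=
      contMDiff_fst.prodMk_space
        ((hf.comp contMDiff_snd).prodMk_space (hX.comp contMDiff_snd))
    exact (contDiff_sphereVariation.comp_contMDiff h :)
  mem_sphere t p := by
    -- X is orthogonal to f, so Pythagoras gives the rescaling factor; it never vanishes, and the
    -- variation exists for all times.
    have h : ‖f p + t • X p‖ ^ 2 = 1 + t ^ 2 * inner ℝ (X p) (X p) := by
      rw [norm_add_sq_real, hn, inner_smul_right, real_inner_comm, hXf, norm_smul, mul_pow,
        real_inner_self_eq_norm_sq, Real.norm_eq_abs, sq_abs]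
      ring
    have hs := Real.sqrt_pos.2 (one_add_sq_mul_inner_pos t (X p))
    rw [sphereVariation, norm_smul, ← h, Real.sqrt_sq (norm_nonneg _), norm_inv, norm_norm]
    refine inv_mul_cancel₀ ?_
    rw [← h, Real.sqrt_sq (norm_nonneg _)] at hs
    exact hs.ne'
  start := by funext p; simp [sphereVariation]
  isCompact := hK
  support t p hp := by simp [sphereVariation, h0 p hp]

theorem velocity_sphereVariation (X : M → C3) :
    velocity (sphereVariation f X) = X := funext fun p => by
  -- The rescaling is of second order in t, so it does not affect the velocity at 0.
  have h1 : HasDerivAt (fun t : ℝ => 1 + t ^ 2 * (inner ℝ (X p) (X p) : ℝ)) 0 0 := by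
    have := (((hasDerivAt_id (0 : ℝ)).pow 2).mul_const (inner ℝ (X p) (X p) : ℝ)).const_add 1
    simpa using this
  have h2 := ((h1.sqrt (one_add_sq_mul_inner_pos 0 (X p)).ne').inv
    (Real.sqrt_pos.2 (one_add_sq_mul_inner_pos 0 (X p))).ne').smul
      (((hasDerivAt_id (0 : ℝ)).smul_const (X p)).const_add (f p))
  have h3 := h2.deriv
  simp only [velocity, sphereVariation]
  refine Eq.trans ?_ (h3.trans ?_)
  · rfl
  · simp

end Variation

section Converse

variable {M : Type*} [TopologicalSpace M] [T2Space M] [ChartedSpace Plane M]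
  [IsManifold (𝓡 2) ∞ M] [MeasurableSpace M] [BorelSpace M]
  {e : OpenPartialHomeomorph M Plane} {f : M → C3}

/-- The field χW, with χ a bump function supported in the chart, makes the first variation the
integral of √g χ|W|², which is positive if W is nonzero at the centre of χ. -/
theorem IsWillmore.willmoreOperator_eq_zero (hW : IsWillmore f)
    (hf : ContMDiff (𝓡 2) 𝓘(ℝ, C3) ∞ f) (hn : ∀ p, ‖f p‖ = 1) (hi : ImmersedOn f Set.univ)
    (he : e ∈ IsManifold.maximalAtlas (𝓡 2) ∞ M) {p : M} (hp : p ∈ e.source) :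
    willmoreOperator (f ∘ e.symm) (e p) = 0 := by
  by_contra hne
  have hu := isSphereImmersionOn_immersedTarget hf hn he
  rw [hi.immersedTarget_eq he] at hu
  obtain ⟨χ, -, hχe⟩ := (SmoothBumpFunction.nhds_basis_tsupport (I := 𝓡 2) p).mem_iff.1
    (e.open_source.mem_nhds hp)
  set W : M → C3 := fun q => willmoreOperator (f ∘ e.symm) (e q) with hWdef
  set K : Set M := tsupport χ with hKdef
  have hK : IsCompact K := χ.hasCompactSupport
  set X : M → C3 := fun q => χ q • W q with hXdef
  have hX0 : ∀ q ∉ K, X q = 0 := fun q hq => by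
    simp only [hXdef, image_eq_zero_of_notMem_tsupport hq, zero_smul]
  have hX : ContMDiff (𝓡 2) 𝓘(ℝ, C3) ∞ X := contMDiff_of_tsupport fun q hq => by
    have hqe : q ∈ e.source := hχe (tsupport_smul_subset_left _ _ hq)
    have hWs : ContMDiffOn (𝓡 2) 𝓘(ℝ, C3) ∞ W e.source :=
      hu.smooth_willmoreOperator.contMDiffOn.comp (contMDiffOn_of_mem_maximalAtlas he)
        e.mapsTo
    exact χ.contMDiffAt.smul (hWs.contMDiffAt (e.open_source.mem_nhds hqe))
  have hXf : ∀ q, inner ℝ (X q) (f q) = (0 : ℝ) := fun q => by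
    by_cases hq : q ∈ K
    · have h := (hu.isNormalAt_willmoreOperator (e.map_source (hχe hq))).2
      rw [Function.comp_apply, e.left_inv (hχe hq)] at h
      simp only [hXdef, inner_smul_left, hWdef, h, mul_zero]
    · rw [hX0 q hq, inner_zero_left]
  have hv := isVariation_sphereVariation hf hn hX hXf hK hX0
  have hF : IsSmoothFamily (sphereVariation f X) := ⟨hv.smooth, hv.mem_sphere⟩
  have d := hF.hasDerivAt_willmoreEnergy he hK hχe
    (by rw [hv.start]; exact fun e he p hp _ => hi e he p hp trivial)
  rw [hv.start, velocity_sphereVariation] at d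
  have hXs : ContDiffOn ℝ ∞ (X ∘ e.symm) e.target := contDiffOn_comp_symm hX he
  have h0 := (hW K _ hv).unique d
  rw [setIntegral_energyVar_chart hf hn hi he hXs hK hχe hX0] at h0
  have heK : e '' K ⊆ e.target := image_subset_target hχe
  refine (setIntegral_pos_of_continuousOn (isCompact_image hK hχe)
    (((hu.smooth_areaElement.mul (hu.smooth_willmoreOperator.inner ℝ hXs)).continuousOn.mono heK))
    ?_ (e.image_mem_nhds hp χ.tsupport_mem_nhds) ?_).ne h0
  · rintro _ ⟨q, hq, rfl⟩
    refine mul_nonneg (hu.areaElement_pos (e.map_source (hχe hq))).le ?_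
    simp only [Function.comp_apply, e.left_inv (hχe hq), hXdef, inner_smul_right]
    exact mul_nonneg χ.nonneg real_inner_self_nonneg
  · refine mul_ne_zero (hu.areaElement_pos (e.map_source hp)).ne' ?_
    simp only [Function.comp_apply, e.left_inv hp, hXdef, inner_smul_right, χ.eq_one, one_mul]
    exact inner_self_ne_zero.2 hne

end Converse

/-! ### From Legendrian immersions of the surface to their chart expressions. -/

section Legendrian

variable {M : Type*} [TopologicalSpace M] [ChartedSpace Plane M]
  [IsManifold (𝓡 2) ∞ M] {e : OpenPartialHomeomorph M Plane} {f : M → C3}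

theorem fderiv_comp_symm (hf : ContMDiff (𝓡 2) 𝓘(ℝ, C3) ∞ f)
    (he : e ∈ IsManifold.maximalAtlas (𝓡 2) ∞ M) {x : Plane} (hx : x ∈ e.target) (v : Plane) :
    fderiv ℝ (f ∘ e.symm) x v
      = mfderiv (𝓡 2) 𝓘(ℝ, C3) f (e.symm x) (mfderiv (𝓡 2) (𝓡 2) e.symm x v) := by
  have hs : MDifferentiableAt (𝓡 2) (𝓡 2) e.symm x :=
    ((contMDiffOn_symm_of_mem_maximalAtlas he).contMDiffAt
      (e.open_target.mem_nhds hx)).mdifferentiableAt (by simp)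
  rw [← mfderiv_eq_fderiv]
  exact congrArg (fun L : TangentSpace (𝓡 2) x →L[ℝ] C3 => L v)
    (mfderiv_comp x (hf.mdifferentiable (by simp) _) hs)

theorem det_metric_pos {u : Plane → C3} {x : Plane}
    (h : Function.Injective (fderiv ℝ u x)) : 0 < (metric u x).det := by
  have hc : ∀ a b : ℝ, a • pd 0 u x + b • pd 1 u x = 0 → a = 0 ∧ b = 0 := fun a b hab => by
    have h1 : fderiv ℝ u x
        (a • EuclideanSpace.single 0 1 + b • EuclideanSpace.single 1 1) = fderiv ℝ u x 0 := by
      rw [map_add, map_smul, map_smul, map_zero]; exact hab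
    have h2 := h h1
    exact ⟨by simpa using congrArg (fun z : Plane => z 0) h2,
      by simpa using congrArg (fun z : Plane => z 1) h2⟩
  have h0 : pd 0 u x ≠ 0 := fun h0 => one_ne_zero (hc 1 0 (by simp [h0])).1
  set a : ℝ := inner ℝ (pd 0 u x) (pd 0 u x) with ha
  set b : ℝ := inner ℝ (pd 0 u x) (pd 1 u x) with hb
  have ha0 : 0 < a := real_inner_self_pos.2 h0
  -- This vector is a times the component of ∂₁u orthogonal to ∂₀u, with squared length a · det g;
  -- independence of ∂₀u and ∂₁u makes it nonzero.
  have hw : a • pd 1 u x - b • pd 0 u x ≠ 0 := fun hw =>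
    ha0.ne' (hc (-b) a (by rw [neg_smul, neg_add_eq_sub]; exact hw)).2
  have hw0 := real_inner_self_pos.2 hw
  have hk : (inner ℝ (a • pd 1 u x - b • pd 0 u x) (a • pd 1 u x - b • pd 0 u x) : ℝ)
      = a * (metric u x).det := by
    rw [det_metric]
    simp only [metric_apply, inner_sub_left, inner_sub_right, real_inner_smul_left,
      real_inner_smul_right, real_inner_comm (pd 0 u x) (pd 1 u x), ← ha, ← hb]
    ring
  rw [hk] at hw0
  exact pos_of_mul_pos_right hw0 ha0.le

namespace IsLegendrianImmersion

variable (hf : IsLegendrianImmersion f)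
include hf

theorem immersedOn : ImmersedOn f Set.univ := fun e he p hp _ => by
  refine ⟨e.map_source hp, det_metric_pos fun v w hvw => ?_⟩
  have hx := e.map_source hp
  rw [fderiv_comp_symm hf.smooth he hx, fderiv_comp_symm hf.smooth he hx] at hvw
  have hd : e.MDifferentiable (𝓡 2) (𝓡 2) :=
    ⟨(contMDiffOn_of_mem_maximalAtlas he).mdifferentiableOn (by simp),
      (contMDiffOn_symm_of_mem_maximalAtlas he).mdifferentiableOn (by simp)⟩
  exact hd.symm.mfderiv_injective hx (hf.immersion _ hvw)

theorem isLegendrianOn (he : e ∈ IsManifold.maximalAtlas (𝓡 2) ∞ M) :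
    IsLegendrianOn (f ∘ e.symm) e.target where
  toIsSphereImmersionOn := by
    have h := isSphereImmersionOn_immersedTarget hf.smooth hf.mem_sphere he
    rwa [hf.immersedOn.immersedTarget_eq he] at h
  inner_pd_I_self x hx i := by
    have h : ∀ z v : C3, contactForm z v = 0 → inner ℝ v (Complex.I • z) = (0 : ℝ) :=
      fun z v hzv => by rwa [contactForm, reeb, inner_neg_right, neg_eq_zero] at hzv
    rw [pd, fderiv_comp_symm hf.smooth he hx]
    exact h _ _ (hf.legendrian (e.symm x) _)

end IsLegendrianImmersion
end Legendrian
end LegendrianWillmore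

end
open LegendrianWillmore in
theorem proposition3p1 {M : Type*} [TopologicalSpace M] [T2Space M] [SecondCountableTopology M]
    [ChartedSpace Plane M] [IsManifold (𝓡 2) ∞ M] [MeasurableSpace M] [BorelSpace M]
    (f : M → C3) (hf : IsLegendrianImmersion f) :
    (∀ e ∈ IsManifold.maximalAtlas (𝓡 2) ∞ M, ∀ p ∈ e.source,
      willmoreOperator (f ∘ e.symm) (e p) =
        (1 / 2 : ℝ) • legendrianWillmoreField (f ∘ e.symm) (e p)) ∧
    (IsWillmore f ↔
      ∀ e ∈ IsManifold.maximalAtlas (𝓡 2) ∞ M, ∀ p ∈ e.source,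
        legendrianWillmoreField (f ∘ e.symm) (e p) = 0) := by
  have heq : ∀ e ∈ IsManifold.maximalAtlas (𝓡 2) ∞ M, ∀ p ∈ e.source,
      willmoreOperator (f ∘ e.symm) (e p) =
        (1 / 2 : ℝ) • legendrianWillmoreField (f ∘ e.symm) (e p) := fun e he p hp =>
    (hf.isLegendrianOn he).willmoreOperator_eq (e.map_source hp)
  refine ⟨heq, fun hW e he p hp => ?_, fun h => ?_⟩
  · have h0 := hW.willmoreOperator_eq_zero hf.smooth hf.mem_sphere hf.immersedOn he hp
    rw [heq e he p hp] at h0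
    exact (smul_eq_zero.1 h0).resolve_left (by norm_num)
  · exact isWillmore_of_willmoreOperator_eq_zero hf.smooth hf.mem_sphere hf.immersedOn
      fun e he p hp => by rw [heq e he p hp, h e he p hp, smul_zero]
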